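/- \textbf{Conventions.} $\mathbb R^3$ and $\mathbb N^3\subset\mathbb R^3$ carry the max-norm, $\|h\|_1=\sup_x\|h(x)\|+\sup_x\|Dh(x)\|$ (possibly $\infty$, $\|Dh(x)\|$ the operator norm), and the $\theta$-neighborhood of $f$ is $\mathcal N_\theta(f)=\{g\in C^1(\mathbb R^3;\mathbb R^3):\|g-f\|_1<\theta\}$. A sink of $g$ is a fixed point at which all (complex) eigenvalues of the Jacobian matrix of $g$ have absolute value $<1$; its basin of attraction is the set of the $x$ with $g^{[j]}(x)\to$ the sink. Computability of points, of maps and of sets is that of computable analysis (oracle Turing machines). A name of a continuous map consists of rational approximations of its values at the rational points and of moduli of uniform continuity on balls; a $C^1$-name of $f$ consists of names of $f$ and of its partial derivatives. An open set $U\subseteq\mathbb R^3$ is computable if it is the union of a computable sequence of open rational balls and the closed rational balls disjoint from $U$ can be listed computably. A Turing machine $M$ has states $1,\dots,m$ (initial state $1$, halting state $m$, in which it does nothing any more) and tape symbols $0,\dots,b-1$ with $b\ge2$ and $0$ the blank. A configuration is coded as $(w_1,w_2,q)\in\mathbb N^3$, where $q$ is the state and $w_1$, $w_2$ are the base-$b$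 codes of the part of the tape to the left of the head, and of the part from the head to the right. Its transition function is denoted by $f_M$. Input words contain no blank, and the initial configuration on input $w$ is $(0,w,1)$. $M$ is called universal if there is a computable way to assign to each partial recursive function $\varphi$ (given by a program) and each $n\in\mathbb N$ an input on which $M$ halts if and only if $\varphi(n)$ is defined; moreover, $M$ is assumed to clear its tape before halting, so that from every input $s=(0,0,m)$ is the only halting configuration that it can reach. ``$M$ halts on $x_0$'' means that it reaches $s$ from the configuration $x_0$. For $\lambda\in(0,1)\cap\mathbb Q$ and $0<\delta<\epsilon<\frac12$, a map $f:\mathbb R^3\to\mathbb R^3$ is called a robust simulation of $M$ if $f$ is analytic and computable; $f(x_0)=f_M(x_0)$ for all configurations $x_0$; $s$ is a sink of $f$; $\|f(x)-f(x_0)\|\le\lambda\|x-x_0\|$ whenever $x_0$ is a configuration and $\|x-x_0\|\le\frac14$; and, for every $g:\mathbb R^3\to\mathbb R^3$ with $\sup_x\|f(x)-g(x)\|\le\delta$, every initial configuration $x_0$ on an input word, every $\bar x_0$ with $\|\bar x_0-x_0\|\le\epsilon$ and every $j\in\mathbb N$, $\|g^{[j]}(\bar x_0)-f_M^{[j]}(x_0)\|\le\epsilon$.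 \textbf{Theorem.} (1) There is a universal Turing machine $M$ such that for all $0<\delta<\epsilon<\frac12$ there are $\lambda$ and a robust simulation $f$ of $M$ with these constants. (2) There is an algorithm that, for every universal Turing machine $M$ and every robust simulation $f$ of $M$ with constants $\lambda,\delta,\epsilon$, computes, from any $C^1$-name of $f$ together with $s$, $\lambda$ and any rational $\rho>0$, a rational $\theta>0$ with the following properties. Every $g\in\mathcal N_\theta(f)$ has a sink $s_g$ with $\|s_g-s\|<\rho$, which is the only fixed point of $g$ in the closed ball of radius $\frac14$ around $s$; $s_f=s$; and $s_g$ is computable from $g$ (one oracle machine computes $s_g$ from any name of $g$, for all $g\in\mathcal N_\theta(f)$). For every $g\in\mathcal N_\theta(f)$, a configuration $x_0$ lies in the basin of attraction $W_g$ of $s_g$ if and only if $M$ halts on $x_0$, and $W_g$ is an open set which is non-computable: it is not a computable open set, and the distance function of $\mathbb R^3\setminus W_g$ is not computable. -/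

import Mathlib

open Set Filter Topology

/-! ## Type-two computability: oracle machines, names, computable maps and computable open sets -/

/-- A numbering of the rational numbers by natural numbers. -/
def ratOf (n : ℕ) : ℚ :=
  ((n.unpair.1.unpair.1 : ℚ) - (n.unpair.1.unpair.2 : ℚ)) / ((n.unpair.2 : ℚ) + 1)

/-- A numbering of `ℚ ^ d`, regarded as a subset of `ℝ ^ d`: a number codes a list of numbers, whose
entries code the coordinates (missing entries are read as `0`). -/
noncomputable def vecOf (d n : ℕ) : Fin d → ℝ :=
  fun i => ((ratOf ((Denumerable.ofNat (List ℕ) n).getD i 0) : ℚ) : ℝ)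

/-- An oracle machine, presented by the computation that it carries out when it has access to a finite
initial segment of its oracle: `run p n = some v` means that on input `n`, with the oracle answers
listed in `p` (and as many steps as `p` is long), the machine has stopped with output `v`. -/
structure OracleMachine where
  run : List ℕ → ℕ → Option ℕ
  computable_run : Computable₂ run

/-- On the oracle `φ` and the input `n` the machine stops with output `v`: the shortest initial
segment of the oracle on which there is an output gives the output `v`. -/
def OracleMachine.Outputs (M : OracleMachine) (φ : ℕ → ℕ) (n v : ℕ) : Prop :=
  ∃ L, M.run ((List.range L).map φ) n = some v ∧
    ∀ L' < L, M.run ((List.range L').map φ) n = none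

/-- `φ` is an oracle (name) for the point `x`: its `m`-th value codes a rational point at distance
less than `2 ^ (-m)` from `x` (in the max-norm). -/
def IsPointName {d : ℕ} (φ : ℕ → ℕ) (x : Fin d → ℝ) : Prop :=
  ∀ m, ‖vecOf d (φ m) - x‖ < (2 : ℝ)⁻¹ ^ m

/-- The machine, with oracle `φ`, computes the point `x`. -/
def OracleMachine.ComputesPoint {d : ℕ} (M : OracleMachine) (φ : ℕ → ℕ) (x : Fin d → ℝ) : Prop :=
  ∀ n, ∃ v, M.Outputs φ n v ∧ ‖vecOf d v - x‖ < (2 : ℝ)⁻¹ ^ n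

/-- Computable maps `ℝ ^ d → ℝ ^ e`. -/
def IsComputableMap {d e : ℕ} (h : (Fin d → ℝ) → (Fin e → ℝ)) : Prop :=
  ∃ M : OracleMachine, ∀ x φ, IsPointName φ x → M.ComputesPoint φ (h x)

/-- `ψ` is a name of the continuous map `h : ℝ ^ d → ℝ ^ e`: it gives rational approximations to the
values of `h` at the rational points, and a modulus of uniform continuity of `h` on every ball
of natural radius around the origin. -/
def IsMapName {d e : ℕ} (ψ : ℕ → ℕ) (h : (Fin d → ℝ) → (Fin e → ℝ)) : Prop :=
  (∀ p n, ‖vecOf e (ψ (Nat.pair 0 (Nat.pair p n))) - h (vecOf d p)‖ < (2 : ℝ)⁻¹ ^ n) ∧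
  (∀ (R n : ℕ) (x y : Fin d → ℝ), ‖x‖ ≤ R → ‖y‖ ≤ R →
    ‖x - y‖ < (2 : ℝ)⁻¹ ^ (ψ (Nat.pair 1 (Nat.pair R n))) → ‖h x - h y‖ < (2 : ℝ)⁻¹ ^ n)

/-- `ψ` is a name of the `C¹` map `h`: it consists of a name of `h` and names of the `d` partial
derivatives of `h`, that is, of the columns of `Dh`. -/
def IsC1Name {d e : ℕ} (ψ : ℕ → ℕ) (h : (Fin d → ℝ) → (Fin e → ℝ)) : Prop :=
  IsMapName (fun n => ψ (Nat.pair 0 n)) h ∧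
  ∀ j : Fin d, IsMapName (fun n => ψ (Nat.pair (j + 1) n))
    (fun x => fderiv ℝ h x (Pi.single j 1))

/-- Computable open sets of `ℝ ^ d`: the set is the union of a computable sequence of open rational
balls, and there is a computable sequence of closed rational balls that lists all closed rational
balls (of positive radius) disjoint from it, and no others.
Entries whose radius is not positive are ignored. -/
def IsComputableOpen {d : ℕ} (U : Set (Fin d → ℝ)) : Prop :=
  ∃ a r b s : ℕ → ℕ, Computable a ∧ Computable r ∧ Computable b ∧ Computable s ∧
    U = ⋃ n, Metric.ball (vecOf d (a n)) (ratOf (r n) : ℝ) ∧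
    ∀ p q : ℕ, 0 < ratOf q →
      (Disjoint (Metric.closedBall (vecOf d p) (ratOf q : ℝ)) U ↔
        ∃ n, vecOf d (b n) = vecOf d p ∧ ratOf (s n) = ratOf q)

/-- The distance function of a set `K`, as a map into `ℝ ^ 1`. -/
noncomputable def distMap {d : ℕ} (K : Set (Fin d → ℝ)) : (Fin d → ℝ) → (Fin 1 → ℝ) :=
  fun x _ => Metric.infDist x K

/-! ## Discrete-time dynamics on `ℝ³` (with the max-norm) -/

/-- `p` is a (hyperbolic) sink of the iteration of `g`: a fixed point at which `g` is differentiable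
and all complex eigenvalues of the Jacobian matrix have absolute value less than one. -/
def IsSink (g : (Fin 3 → ℝ) → (Fin 3 → ℝ)) (p : Fin 3 → ℝ) : Prop :=
  g p = p ∧ DifferentiableAt ℝ g p ∧
  ∀ μ ∈ spectrum ℂ
    ((LinearMap.toMatrix' (fderiv ℝ g p : (Fin 3 → ℝ) →ₗ[ℝ] (Fin 3 → ℝ))).map Complex.ofReal),
    ‖μ‖ < 1

/-- The basin of attraction of `p` under iteration of `g`. -/
def basin (g : (Fin 3 → ℝ) → (Fin 3 → ℝ)) (p : Fin 3 → ℝ) : Set (Fin 3 → ℝ) :=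
  {x | Tendsto (fun n => g^[n] x) atTop (𝓝 p)}

/-- The `C¹`-norm `sup ‖h‖ + sup ‖Dh‖`, possibly infinite. -/
noncomputable def c1Norm (h : (Fin 3 → ℝ) → (Fin 3 → ℝ)) : ENNReal :=
  (⨆ x, ‖h x‖ₑ) + ⨆ x, ‖fderiv ℝ h x‖ₑ

/-- The `θ`-neighbourhood of `f` in `C¹(ℝ³)`. -/
def c1Nhd (f : (Fin 3 → ℝ) → (Fin 3 → ℝ)) (θ : ℝ) : Set ((Fin 3 → ℝ) → (Fin 3 → ℝ)) :=
  {g | ContDiff ℝ 1 g ∧ c1Norm (fun x => g x - f x) < ENNReal.ofReal θ}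

/-! ## Turing machines and their configurations as points of `ℕ³` -/

/-- The moves of the head of a Turing machine. -/
inductive HeadMove
  | left
  | stay
  | right

/-- A one-tape Turing machine with `lastState + 1` states and `extraSymbols + 2` tape symbols. The
symbol `0` is the blank; the first state is initial, and the last one is the halting state, in
which the machine does nothing any more. -/
structure TuringM where
  lastState : ℕ
  extraSymbols : ℕ
  trans : Fin (lastState + 1) → Fin (extraSymbols + 2) →
    Fin (lastState + 1) × Fin (extraSymbols + 2) × HeadMove
  trans_last : ∀ a, trans (Fin.last lastState) a = (Fin.last lastState, a, HeadMove.stay)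

namespace TuringM

variable (M : TuringM)

/-- The number of tape symbols, which is the base of the encoding of the tape. -/
def base : ℕ := M.extraSymbols + 2

/-- The configurations of `M`. The part of the tape to the left of the head, and the part from the
head to the right, are each written as a natural number in base `M.base`, the least significant
digit being the symbol nearest to the head. -/
structure Config where
  left : ℕ
  right : ℕ
  state : Fin (M.lastState + 1)

/-- One step of the machine: the transition function on configurations. -/
def step (c : M.Config) : M.Config :=
  match M.trans c.state (Fin.ofNat (M.extraSymbols + 2) c.right) with
  | (q, b, HeadMove.left) =>
      ⟨c.left / M.base, M.base * (M.base * (c.right / M.base) + b) + c.left % M.base, q⟩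
  | (q, b, HeadMove.stay) => ⟨c.left, M.base * (c.right / M.base) + b, q⟩
  | (q, b, HeadMove.right) => ⟨M.base * c.left + b, c.right / M.base, q⟩

/-- The initial configuration with the word `w` on the tape. -/
def init (w : ℕ) : M.Config := ⟨0, w, 0⟩

/-- The configuration in the halting state with a blank tape. -/
def haltConfig : M.Config := ⟨0, 0, Fin.last M.lastState⟩

/-- The codes of input words: words without blanks. -/
def IsInput (w : ℕ) : Prop := ∀ a ∈ Nat.digits M.base w, a ≠ 0

/-- Started in the configuration `c`, the machine reaches the halting configuration. -/
def Reaches (c : M.Config) : Prop := ∃ n, M.step^[n] c = M.haltConfig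

/-- The point of `ℕ³ ⊆ ℝ³` that represents a configuration; the states are numbered from `1`. -/
def toPoint (c : M.Config) : Fin 3 → ℝ := ![(c.left : ℝ), (c.right : ℝ), (c.state : ℝ) + 1]

/-- `M` is a universal Turing machine which clears its tape before it halts, so that
`M.haltConfig` is its only halting configuration. -/
structure IsUniversal : Prop where
  /-- every partial recursive function can be run, on every argument, by `M` -/
  universal : ∃ enc : Nat.Partrec.Code → ℕ → ℕ, Computable₂ enc ∧
    ∀ c n, M.IsInput (enc c n) ∧ (M.Reaches (M.init (enc c n)) ↔ (c.eval n).Dom)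
  /-- `M.haltConfig` is the only configuration in which `M` halts -/
  unique_halt : ∀ w, M.IsInput w → ∀ n,
    (M.step^[n] (M.init w)).state = Fin.last M.lastState → M.step^[n] (M.init w) = M.haltConfig

/-- `f : ℝ³ → ℝ³` is an analytic and computable map that extends the transition function of `M`,
simulates `M` robustly (with contraction constant `lam`, and with tolerance `δ` for perturbations
of the map and `ε` for perturbations of points), and has the halting configuration as a sink. -/
structure RobustSimulation (f : (Fin 3 → ℝ) → (Fin 3 → ℝ)) (lam : ℚ) (δ ε : ℝ) : Prop where
  analytic : AnalyticOnNhd ℝ f univ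
  computable : IsComputableMap f
  extends_step : ∀ c, f (M.toPoint c) = M.toPoint (M.step c)
  sink : IsSink f (M.toPoint M.haltConfig)
  lam_pos : 0 < lam
  lam_lt_one : lam < 1
  contraction : ∀ (c : M.Config) (x : Fin 3 → ℝ), ‖x - M.toPoint c‖ ≤ 1 / 4 →
    ‖f x - f (M.toPoint c)‖ ≤ (lam : ℝ) * ‖x - M.toPoint c‖
  robust : ∀ g : (Fin 3 → ℝ) → (Fin 3 → ℝ), (∀ x, ‖f x - g x‖ ≤ δ) →
    ∀ w, M.IsInput w → ∀ x : Fin 3 → ℝ, ‖x - M.toPoint (M.init w)‖ ≤ ε →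
      ∀ j, ‖g^[j] x - M.toPoint (M.step^[j] (M.init w))‖ ≤ ε

end TuringM

/-! Configurations are integer points, hence at mutual distance at least 1. If `f` extends the step
function and contracts the ball of radius 1/4 around every configuration by a factor λ < 1, then a
map `g` that differs from `f` by at most θ < (1 - λ)/4 still sends each such ball into the ball
around the next configuration. Orbits of `g` starting there shadow the run of the machine forever
(`NearSim.shadow`). On a smaller ball of radius r around the halting point s the derivative of `g`
has norm at most κ < 1, so Banach's theorem gives a fixed point. The error recursion drives the
whole quarter ball into that smaller ball, so the fixed point is unique in the quarter ball and
attracts all of it. An orbit that converges to this sink must shadow a run that reaches s: near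
configurations, membership in the basin is halting (`NearSim.mem_basin_iff`).

The basin therefore contains or misses the entire quarter ball around each initial configuration. A
list of the closed balls disjoint from it would enumerate the non-halting computations, and the
distance to its complement, known up to 1/8, would decide halting (`DecidesHalting`).

The radius θ is effective because r comes from moduli of continuity of the partial derivatives,
while lower bounds for 1 - λ and ρ can be read off denominators (`radius_bounds`). The sink is found
by searching for a rational point that is almost fixed: under a contraction a small residual means a
small distance (`exists_machine_fixedPoint`).

For existence, a universal partial recursive function is compiled down to a Post-Turing machine,
which is simulated without writing blanks, so that the used part of the tape can be found and erased
at the end (`exists_isUniversal`). The step function is interpolated by affine maps weighted with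
trigonometric indicators of residue classes. Its local Lipschitz constant grows linearly with the
configuration; composing with an analytic rounding whose strength grows quadratically gives any
desired contraction (`exists_simMap_contraction`). -/

/-! ## A universal machine that clears its tape -/

/-- The states of a machine that simulates a Post-Turing machine and then clears the tape. -/
inductive CleanState (Λ : Type)
  | sim : Λ → CleanState Λ
  | sweep : CleanState Λ
  | erase : CleanState Λ

/-- The transitions of the simulation of a Post-Turing machine: a blank cell is read as the default
symbol, but no blank is written before the erasing phase. -/
def cleanTrans {Γ Λ : Type} [Inhabited Γ] [Inhabited Λ] (T : Turing.TM0.Machine Γ Λ) :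
    CleanState Λ → Option Γ → Option (CleanState Λ) × Option Γ × HeadMove
  | .sim q, a =>
    match T q (a.getD default) with
    -- The scanned cell is filled even when the simulated machine stops, so that no gap separates
    -- the two halves of the tape when the sweep begins.
    | none => (some .sweep, some (a.getD default), .stay)
    | some (q', .move .left) => (some (.sim q'), some (a.getD default), .left)
    | some (q', .move .right) => (some (.sim q'), some (a.getD default), .right)
    | some (q', .write b) => (some (.sim q'), some b, .stay)
  -- The used cells form an interval without blanks: the first blank met to the right is its right
  -- end, and erasing leftwards until the next blank removes all of it.
  | .sweep, some a => (some .sweep, some a, .right)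
  | .sweep, none => (some .erase, none, .left)
  | .erase, some _ => (some .erase, none, .left)
  | .erase, none => (none, none, .stay)

/-- Symbols are numbered from `1`; the blank is `0`. -/
def symEnc {Γ : Type} {x : ℕ} (e : Γ ≃ Fin (x + 1)) (a : Option Γ) : Fin (x + 2) :=
  a.elim 0 fun s => (e s).succ

/-- The symbol with a given number. -/
def symDec {Γ : Type} {x : ℕ} (e : Γ ≃ Fin (x + 1)) (a : Fin (x + 2)) : Option Γ :=
  Fin.cases none (fun i => some (e.symm i)) a

theorem symDec_symEnc {Γ : Type} {x : ℕ} (e : Γ ≃ Fin (x + 1)) (a : Option Γ) :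
    symDec e (symEnc e a) = a := by
  cases a with
  | none => rfl
  | some a => simp [symEnc, symDec]

theorem symDec_eq_none {Γ : Type} {x : ℕ} (e : Γ ≃ Fin (x + 1)) (a : Fin (x + 2)) :
    symDec e a = none ↔ a = 0 := by
  refine Fin.cases ?_ (fun i => ?_) a
  · simp [symDec]
  · simp [symDec, Fin.succ_ne_zero]

theorem symEnc_some_ne_zero {Γ : Type} {x : ℕ} (e : Γ ≃ Fin (x + 1)) (a : Γ) :
    ((symEnc e (some a) : Fin (x + 2)) : ℕ) ≠ 0 := by
  simp [symEnc]

/-- The tape-clearing simulation of a Post-Turing machine as a numbered machine. -/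
def cleanMachine {Γ Λ : Type} [Inhabited Γ] [Inhabited Λ] (T : Turing.TM0.Machine Γ Λ) {x y : ℕ}
    (e : Γ ≃ Fin (x + 1)) (sc : CleanState Λ → Fin y) (sd : Fin y → CleanState Λ) : TuringM where
  lastState := y
  extraSymbols := x
  trans p a := Fin.lastCases (motive := fun _ => Fin (y + 1) × Fin (x + 2) × HeadMove)
    (Fin.last y, a, HeadMove.stay)
    (fun i =>
      ((cleanTrans T (sd i) (symDec e a)).1.elim (Fin.last y) fun s => (sc s).castSucc,
        symEnc e (cleanTrans T (sd i) (symDec e a)).2.1,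
        (cleanTrans T (sd i) (symDec e a)).2.2)) p
  trans_last a := by simp

/-- A number none of whose digits is zero. -/
def NoZeroDigit (b n : ℕ) : Prop := ∀ a ∈ Nat.digits b n, a ≠ 0

theorem noZeroDigit_zero (b : ℕ) : NoZeroDigit b 0 := by simp [NoZeroDigit]

theorem NoZeroDigit.div {b n : ℕ} (hb : 2 ≤ b) (h : NoZeroDigit b n) : NoZeroDigit b (n / b) := by
  rcases Nat.eq_zero_or_pos n with rfl | hn
  · simpa using h
  · intro a ha
    apply h
    rw [Nat.digits_def' (by omega) hn]
    exact List.mem_cons_of_mem _ ha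

/-- This is what makes a blank an end marker: the leading digit of a positive number is nonzero, so
a blank next to the head of a gap-free half tape means that this half is empty. -/
theorem NoZeroDigit.eq_zero {b n : ℕ} (hb : 2 ≤ b) (h : NoZeroDigit b n) (h0 : n % b = 0) :
    n = 0 := by
  by_contra hn
  apply h (n % b) _ h0
  rw [Nat.digits_def' (by omega) (Nat.pos_of_ne_zero hn)]
  exact List.mem_cons_self

theorem NoZeroDigit.cons {b n d : ℕ} (hb : 2 ≤ b) (h : NoZeroDigit b n) (hd : d ≠ 0) (hdb : d < b) :
    NoZeroDigit b (b * n + d) := by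
  have h1 : b * n + d = d + b * n := by ring
  rw [h1, NoZeroDigit, Nat.digits_add b (by omega) d n hdb (Or.inl hd)]
  intro a ha
  rcases List.mem_cons.1 ha with rfl | ha
  · exact hd
  · exact h a ha

/-- The result of writing and moving the head. -/
def moveHead (b l r d : ℕ) : HeadMove → ℕ × ℕ
  | .left => (l / b, b * (b * (r / b) + d) + l % b)
  | .stay => (l, b * (r / b) + d)
  | .right => (b * l + d, r / b)

theorem TuringM.step_eq (M : TuringM) {l r : ℕ} {p q : Fin (M.lastState + 1)}
    {d : Fin (M.extraSymbols + 2)} {mv : HeadMove}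
    (h : M.trans p (Fin.ofNat (M.extraSymbols + 2) r) = (q, d, mv)) :
    M.step ⟨l, r, p⟩ = ⟨(moveHead M.base l r d mv).1, (moveHead M.base l r d mv).2, q⟩ := by
  unfold TuringM.step
  rw [h]
  cases mv <;> rfl

/-! ### The simulation invariant -/

section CleanMachine

variable {Γ Λ : Type} [Inhabited Γ] [Inhabited Λ] (T : Turing.TM0.Machine Γ Λ) {x y : ℕ}
  (e : Γ ≃ Fin (x + 1)) (sc : CleanState Λ → Fin y) (sd : Fin y → CleanState Λ)

theorem cleanMachine_step (l r : ℕ) (s : CleanState Λ) (hs : sd (sc s) = s)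
    (o : Option (CleanState Λ)) (d : Option Γ) (mv : HeadMove)
    (h : cleanTrans T s (symDec e (Fin.ofNat (x + 2) r)) = (o, d, mv)) :
    (cleanMachine T e sc sd).step ⟨l, r, (sc s).castSucc⟩ =
      ⟨(moveHead (x + 2) l r (symEnc e d) mv).1, (moveHead (x + 2) l r (symEnc e d) mv).2,
        o.elim (Fin.last y) fun s => (sc s).castSucc⟩ := by
  have h1 : (cleanMachine T e sc sd).trans ((sc s).castSucc) (Fin.ofNat (x + 2) r) =
      (o.elim (Fin.last y) fun s => (sc s).castSucc, symEnc e d, mv) := by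
    simp only [cleanMachine, Fin.lastCases_castSucc, hs, h]
  exact (cleanMachine T e sc sd).step_eq h1

/-- The symbol with a given number, the blank being read as the default symbol. -/
def symOf (n : ℕ) : Γ := (symDec e (Fin.ofNat (x + 2) n)).getD default

/-- The configuration `c` of the tape-clearing machine represents the configuration `t` of the
simulated machine. -/
structure Represents (S : Set Λ) (t : Turing.TM0.Cfg Γ Λ)
    (c : (cleanMachine T e sc sd).Config) : Prop where
  mem : t.q ∈ S
  state : c.state = (sc (.sim t.q)).castSucc
  left : NoZeroDigit (x + 2) c.left
  -- The scanned cell is exempt: a move to the left beyond the used part puts the head on a blank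
  -- with used cells to its right.
  right : NoZeroDigit (x + 2) (c.right / (x + 2))
  nth_right : ∀ i : ℕ, t.Tape.nth i = symOf e (c.right / (x + 2) ^ i)
  nth_left : ∀ i : ℕ, t.Tape.nth (-(i + 1 : ℤ)) = symOf e (c.left / (x + 2) ^ i)

theorem ofNat_add_mul (n d : ℕ) : Fin.ofNat (x + 2) ((x + 2) * n + d) = Fin.ofNat (x + 2) d := by
  ext; simp [Fin.ofNat]

theorem symOf_cons (n : ℕ) (a : Γ) : symOf e ((x + 2) * n + symEnc e (some a)) = a := by
  have : Fin.ofNat (x + 2) (symEnc e (some a)) = symEnc e (some a) := by simp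
  rw [symOf, ofNat_add_mul, this, symDec_symEnc]; rfl

theorem symOf_add_mod (n m : ℕ) : symOf e ((x + 2) * n + m % (x + 2)) = symOf e m := by
  rw [symOf, ofNat_add_mul, symOf]
  congr 2
  ext; simp [Fin.ofNat]

theorem cons_div_pow (n d i : ℕ) (hd : d < x + 2) :
    ((x + 2) * n + d) / (x + 2) ^ (i + 1) = n / (x + 2) ^ i := by
  rw [pow_succ', ← Nat.div_div_eq_div_mul, Nat.mul_add_div (by omega), Nat.div_eq_of_lt hd, add_zero]

theorem div_div_pow (n i : ℕ) : n / (x + 2) / (x + 2) ^ i = n / (x + 2) ^ (i + 1) := by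
  rw [pow_succ', Nat.div_div_eq_div_mul]

variable {T e sc sd}

/-- One step of the simulated machine is one step of the simulation. -/
theorem Represents.step {S : Set Λ} (hS : Turing.TM0.Supports T S)
    (hsc : ∀ q ∈ S, sd (sc (.sim q)) = .sim q)
    {t t' : Turing.TM0.Cfg Γ Λ} {c : (cleanMachine T e sc sd).Config}
    (h : Represents T e sc sd S t c) (ht : Turing.TM0.step T t = some t') :
    Represents T e sc sd S t' ((cleanMachine T e sc sd).step c) := by
  obtain ⟨l, r, s⟩ := c
  obtain ⟨q, tape⟩ := t
  have hstate := h.state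
  simp only at hstate
  subst hstate
  have hmem := h.mem
  have hl := h.left
  have hr := h.right
  have hnr := h.nth_right
  have hnl := h.nth_left
  simp only at hmem hl hr hnr hnl
  have hhead : tape.head = (symDec e (Fin.ofNat (x + 2) r)).getD default := by
    have := hnr 0
    simpa [symOf] using this
  have hstep := cleanMachine_step T e sc sd l r (.sim q) (hsc q hmem)
  have hlt : ∀ a, ((symEnc e a : Fin (x + 2)) : ℕ) < x + 2 := fun a => Fin.isLt _
  simp only [Turing.TM0.step, Option.map_eq_some_iff] at ht
  obtain ⟨⟨q', a⟩, hT, rfl⟩ := ht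
  have hmem' : q' ∈ S := hS.2 hT hmem
  rw [hhead] at hT
  set A : Γ := (symDec e (Fin.ofNat (x + 2) r)).getD default with hA
  have hAtape : tape.nth 0 = A := by rw [← hhead]; simp
  match a, hT with
  | .move .left, hT =>
    rw [hstep (some (.sim q')) (some A) .left (by simp only [cleanTrans, ← hA, hT])]
    refine ⟨hmem', rfl, hl.div (by omega), ?_, fun i => ?_, fun i => ?_⟩
    · simp only [moveHead]
      rw [Nat.mul_add_div (by omega), Nat.div_eq_of_lt (Nat.mod_lt _ (by omega)), add_zero]
      exact hr.cons (by omega) (symEnc_some_ne_zero e A) (hlt _)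
    · simp only [moveHead, Turing.Tape.move_left_nth]
      rcases i with _ | _ | i
      · have := hnl 0
        simp only [pow_zero, Nat.div_one, Nat.cast_zero, zero_add, zero_sub] at this ⊢
        rw [this, symOf_add_mod]
      · rw [cons_div_pow _ _ _ (Nat.mod_lt _ (by omega))]
        simp only [pow_zero, Nat.div_one, zero_add, Nat.cast_one, sub_self]
        rw [symOf_cons, hAtape]
      · rw [cons_div_pow _ _ _ (Nat.mod_lt _ (by omega)), cons_div_pow _ _ _ (hlt _), div_div_pow,
          ← hnr (i + 1)]
        congr 1; push_cast; ring
    · simp only [moveHead, Turing.Tape.move_left_nth]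
      rw [div_div_pow, ← hnl (i + 1)]
      congr 1
  | .move .right, hT =>
    rw [hstep (some (.sim q')) (some A) .right (by simp only [cleanTrans, ← hA, hT])]
    refine ⟨hmem', rfl, hl.cons (by omega) (symEnc_some_ne_zero e A) (hlt _), hr.div (by omega),
      fun i => ?_, fun i => ?_⟩
    · simp only [moveHead, Turing.Tape.move_right_nth]
      rw [div_div_pow, ← hnr (i + 1)]
      congr 1
    · simp only [moveHead, Turing.Tape.move_right_nth]
      rcases i with _ | i
      · simp only [pow_zero, Nat.div_one, Nat.cast_zero, zero_add]
        rw [symOf_cons, ← hAtape]; rfl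
      · rw [cons_div_pow _ _ _ (hlt _), ← hnl i]
        congr 1
  | .write B, hT =>
    rw [hstep (some (.sim q')) (some B) .stay (by simp only [cleanTrans, ← hA, hT])]
    refine ⟨hmem', rfl, hl, ?_, fun i => ?_, fun i => ?_⟩
    · simp only [moveHead]
      rw [Nat.mul_add_div (by omega), Nat.div_eq_of_lt (hlt _), add_zero]
      exact hr
    · simp only [moveHead, Turing.Tape.write_nth]
      rcases i with _ | i
      · simp only [pow_zero, Nat.div_one]
        rw [symOf_cons]; simp
      · rw [cons_div_pow _ _ _ (hlt _), div_div_pow, ← hnr (i + 1)]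
        rw [if_neg (by push_cast; omega)]
    · simp only [moveHead, Turing.Tape.write_nth]
      rw [if_neg (by omega), hnl]

end CleanMachine


/-! ### Clearing the tape, and halting of the simulation -/

theorem symDec_ofNat_eq_none {Γ : Type} {x : ℕ} {e : Γ ≃ Fin (x + 1)} (n : ℕ) :
    symDec e (Fin.ofNat (x + 2) n) = none ↔ n % (x + 2) = 0 := by
  rw [symDec_eq_none, Fin.ext_iff]; simp [Fin.ofNat]

theorem symEnc_symDec_ofNat {Γ : Type} {x : ℕ} {e : Γ ≃ Fin (x + 1)} (n : ℕ) {a : Γ} (h : symDec e (Fin.ofNat (x + 2) n) = some a) :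
    ((symEnc e (some a) : Fin (x + 2)) : ℕ) = n % (x + 2) := by
  have : symEnc e (symDec e (Fin.ofNat (x + 2) n)) = Fin.ofNat (x + 2) n := by
    generalize Fin.ofNat (x + 2) n = i
    refine Fin.cases ?_ (fun i => ?_) i
    · rfl
    · simp [symEnc, symDec]
  rw [← h, this]; simp [Fin.ofNat]

section CleanMachine

variable {Γ Λ : Type} [Inhabited Γ] [Inhabited Λ] {T : Turing.TM0.Machine Γ Λ} {x y : ℕ}
  {e : Γ ≃ Fin (x + 1)} {sc : CleanState Λ → Fin y} {sd : Fin y → CleanState Λ}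

theorem TuringM.Reaches.of_step {M : TuringM} {c : M.Config} (h : M.Reaches (M.step c)) :
    M.Reaches c := by
  obtain ⟨n, hn⟩ := h
  exact ⟨n + 1, by rw [Function.iterate_succ_apply]; exact hn⟩

theorem TuringM.step_haltConfig (M : TuringM) : M.step M.haltConfig = M.haltConfig := by
  unfold TuringM.haltConfig
  rw [M.step_eq (M.trans_last _)]
  simp [moveHead]

/-- The configurations that occur while the tape is being cleared. -/
def IsClearing (c : (cleanMachine T e sc sd).Config) : Prop :=
  (c.state = (sc .sweep).castSucc ∧ NoZeroDigit (x + 2) c.left ∧ NoZeroDigit (x + 2) c.right) ∨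
  (c.state = (sc .erase).castSucc ∧ NoZeroDigit (x + 2) c.left ∧ c.right < x + 2 ∧
    -- A blank under the erasing head occurs only when nothing is left on the tape, so the machine
    -- stops in `haltConfig` and nowhere else.
    (c.right = 0 → c.left = 0)) ∨
  c = (cleanMachine T e sc sd).haltConfig

theorem step_sweep_some (hsw : sd (sc .sweep) = .sweep) {l r : ℕ} (hr : r % (x + 2) ≠ 0) :
    (cleanMachine T e sc sd).step ⟨l, r, (sc .sweep).castSucc⟩ =
      ⟨(x + 2) * l + r % (x + 2), r / (x + 2), (sc .sweep).castSucc⟩ := by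
  obtain ⟨a, ha⟩ := Option.ne_none_iff_exists'.1 (mt (symDec_ofNat_eq_none (e := e) r).1 hr)
  rw [cleanMachine_step T e sc sd l r .sweep hsw (some .sweep) (some a) .right
    (by simp only [cleanTrans, ha])]
  simp only [moveHead, symEnc_symDec_ofNat r ha]
  rfl

theorem step_sweep_none (hsw : sd (sc .sweep) = .sweep) {l : ℕ} :
    (cleanMachine T e sc sd).step ⟨l, 0, (sc .sweep).castSucc⟩ =
      ⟨l / (x + 2), l % (x + 2), (sc .erase).castSucc⟩ := by
  have ha : symDec e (Fin.ofNat (x + 2) 0) = none := (symDec_ofNat_eq_none 0).2 (by simp)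
  rw [cleanMachine_step T e sc sd l 0 .sweep hsw (some .erase) none .left
    (by simp only [cleanTrans, ha])]
  simp [moveHead, symEnc]
  rfl

theorem step_erase_some (hsw : sd (sc .erase) = .erase) {l r : ℕ} (hr : r ≠ 0) (hr' : r < x + 2) :
    (cleanMachine T e sc sd).step ⟨l, r, (sc .erase).castSucc⟩ =
      ⟨l / (x + 2), l % (x + 2), (sc .erase).castSucc⟩ := by
  have h1 : r % (x + 2) ≠ 0 := by rwa [Nat.mod_eq_of_lt hr']
  obtain ⟨a, ha⟩ := Option.ne_none_iff_exists'.1 (mt (symDec_ofNat_eq_none (e := e) r).1 h1)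
  rw [cleanMachine_step T e sc sd l r .erase hsw (some .erase) none .left
    (by simp only [cleanTrans, ha])]
  simp [moveHead, symEnc, Nat.div_eq_of_lt hr']
  rfl

theorem step_erase_none (hsw : sd (sc .erase) = .erase) :
    (cleanMachine T e sc sd).step ⟨0, 0, (sc .erase).castSucc⟩ =
      (cleanMachine T e sc sd).haltConfig := by
  have ha : symDec e (Fin.ofNat (x + 2) 0) = none := (symDec_ofNat_eq_none 0).2 (by simp)
  rw [cleanMachine_step T e sc sd 0 0 .erase hsw none none .stay
    (by simp only [cleanTrans, ha])]
  simp [moveHead, symEnc, TuringM.haltConfig]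
  rfl

theorem IsClearing.step (hsw : sd (sc .sweep) = .sweep) (her : sd (sc .erase) = .erase)
    {c : (cleanMachine T e sc sd).Config} (h : IsClearing c) :
    IsClearing ((cleanMachine T e sc sd).step c) := by
  obtain ⟨l, r, s⟩ := c
  rcases h with ⟨rfl, hl, hr⟩ | ⟨rfl, hl, hr, h0⟩ | h
  · simp only at hl hr
    by_cases h : r % (x + 2) = 0
    · obtain rfl := hr.eq_zero (by omega) h
      rw [step_sweep_none hsw]
      refine Or.inr (Or.inl ⟨rfl, hl.div (by omega), Nat.mod_lt _ (by omega), fun h => ?_⟩)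
      simp only at h ⊢
      rw [hl.eq_zero (by omega) h]; simp
    · rw [step_sweep_some hsw h]
      exact Or.inl ⟨rfl, hl.cons (by omega) h (Nat.mod_lt _ (by omega)), hr.div (by omega)⟩
  · simp only at hl hr h0
    by_cases h : r = 0
    · obtain rfl := h
      rw [h0 rfl, step_erase_none her]
      exact Or.inr (Or.inr rfl)
    · rw [step_erase_some her h hr]
      refine Or.inr (Or.inl ⟨rfl, hl.div (by omega), Nat.mod_lt _ (by omega), fun h => ?_⟩)
      simp only at h ⊢
      rw [hl.eq_zero (by omega) h]; simp
  · rw [h, TuringM.step_haltConfig]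
    exact Or.inr (Or.inr rfl)

/-- Each erasing step removes the last digit of the left half, which decreases until it is 0; the
step after that halts. -/
theorem reaches_of_erase (her : sd (sc .erase) = .erase) (l : ℕ) :
    ∀ r, NoZeroDigit (x + 2) l → r < x + 2 → (r = 0 → l = 0) →
      (cleanMachine T e sc sd).Reaches ⟨l, r, (sc .erase).castSucc⟩ := by
  induction l using Nat.strong_induction_on with
  | _ l ih =>
    intro r hl hr h0
    have hz : (cleanMachine T e sc sd).Reaches ⟨0, 0, (sc .erase).castSucc⟩ :=
      ⟨1, step_erase_none her⟩
    by_cases h : r = 0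
    · obtain rfl := h
      rw [h0 rfl]; exact hz
    · apply TuringM.Reaches.of_step
      rw [step_erase_some her h hr]
      rcases Nat.eq_zero_or_pos l with rfl | hpos
      · simpa using hz
      · refine ih _ (Nat.div_lt_self hpos (by omega)) _ (hl.div (by omega))
          (Nat.mod_lt _ (by omega)) fun h => ?_
        exact absurd (hl.eq_zero (by omega) h) (by omega)

/-- Each step to the right shortens the right half by a digit; once it is empty, the erasing phase
takes over. -/
theorem reaches_of_sweep (hsw : sd (sc .sweep) = .sweep) (her : sd (sc .erase) = .erase) (r : ℕ) :
    ∀ l, NoZeroDigit (x + 2) l → NoZeroDigit (x + 2) r →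
      (cleanMachine T e sc sd).Reaches ⟨l, r, (sc .sweep).castSucc⟩ := by
  induction r using Nat.strong_induction_on with
  | _ r ih =>
    intro l hl hr
    apply TuringM.Reaches.of_step
    by_cases h : r % (x + 2) = 0
    · obtain rfl := hr.eq_zero (by omega) h
      rw [step_sweep_none hsw]
      refine reaches_of_erase her _ _ (hl.div (by omega)) (Nat.mod_lt _ (by omega)) fun h => ?_
      rw [hl.eq_zero (by omega) h]; simp
    · rw [step_sweep_some hsw h]
      have hpos : 0 < r := Nat.pos_of_ne_zero fun h0 => h (by rw [h0]; simp)
      exact ih _ (Nat.div_lt_self hpos (by omega)) _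
        (hl.cons (by omega) h (Nat.mod_lt _ (by omega))) (hr.div (by omega))

/-- When the simulated machine halts, the simulation starts to clear the tape. -/
theorem Represents.step_halt {S : Set Λ} (hsc : ∀ q ∈ S, sd (sc (.sim q)) = .sim q)
    {t : Turing.TM0.Cfg Γ Λ} {c : (cleanMachine T e sc sd).Config}
    (h : Represents T e sc sd S t c) (ht : Turing.TM0.step T t = none) :
    ∃ l r, NoZeroDigit (x + 2) l ∧ NoZeroDigit (x + 2) r ∧
      (cleanMachine T e sc sd).step c = ⟨l, r, (sc .sweep).castSucc⟩ := by
  obtain ⟨l, r, s⟩ := c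
  obtain ⟨q, tape⟩ := t
  have hstate := h.state
  simp only at hstate
  subst hstate
  have hhead : tape.head = (symDec e (Fin.ofNat (x + 2) r)).getD default := by
    have := h.nth_right 0
    simpa [symOf] using this
  simp only [Turing.TM0.step, Option.map_eq_none_iff, hhead] at ht
  rw [cleanMachine_step T e sc sd l r (.sim q) (hsc q h.mem) (some .sweep)
    (some ((symDec e (Fin.ofNat (x + 2) r)).getD default)) .stay (by simp only [cleanTrans, ht])]
  exact ⟨_, _, h.left, h.right.cons (by omega) (symEnc_some_ne_zero e _) (Fin.isLt _), rfl⟩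

theorem Represents.ne_haltConfig {S : Set Λ} {t : Turing.TM0.Cfg Γ Λ}
    {c : (cleanMachine T e sc sd).Config} (h : Represents T e sc sd S t c) :
    c.state ≠ Fin.last y := by
  rw [h.state]
  exact Fin.castSucc_ne_last _

/-- The two machines run in lockstep, and a represented configuration is never in the halting state;
conversely, once the simulated machine stops, the clearing phase always terminates. -/
theorem Represents.reaches_iff {S : Set Λ} (hS : Turing.TM0.Supports T S)
    (hsc : ∀ q ∈ S, sd (sc (.sim q)) = .sim q) (hsw : sd (sc .sweep) = .sweep)
    (her : sd (sc .erase) = .erase) {t : Turing.TM0.Cfg Γ Λ}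
    {c : (cleanMachine T e sc sd).Config} (h : Represents T e sc sd S t c) :
    (cleanMachine T e sc sd).Reaches c ↔ (StateTransition.eval (Turing.TM0.step T) t).Dom := by
  constructor
  · rintro ⟨n, hn⟩
    induction n generalizing t c with
    | zero => exact absurd (by rw [show c = _ from hn]; rfl) h.ne_haltConfig
    | succ n ih =>
      rcases ht : Turing.TM0.step T t with _ | t'
      · exact Part.dom_iff_mem.2 ⟨t, StateTransition.mem_eval.2 ⟨Relation.ReflTransGen.refl, ht⟩⟩
      · rw [StateTransition.reaches_eval (Relation.ReflTransGen.single ht)]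
        exact ih (h.step hS hsc ht) (by rwa [← Function.iterate_succ_apply])
  · intro hd
    obtain ⟨t', ht'⟩ := Part.dom_iff_mem.1 hd
    obtain ⟨hreach, hnone⟩ := StateTransition.mem_eval.1 ht'
    induction hreach using Relation.ReflTransGen.head_induction_on generalizing c with
    | refl =>
      apply TuringM.Reaches.of_step
      obtain ⟨l, r, hl, hr, hc⟩ := h.step_halt hsc hnone
      rw [hc]
      exact reaches_of_sweep hsw her r l hl hr
    | head hab _ ih =>
      apply TuringM.Reaches.of_step
      have hev := StateTransition.reaches_eval (Relation.ReflTransGen.single hab)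
      exact ih (h.step hS hsc hab) (by rwa [← hev]) (by rwa [← hev])

/-- Every blank-free word decodes to a list of symbols. Thus the invariant holds on all inputs, not
only on those produced by the reduction, as uniqueness of the halting configuration requires. -/
theorem represents_init {S : Set Λ} (hS : Turing.TM0.Supports T S)
    (h0 : (sc (.sim default)).castSucc = 0) {w : ℕ} (hw : (cleanMachine T e sc sd).IsInput w) :
    Represents T e sc sd S (Turing.TM0.init ((Nat.digits (x + 2) w).map (symOf e)))
      ((cleanMachine T e sc sd).init w) := by
  have hw' : NoZeroDigit (x + 2) w := hw
  have hz : symOf e 0 = (default : Γ) := by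
    have : symDec e (Fin.ofNat (x + 2) 0) = none := (symDec_ofNat_eq_none 0).2 (by simp)
    simp only [symOf, this, Option.getD_none]
  refine ⟨hS.1, h0.symm, noZeroDigit_zero _, hw'.div (by omega), fun i => ?_, fun i => ?_⟩
  · simp only [Turing.TM0.init, Turing.Tape.mk₁, Turing.Tape.mk₂, Turing.Tape.mk'_nth_nat,
      Turing.ListBlank.nth_mk, TuringM.init]
    rw [show ∀ l : List Γ, l.getI i = l.getD i default from fun _ => rfl, ← hz, List.getD_map, Nat.getD_digits _ _ (by omega)]
    simp only [symOf]
    congr 2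
    ext; simp [Fin.ofNat]
  · have : (-(i + 1 : ℤ)) = Int.negSucc i := by rw [Int.negSucc_eq]
    rw [this]
    simp only [TuringM.init, Nat.zero_div, hz]
    change (Turing.ListBlank.mk []).nth i = _
    rw [Turing.ListBlank.nth_mk]
    simp [List.getI]

theorem step_iterate_init {S : Set Λ} (hS : Turing.TM0.Supports T S)
    (hsc : ∀ q ∈ S, sd (sc (.sim q)) = .sim q) (hsw : sd (sc .sweep) = .sweep)
    (her : sd (sc .erase) = .erase) 
    (h0 : (sc (.sim default)).castSucc = 0) {w : ℕ} (hw : (cleanMachine T e sc sd).IsInput w)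
    (n : ℕ) :
    (∃ t, Represents T e sc sd S t
      ((cleanMachine T e sc sd).step^[n] ((cleanMachine T e sc sd).init w))) ∨
    IsClearing ((cleanMachine T e sc sd).step^[n] ((cleanMachine T e sc sd).init w)) := by
  induction n with
  | zero => exact Or.inl ⟨_, represents_init hS h0 hw⟩
  | succ n ih =>
    rw [Function.iterate_succ_apply']
    rcases ih with ⟨t, ht⟩ | h
    · rcases htt : Turing.TM0.step T t with _ | t'
      · obtain ⟨l, r, hl, hr, hc⟩ := ht.step_halt hsc htt
        rw [hc]
        exact Or.inr (Or.inl ⟨rfl, hl, hr⟩)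
      · exact Or.inl ⟨t', ht.step hS hsc htt⟩
    · exact Or.inr (h.step hsw her)

end CleanMachine

/-- A Post-Turing machine with finitely many symbols and states for which there is a computable
reduction of the halting problem gives a universal machine that clears its tape. -/
theorem exists_isUniversal_of_TM0 {Γ Λ : Type} [Inhabited Γ] [Inhabited Λ] [Finite Γ]
    (T : Turing.TM0.Machine Γ Λ) (S : Finset Λ) (hS : Turing.TM0.Supports T (S : Set Λ))
    (enc : ℕ → List Γ)
    (henc : ∀ (b : ℕ) (e : Γ → ℕ), Computable fun n => Nat.ofDigits b ((enc n).map e))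
    (hT : ∀ (c : Nat.Partrec.Code) (n : ℕ),
      (Turing.TM0.eval T (enc (Nat.pair (Encodable.encode c) n))).Dom ↔ (c.eval n).Dom) :
    ∃ M : TuringM, M.IsUniversal := by
  classical
  obtain ⟨k, ⟨e'⟩⟩ := Finite.exists_equiv_fin Γ
  obtain ⟨x, rfl⟩ : ∃ x, k = x + 1 :=
    Nat.exists_eq_succ_of_ne_zero (by rintro rfl; exact (e' default).elim0)
  -- The label type may be infinite; only the supported labels receive a number.
  let S' : Finset (CleanState Λ) := S.image .sim ∪ {.sweep, .erase}
  have hmem : ∀ q ∈ S, CleanState.sim q ∈ S' := fun q hq =>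
    Finset.mem_union_left _ (Finset.mem_image_of_mem _ hq)
  have hstart : CleanState.sim default ∈ S' := hmem _ hS.1
  let start : S' := ⟨.sim default, hstart⟩
  obtain ⟨y', ⟨e₁⟩⟩ := Finite.exists_equiv_fin S'
  obtain ⟨y, rfl⟩ : ∃ y, y' = y + 1 :=
    Nat.exists_eq_succ_of_ne_zero (by rintro rfl; exact (e₁ start).elim0)
  -- The swap gives the start state the number 0, which `TuringM.init` expects.
  let e₂ : S' ≃ Fin (y + 1) := e₁.trans (Equiv.swap (e₁ start) 0)
  have he₂ : e₂ start = 0 := by simp [e₂]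
  let sc : CleanState Λ → Fin (y + 1) := fun s => if h : s ∈ S' then e₂ ⟨s, h⟩ else 0
  let sd : Fin (y + 1) → CleanState Λ := fun i => (e₂.symm i : S')
  have hscd : ∀ s ∈ S', sd (sc s) = s := fun s hs => by simp [sc, sd, hs]
  have hsc : ∀ q ∈ (S : Set Λ), sd (sc (.sim q)) = .sim q := fun q hq => hscd _ (hmem q hq)
  have hsw : sd (sc .sweep) = .sweep := hscd _ (by simp [S'])
  have her : sd (sc .erase) = .erase := hscd _ (by simp [S'])
  have h0 : (sc (.sim default)).castSucc = 0 := by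
    have : sc (.sim default) = 0 := by simp only [sc, hstart, dif_pos]; exact he₂
    rw [this]; rfl
  refine ⟨cleanMachine T e' sc sd, ⟨fun c n => Nat.ofDigits (x + 2)
    ((enc (Nat.pair (Encodable.encode c) n)).map fun a => (symEnc e' (some a) : Fin (x + 2)).1),
    ?_, fun c n => ?_⟩, fun w hw n hn => ?_⟩
  · exact (henc _ _).comp (Primrec₂.natPair.to_comp.comp
      (Computable.encode.comp Computable.fst) Computable.snd)
  · set L := (enc (Nat.pair (Encodable.encode c) n)).map
      fun a => (symEnc e' (some a) : Fin (x + 2)).1 with hL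
    have hne : ∀ a ∈ L, a ≠ 0 := by
      intro a ha
      obtain ⟨s, -, rfl⟩ := List.mem_map.1 ha
      exact symEnc_some_ne_zero e' s
    have hdig : Nat.digits (x + 2) (Nat.ofDigits (x + 2) L) = L := by
      refine Nat.digits_ofDigits _ (by omega) _ (fun a ha => ?_)
        fun h => hne _ (List.getLast_mem h)
      obtain ⟨s, -, rfl⟩ := List.mem_map.1 ha
      exact Fin.isLt _
    have hin : (cleanMachine T e' sc sd).IsInput (Nat.ofDigits (x + 2) L) := by
      intro a ha
      have ha' : a ∈ Nat.digits (x + 2) (Nat.ofDigits (x + 2) L) := ha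
      rw [hdig] at ha'
      exact hne a ha'
    refine ⟨hin, ?_⟩
    rw [(represents_init hS h0 hin).reaches_iff hS hsc hsw her, ← hT c n, hdig]
    have hmap : L.map (symOf e') = enc (Nat.pair (Encodable.encode c) n) := by
      rw [hL, List.map_map]
      conv_rhs => rw [← List.map_id (enc _)]
      refine List.map_congr_left fun a _ => ?_
      have := symOf_cons e' 0 a
      simpa using this
    rw [hmap]
    rfl
  · rcases step_iterate_init hS hsc hsw her h0 hw n with ⟨t, ht⟩ | h | h | h
    · exact absurd hn ht.ne_haltConfig
    · exact absurd (h.1.symm.trans hn) (Fin.castSucc_ne_last _)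
    · exact absurd (h.1.symm.trans hn) (Fin.castSucc_ne_last _)
    · exact h


/-! ### A computable reduction of the halting problem to one Post-Turing machine -/

theorem trPosNum_eq_bits (p : PosNum) :
    Turing.PartrecToTM2.trPosNum p = (Nat.bits (p : ℕ)).map
      fun b => cond b Turing.PartrecToTM2.Γ'.bit1 Turing.PartrecToTM2.Γ'.bit0 := by
  induction p with
  | one => simp [Turing.PartrecToTM2.trPosNum]
  | bit0 p ih =>
    have h : ((PosNum.bit0 p : PosNum) : ℕ) = 2 * (p : ℕ) := by
      rw [PosNum.cast_bit0]; ring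
    rw [h, Nat.bit0_bits _ (PosNum.to_nat_pos p).ne']
    simp [Turing.PartrecToTM2.trPosNum, ih]
  | bit1 p ih =>
    have h : ((PosNum.bit1 p : PosNum) : ℕ) = 2 * (p : ℕ) + 1 := by
      rw [PosNum.cast_bit1]; ring
    rw [h, Nat.bit1_bits]
    simp [Turing.PartrecToTM2.trPosNum, ih]

theorem trNat_eq_bits (n : ℕ) :
    Turing.PartrecToTM2.trNat n = (Nat.bits n).map
      fun b => cond b Turing.PartrecToTM2.Γ'.bit1 Turing.PartrecToTM2.Γ'.bit0 := by
  have h : ∀ m : Num, Turing.PartrecToTM2.trNum m = (Nat.bits (m : ℕ)).map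
      fun b => cond b Turing.PartrecToTM2.Γ'.bit1 Turing.PartrecToTM2.Γ'.bit0 := by
    intro m
    cases m with
    | zero => simp [Turing.PartrecToTM2.trNum]
    | pos p => exact trPosNum_eq_bits p
  rw [Turing.PartrecToTM2.trNat, h, Num.to_of_nat]

/-- Strong recursion: the digits of k + 1 are its parity followed by the digits of its half, which
are looked up in the list of earlier values. -/
theorem primrec_bits : Primrec Nat.bits := by
  have hg : Primrec₂ fun (_ : Unit) (l : List (List Bool)) =>
      (some (Nat.casesOn l.length [] fun k =>
        (k + 1).bodd :: (l[(k + 1).div2]?.getD [])) : Option (List Bool)) := by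
    refine Primrec.option_some.comp (Primrec.nat_casesOn (Primrec.list_length.comp Primrec.snd)
      (Primrec.const []) ?_)
    have hk : Primrec fun p : (Unit × List (List Bool)) × ℕ => p.2 + 1 :=
      Primrec.succ.comp Primrec.snd
    exact Primrec.list_cons.comp (Primrec.nat_bodd.comp hk)
      (Primrec.option_getD.comp (Primrec.list_getElem?.comp (Primrec.snd.comp Primrec.fst)
        (Primrec.nat_div2.comp hk)) (Primrec.const []))
  have := Primrec.nat_strong_rec (fun (_ : Unit) n => Nat.bits n) hg (fun _ n => by
    rcases n with _ | n
    · simp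
    · have hlt : (n + 1).div2 < n + 1 := by rw [Nat.div2_val]; omega
      simp only [List.length_map, List.length_range, Option.some_inj]
      rw [List.getElem?_map, List.getElem?_range hlt]
      simp only [Option.map_some, Option.getD_some]
      have hb := Nat.bits_append_bit (n + 1).div2 (n + 1).bodd (by
        intro h0
        rw [Nat.div2_val] at h0
        have : n = 0 := by omega
        subst this; rfl)
      rw [Nat.bit_bodd_div2] at hb
      exact hb.symm)
  exact this.comp (Primrec.const ()) Primrec.id

/-- Evaluation of programs is itself partial recursive, so a single code carries it out on pairs of
a program and an argument. -/
theorem exists_code_universal : ∃ c : Turing.ToPartrec.Code, ∀ (d : Nat.Partrec.Code) (n : ℕ),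
    (c.eval [Nat.pair (Encodable.encode d) n]).Dom ↔ (d.eval n).Dom := by
  have hf : Partrec fun v : List.Vector ℕ 1 =>
      (Denumerable.ofNat Nat.Partrec.Code v.head.unpair.1).eval v.head.unpair.2 := by
    have hu : Computable fun v : List.Vector ℕ 1 => v.head.unpair :=
      Computable.unpair.comp Computable.vector_head
    exact Nat.Partrec.Code.eval_part.comp
      ((Computable.ofNat _).comp (Computable.fst.comp hu)) (Computable.snd.comp hu)
  obtain ⟨c, hc⟩ := Turing.ToPartrec.Code.exists_code (Nat.Partrec'.of_part hf)
  refine ⟨c, fun d n => ?_⟩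
  have := hc (Nat.pair (Encodable.encode d) n ::ᵥ List.Vector.nil)
  simp only [List.Vector.head_cons, Nat.unpair_pair, Denumerable.ofNat_encode] at this
  rw [show c.eval [Nat.pair (Encodable.encode d) n] = _ from this]
  rfl

instance : Finite Turing.PartrecToTM2.K' :=
  Finite.of_injective (fun k => (match k with
    | .main => 0
    | .rev => 1
    | .aux => 2
    | .stack => 3 : Fin 4)) (by intro a b h; cases a <;> cases b <;> simp_all)

theorem computable_ofDigits_map {α : Type} [Primcodable α] {f : ℕ → List α} (hf : Primrec f)
    (b : ℕ) {g : α → ℕ} (hg : Primrec g) : Primrec fun n => Nat.ofDigits b ((f n).map g) := by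
  have h : ∀ l : List α, Nat.ofDigits b (l.map g) = l.foldr (fun a s => g a + b * s) 0 := by
    intro l
    induction l with
    | nil => rfl
    | cons a l ih => rw [List.map_cons, Nat.ofDigits_cons, ih]; rfl
  simp only [h]
  refine Primrec.list_foldr (h := fun _ p => g p.1 + b * p.2) hf (Primrec.const 0) ?_
  exact Primrec.nat_add.comp (hg.comp (Primrec.fst.comp Primrec.snd))
    (Primrec.nat_mul.comp (Primrec.const b) (Primrec.snd.comp Primrec.snd))

-- The universal code is compiled into a multi-stack machine, then into a one-tape machine, then
-- into a Post-Turing machine. The translations preserve the domain of evaluation and the finiteness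
-- of the set of labels in use.
open Turing in
theorem exists_isUniversal : ∃ M : TuringM, M.IsUniversal := by
  classical
  obtain ⟨c, hc⟩ := exists_code_universal
  -- Machines start in the default label, so the default is declared to be the entry point of the
  -- compiled code.
  let _ : Inhabited PartrecToTM2.Λ' := ⟨PartrecToTM2.trNormal c .halt⟩
  let _ : Fintype PartrecToTM2.K' := Fintype.ofFinite _
  let M2 := PartrecToTM2.tr
  let M1 := TM2to1.tr M2
  let M0 := TM1to0.tr M1
  have hs := TM1to0.tr_supports M1 (TM2to1.tr_supports M2 (PartrecToTM2.tr_supports c .halt))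
  -- A cell of the one-tape machine holds a flag for the bottom of the stacks and one entry per
  -- stack. The initial tape has the separator `cons` in the bottom cell and the binary digits above
  -- it; `none` stands for that first cell.
  let g : Option Bool → TM2to1.Γ' PartrecToTM2.K' fun _ => PartrecToTM2.Γ' := fun o =>
    o.elim (true, Function.update (fun _ => none) .main (some .cons))
      fun b => (false, Function.update (fun _ => none) .main (some (cond b .bit1 .bit0)))
  have : Finite (TM2to1.Γ' PartrecToTM2.K' fun _ => PartrecToTM2.Γ') := Finite.of_fintype _
  have henc : ∀ n, TM2to1.trInit (Γ := fun _ => PartrecToTM2.Γ') PartrecToTM2.K'.main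
      (PartrecToTM2.trList [n]) = (none :: (Nat.bits n).reverse.map some).map g := by
    intro n
    rw [PartrecToTM2.trList, PartrecToTM2.trList, trNat_eq_bits]
    rw [TM2to1.trInit, List.reverse_append, List.reverse_singleton, ← List.map_reverse,
      List.map_cons, List.map_map]
    refine congrArg₂ List.cons rfl ?_
    refine Eq.trans (List.map_map (l := (Nat.bits n).reverse)) ?_
    rfl
  refine exists_isUniversal_of_TM0 M0 _ hs
    (fun n => TM2to1.trInit .main (PartrecToTM2.trList [n])) (fun b e => ?_) (fun d n => ?_)
  · simp only [henc, List.map_map]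
    refine (computable_ofDigits_map ?_ b (Primrec.dom_finite _)).to_comp
    exact Primrec.list_cons.comp (Primrec.const none)
      (Primrec.list_map (Primrec.list_reverse.comp primrec_bits)
        (Primrec.option_some.comp Primrec.snd))
  · rw [← hc d n, TM1to0.tr_eval]
    refine (TM2to1.tr_eval_dom M2 _ _).trans ?_
    have hinit : TM2.init PartrecToTM2.K'.main
        (PartrecToTM2.trList [Nat.pair (Encodable.encode d) n]) =
        PartrecToTM2.init c [Nat.pair (Encodable.encode d) n] := by
      unfold TM2.init PartrecToTM2.init
      congr 1
      funext k
      cases k <;> rfl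
    unfold TM2.eval
    rw [hinit]
    have := PartrecToTM2.tr_eval c [Nat.pair (Encodable.encode d) n]
    change (StateTransition.eval (TM2.step PartrecToTM2.tr)
      (PartrecToTM2.init c [Nat.pair (Encodable.encode d) n])).Dom ↔ _
    rw [this]
    rfl


/-! ## Codes of rational numbers -/

theorem ratOf_pair (a b c : ℕ) : ratOf (Nat.pair (Nat.pair a b) c) = ((a : ℚ) - b) / (c + 1) := by
  simp [ratOf]

/-- Addition on codes of rational numbers. -/
def ratAdd (m n : ℕ) : ℕ :=
  Nat.pair (Nat.pair
    (m.unpair.1.unpair.1 * (n.unpair.2 + 1) + n.unpair.1.unpair.1 * (m.unpair.2 + 1))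
    (m.unpair.1.unpair.2 * (n.unpair.2 + 1) + n.unpair.1.unpair.2 * (m.unpair.2 + 1)))
    -- Codes store the denominator minus one, and this is (a + 1)(b + 1) - 1.
    (m.unpair.2 * n.unpair.2 + m.unpair.2 + n.unpair.2)

/-- Multiplication on codes of rational numbers. -/
def ratMul (m n : ℕ) : ℕ :=
  Nat.pair (Nat.pair
    (m.unpair.1.unpair.1 * n.unpair.1.unpair.1 + m.unpair.1.unpair.2 * n.unpair.1.unpair.2)
    (m.unpair.1.unpair.1 * n.unpair.1.unpair.2 + m.unpair.1.unpair.2 * n.unpair.1.unpair.1))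
    (m.unpair.2 * n.unpair.2 + m.unpair.2 + n.unpair.2)

/-- Negation on codes of rational numbers. -/
def ratNeg (m : ℕ) : ℕ :=
  Nat.pair (Nat.pair m.unpair.1.unpair.2 m.unpair.1.unpair.1) m.unpair.2

/-- The inverse on codes of positive rational numbers. -/
def ratInv (m : ℕ) : ℕ :=
  Nat.pair (Nat.pair (m.unpair.2 + 1) 0) (m.unpair.1.unpair.1 - m.unpair.1.unpair.2 - 1)

theorem ratOf_ratAdd (m n : ℕ) : ratOf (ratAdd m n) = ratOf m + ratOf n := by
  rw [ratAdd, ratOf_pair, ratOf, ratOf]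
  have h1 : ((m.unpair.2 : ℚ) + 1) ≠ 0 := by positivity
  have h2 : ((n.unpair.2 : ℚ) + 1) ≠ 0 := by positivity
  have h3 : (((m.unpair.2 * n.unpair.2 + m.unpair.2 + n.unpair.2 : ℕ) : ℚ) + 1) =
    ((m.unpair.2 : ℚ) + 1) * ((n.unpair.2 : ℚ) + 1) := by push_cast; ring
  rw [h3, div_add_div _ _ h1 h2]
  congr 1
  push_cast; ring

theorem ratOf_ratMul (m n : ℕ) : ratOf (ratMul m n) = ratOf m * ratOf n := by
  rw [ratMul, ratOf_pair, ratOf, ratOf]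
  have h3 : (((m.unpair.2 * n.unpair.2 + m.unpair.2 + n.unpair.2 : ℕ) : ℚ) + 1) =
    ((m.unpair.2 : ℚ) + 1) * ((n.unpair.2 : ℚ) + 1) := by push_cast; ring
  rw [h3, div_mul_div_comm]
  congr 1
  push_cast; ring

theorem ratOf_ratNeg (m : ℕ) : ratOf (ratNeg m) = -ratOf m := by
  rw [ratNeg, ratOf_pair, ratOf, ← neg_div]
  congr 1
  ring

theorem ratOf_ratInv {m : ℕ} (h : 0 < ratOf m) : ratOf (ratInv m) = (ratOf m)⁻¹ := by
  have h1 : (0 : ℚ) < (m.unpair.2 : ℚ) + 1 := by positivity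
  rw [ratOf, div_pos_iff_of_pos_right h1] at h
  have h2 : m.unpair.1.unpair.2 < m.unpair.1.unpair.1 := by exact_mod_cast sub_pos.1 h
  have h3 : ((m.unpair.1.unpair.1 - m.unpair.1.unpair.2 - 1 : ℕ) : ℚ) + 1 =
      (m.unpair.1.unpair.1 : ℚ) - m.unpair.1.unpair.2 := by
    rw [Nat.cast_sub (by omega), Nat.cast_sub h2.le]; push_cast; ring
  rw [ratInv, ratOf_pair, h3, ratOf, inv_div]
  congr 1
  push_cast; ring

theorem abs_ratOf_le (m : ℕ) :
    |(ratOf m : ℝ)| ≤ (m.unpair.1.unpair.1 + m.unpair.1.unpair.2 : ℕ) := by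
  rw [ratOf]; push_cast
  have h1 : (1 : ℝ) ≤ (m.unpair.2 : ℝ) + 1 := by simp
  rw [abs_div, abs_of_pos (lt_of_lt_of_le one_pos h1)]
  refine (div_le_self (abs_nonneg _) h1).trans (abs_le.2 ⟨?_, ?_⟩)
  · have : (0 : ℝ) ≤ m.unpair.1.unpair.1 := Nat.cast_nonneg _
    linarith
  · have : (0 : ℝ) ≤ m.unpair.1.unpair.2 := Nat.cast_nonneg _
    linarith

theorem exists_ratOf (q : ℚ) : ∃ n, ratOf n = q := by
  refine ⟨Nat.pair (Nat.pair q.num.toNat (-q.num).toNat) (q.den - 1), ?_⟩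
  rw [ratOf_pair]
  have h1 : ((q.den - 1 : ℕ) : ℚ) + 1 = q.den := by
    rw [Nat.cast_sub q.pos]; push_cast; ring
  have h2 : ((q.num.toNat : ℕ) : ℚ) - ((-q.num).toNat : ℕ) = q.num := by
    have : ((q.num.toNat : ℕ) : ℤ) - ((-q.num).toNat : ℕ) = q.num := by omega
    exact_mod_cast this
  rw [h1, h2, Rat.num_div_den]

section RatPrimrec

variable {α : Type*} [Primcodable α]

theorem primrec_num : Primrec fun m : ℕ => m.unpair.1.unpair.1 :=
  Primrec.fst.comp (Primrec.unpair.comp (Primrec.fst.comp Primrec.unpair))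

theorem primrec_numNeg : Primrec fun m : ℕ => m.unpair.1.unpair.2 :=
  Primrec.snd.comp (Primrec.unpair.comp (Primrec.fst.comp Primrec.unpair))

theorem primrec_den : Primrec fun m : ℕ => m.unpair.2 := Primrec.snd.comp Primrec.unpair

theorem primrec_pair3 {f g h : α → ℕ} (hf : Primrec f) (hg : Primrec g) (hh : Primrec h) :
    Primrec fun a => Nat.pair (Nat.pair (f a) (g a)) (h a) :=
  Primrec₂.natPair.comp (Primrec₂.natPair.comp hf hg) hh

theorem primrec_ratAdd : Primrec₂ ratAdd := by
  have n1 := primrec_num.comp (Primrec.fst (α := ℕ) (β := ℕ))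
  have n2 := primrec_num.comp (Primrec.snd (α := ℕ) (β := ℕ))
  have m1 := primrec_numNeg.comp (Primrec.fst (α := ℕ) (β := ℕ))
  have m2 := primrec_numNeg.comp (Primrec.snd (α := ℕ) (β := ℕ))
  have d1 := primrec_den.comp (Primrec.fst (α := ℕ) (β := ℕ))
  have d2 := primrec_den.comp (Primrec.snd (α := ℕ) (β := ℕ))
  exact primrec_pair3
    (Primrec.nat_add.comp (Primrec.nat_mul.comp n1 (Primrec.succ.comp d2))
      (Primrec.nat_mul.comp n2 (Primrec.succ.comp d1)))
    (Primrec.nat_add.comp (Primrec.nat_mul.comp m1 (Primrec.succ.comp d2))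
      (Primrec.nat_mul.comp m2 (Primrec.succ.comp d1)))
    (Primrec.nat_add.comp (Primrec.nat_add.comp (Primrec.nat_mul.comp d1 d2) d1) d2)

theorem primrec_ratMul : Primrec₂ ratMul := by
  have n1 := primrec_num.comp (Primrec.fst (α := ℕ) (β := ℕ))
  have n2 := primrec_num.comp (Primrec.snd (α := ℕ) (β := ℕ))
  have m1 := primrec_numNeg.comp (Primrec.fst (α := ℕ) (β := ℕ))
  have m2 := primrec_numNeg.comp (Primrec.snd (α := ℕ) (β := ℕ))
  have d1 := primrec_den.comp (Primrec.fst (α := ℕ) (β := ℕ))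
  have d2 := primrec_den.comp (Primrec.snd (α := ℕ) (β := ℕ))
  exact primrec_pair3
    (Primrec.nat_add.comp (Primrec.nat_mul.comp n1 n2) (Primrec.nat_mul.comp m1 m2))
    (Primrec.nat_add.comp (Primrec.nat_mul.comp n1 m2) (Primrec.nat_mul.comp m1 n2))
    (Primrec.nat_add.comp (Primrec.nat_add.comp (Primrec.nat_mul.comp d1 d2) d1) d2)

theorem primrec_ratNeg : Primrec ratNeg := primrec_pair3 primrec_numNeg primrec_num primrec_den

theorem primrec_ratInv : Primrec ratInv :=
  primrec_pair3 (Primrec.succ.comp primrec_den) (Primrec.const 0)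
    (Primrec.nat_sub.comp (Primrec.nat_sub.comp primrec_num primrec_numNeg) (Primrec.const 1))

end RatPrimrec

/-! ## Computable families of real numbers -/

/-- A computable family of real numbers. -/
def CReal {α : Type*} [Primcodable α] (F : α → ℝ) : Prop :=
  ∃ a : α → ℕ → ℕ, Computable₂ a ∧ ∀ p n, |(ratOf (a p n) : ℝ) - F p| ≤ 1 / ((n : ℝ) + 1)

namespace CReal

variable {α β : Type*} [Primcodable α] [Primcodable β] {F G : α → ℝ}

theorem comp (hF : CReal F) {g : β → α} (hg : Computable g) : CReal fun p => F (g p) := by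
  obtain ⟨a, ha, h⟩ := hF
  exact ⟨fun p n => a (g p) n, ha.comp (hg.comp Computable.fst) Computable.snd, fun p n => h _ _⟩

theorem rat {g : α → ℕ} (hg : Computable g) : CReal fun p => (ratOf (g p) : ℝ) :=
  ⟨fun p _ => g p, hg.comp Computable.fst, fun p n => by simp; positivity⟩

theorem nat {g : α → ℕ} (hg : Computable g) : CReal fun p => (g p : ℝ) := by
  have h := rat (g := fun p => Nat.pair (Nat.pair (g p) 0) 0)
    (Primrec₂.natPair.to_comp.comp
      (Primrec₂.natPair.to_comp.comp hg (Computable.const 0)) (Computable.const 0))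
  simpa [ratOf_pair] using h

theorem ratConst (q : ℚ) : CReal fun _ : α => (q : ℝ) := by
  obtain ⟨n, rfl⟩ := exists_ratOf q
  exact rat (Computable.const n)

/-- The closure properties below go through this criterion, in which the error may carry a
computable factor B: taking k = B(2n + 2) brings the error below 1/(2n + 2), half of the allowed
one. -/
theorem limit {G : α × ℕ → ℝ} (hG : CReal G) {B : α → ℕ} (hB : Computable B)
    (h : ∀ p k, |G (p, k) - F p| ≤ B p / ((k : ℝ) + 1)) : CReal F := by
  obtain ⟨a, ha, haG⟩ := hG
  refine ⟨fun p n => a (p, B p * (2 * n + 2)) (2 * n + 1), ?_, fun p n => ?_⟩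
  · have h2 : Computable fun x : α × ℕ => 2 * x.2 :=
      (Primrec.nat_double.comp Primrec.snd).to_comp
    have h3 : Computable fun x : α × ℕ => 2 * x.2 + 2 :=
      Primrec.nat_add.to_comp.comp h2 (Computable.const 2)
    exact ha.comp (Computable.pair Computable.fst
      (Primrec.nat_mul.to_comp.comp (hB.comp Computable.fst) h3)) (Computable.succ.comp h2)
  · have h1 := haG (p, B p * (2 * n + 2)) (2 * n + 1)
    have h2 := h p (B p * (2 * n + 2))
    have h3 : (B p : ℝ) / (((B p * (2 * n + 2) : ℕ) : ℝ) + 1) ≤ 1 / (2 * n + 2) := by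
      rw [div_le_div_iff₀ (by positivity) (by positivity)]
      push_cast; linarith
    have h4 : (1 : ℝ) / (((2 * n + 1 : ℕ) : ℝ) + 1) = 1 / (2 * n + 2) := by
      push_cast; congr 1; ring
    have h5 : (1 : ℝ) / (n + 1) = 1 / (2 * n + 2) + 1 / (2 * n + 2) := by
      field_simp; ring
    rw [h4] at h1
    rw [h5]
    calc _ ≤ _ := abs_sub_le _ (G (p, B p * (2 * n + 2))) _
      _ ≤ _ := add_le_add h1 (h2.trans h3)

theorem exists_bound (hF : CReal F) : ∃ B : α → ℕ, Computable B ∧ ∀ p, |F p| ≤ B p := by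
  obtain ⟨a, ha, h⟩ := hF
  refine ⟨fun p => (a p 0).unpair.1.unpair.1 + (a p 0).unpair.1.unpair.2 + 1, ?_, fun p => ?_⟩
  · have h0 : Computable fun p => a p 0 := ha.comp Computable.id (Computable.const 0)
    exact Computable.succ.comp (Primrec.nat_add.to_comp.comp (primrec_num.to_comp.comp h0)
      (primrec_numNeg.to_comp.comp h0))
  · have h1 := h p 0
    have h2 := abs_ratOf_le (a p 0)
    have h3 : |F p| ≤ |(ratOf (a p 0) : ℝ)| + |(ratOf (a p 0) : ℝ) - F p| := by
      have := abs_sub_abs_le_abs_sub (F p) (ratOf (a p 0) : ℝ)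
      rw [abs_sub_comm] at this; linarith
    push_cast at h2 ⊢
    norm_num at h1
    linarith

theorem add (hF : CReal F) (hG : CReal G) : CReal fun p => F p + G p := by
  obtain ⟨a, ha, h⟩ := hF
  obtain ⟨b, hb, h'⟩ := hG
  have hc : Computable fun x : α × ℕ => ratAdd (a x.1 x.2) (b x.1 x.2) :=
    primrec_ratAdd.to_comp.comp ha hb
  refine limit (rat hc) (Computable.const 2) fun p k => ?_
  simp only [ratOf_ratAdd]
  push_cast
  have h1 := h p k
  have h2 := h' p k
  have h3 : (2 : ℝ) / (k + 1) = 1 / (k + 1) + 1 / (k + 1) := by ring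
  rw [h3, add_sub_add_comm]
  exact (abs_add_le _ _).trans (add_le_add h1 h2)

theorem mul (hF : CReal F) (hG : CReal G) : CReal fun p => F p * G p := by
  obtain ⟨A, hA, hFA⟩ := hF.exists_bound
  obtain ⟨B, hB, hGB⟩ := hG.exists_bound
  obtain ⟨a, ha, h⟩ := hF
  obtain ⟨b, hb, h'⟩ := hG
  have hc : Computable fun x : α × ℕ => ratMul (a x.1 x.2) (b x.1 x.2) :=
    primrec_ratMul.to_comp.comp ha hb
  have hAB : Computable fun p => A p + B p + 1 :=
    Computable.succ.comp (Primrec.nat_add.to_comp.comp hA hB)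
  refine limit (rat hc) hAB fun p k => ?_
  simp only [ratOf_ratMul]
  push_cast
  set f := (ratOf (a p k) : ℝ)
  set g := (ratOf (b p k) : ℝ)
  have h1 : |f - F p| ≤ 1 / ((k : ℝ) + 1) := h p k
  have h2 : |g - G p| ≤ 1 / ((k : ℝ) + 1) := h' p k
  have h0 : 1 / ((k : ℝ) + 1) ≤ 1 := by
    rw [div_le_one (by positivity)]; simp
  have hf : |f| ≤ A p + 1 := by
    have := abs_sub_abs_le_abs_sub f (F p)
    linarith [hFA p]
  have h3 : f * g - F p * G p = f * (g - G p) + (f - F p) * G p := by ring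
  rw [h3]
  calc _ ≤ |f| * |g - G p| + |f - F p| * |G p| := by
        rw [← abs_mul, ← abs_mul]; exact abs_add_le _ _
    _ ≤ (A p + 1) * (1 / ((k : ℝ) + 1)) + 1 / ((k : ℝ) + 1) * B p := by
        gcongr; exact hGB p
    _ = _ := by ring

theorem inv (hF : CReal F) (h1 : ∀ p, 1 ≤ F p) : CReal fun p => (F p)⁻¹ := by
  obtain ⟨a, ha, h⟩ := hF
  -- The shifted index makes the approximation at least 1/2: `ratInv` is then applied to a positive
  -- number, and the quotient loses at most a factor 2.
  have hc : Computable fun x : α × ℕ => ratInv (a x.1 (x.2 + 1)) :=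
    primrec_ratInv.to_comp.comp (ha.comp Computable.fst (Computable.succ.comp Computable.snd))
  refine limit (rat hc) (Computable.const 2) fun p k => ?_
  have h2 := h p (k + 1)
  push_cast at h2
  have h3 : (1 : ℝ) / ((k : ℝ) + 1 + 1) ≤ 1 / 2 := by
    apply one_div_le_one_div_of_le (by norm_num)
    have : (0 : ℝ) ≤ k := Nat.cast_nonneg _
    linarith
  have h4 : (1 : ℝ) / ((k : ℝ) + 1 + 1) ≤ 1 / (k + 1) := by
    apply one_div_le_one_div_of_le (by positivity); linarith
  have h5 : (1 : ℝ) / 2 ≤ (ratOf (a p (k + 1)) : ℝ) := by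
    have := (abs_le.1 h2).1
    linarith [h1 p]
  have h6 : 0 < ratOf (a p (k + 1)) := by
    have : (0 : ℝ) < (ratOf (a p (k + 1)) : ℝ) := by linarith
    exact_mod_cast this
  simp only [ratOf_ratInv h6]
  push_cast
  set f := (ratOf (a p (k + 1)) : ℝ)
  have hF1 := h1 p
  rw [inv_sub_inv (by linarith) (by linarith), abs_div, abs_sub_comm, div_le_iff₀ (by positivity),
    abs_of_pos (show 0 < f * F p by positivity)]
  have h7 : (1 : ℝ) / 2 ≤ f * F p := by nlinarith
  calc |f - F p| ≤ 1 / ((k : ℝ) + 1) := h2.trans h4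
    _ = 2 / (k + 1) * (1 / 2) := by ring
    _ ≤ _ := by gcongr

theorem div (hF : CReal F) (hG : CReal G) (h1 : ∀ p, 1 ≤ G p) : CReal fun p => F p / G p := by
  simpa only [div_eq_mul_inv] using hF.mul (hG.inv h1)

theorem sum {F : α × ℕ → ℝ} (hF : CReal F) {N : α → ℕ} (hN : Computable N) :
    CReal fun p => ∑ j ∈ Finset.range (N p), F (p, j) := by
  obtain ⟨a, ha, h⟩ := hF
  let s : α × ℕ → ℕ → ℕ := fun x m => Nat.rec 0 (fun j c => ratAdd c (a (x.1, j) x.2)) m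
  have hs : ∀ x m, ratOf (s x m) = ∑ j ∈ Finset.range m, ratOf (a (x.1, j) x.2) := by
    intro x m
    induction m with
    | zero => simp [s, ratOf]
    | succ m ih =>
      rw [Finset.sum_range_succ, ← ih, ← ratOf_ratAdd]
  have hc : Computable fun x : α × ℕ => s x (N x.1) := by
    refine Computable.nat_rec (h := fun (x : α × ℕ) (q : ℕ × ℕ) => ratAdd q.2 (a (x.1, q.1) x.2))
      (hN.comp Computable.fst) (Computable.const 0) ?_
    exact primrec_ratAdd.to_comp.comp (Computable.snd.comp Computable.snd)
      (ha.comp (Computable.pair (Computable.fst.comp Computable.fst)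
        (Computable.fst.comp Computable.snd)) (Computable.snd.comp Computable.fst))
  refine limit (rat hc) hN fun p k => ?_
  simp only [hs]
  push_cast
  rw [← Finset.sum_sub_distrib]
  refine (Finset.abs_sum_le_sum_abs _ _).trans ?_
  refine (Finset.sum_le_sum fun j _ => h (p, j) k).trans ?_
  simp [div_eq_mul_inv]

theorem ratPow {g h : α → ℕ} (hg : Computable g) (hh : Computable h) :
    CReal fun p => (ratOf (g p) : ℝ) ^ h p := by
  let s : ℕ → ℕ → ℕ := fun x m => Nat.rec (Nat.pair (Nat.pair 1 0) 0) (fun _ c => ratMul c x) m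
  have hs : ∀ x m, ratOf (s x m) = ratOf x ^ m := by
    intro x m
    induction m with
    | zero => simp [s, ratOf]
    | succ m ih => rw [pow_succ, ← ih, ← ratOf_ratMul]
  have hc : Computable fun p => s (g p) (h p) := by
    refine Computable.nat_rec (h := fun (p : α) (q : ℕ × ℕ) => ratMul q.2 (g p)) hh (Computable.const _) ?_
    exact primrec_ratMul.to_comp.comp (Computable.snd.comp Computable.snd)
      (hg.comp Computable.fst)
  have := rat hc
  simp only [hs] at this
  push_cast at this
  exact this

end CReal


/-! ### Evaluation of arctan, π and cos -/

namespace CReal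

variable {α : Type*} [Primcodable α]

theorem comp_lipschitz {φ : ℝ → ℝ} (hφ : CReal fun n : ℕ => φ (ratOf n)) (K : ℕ)
    (hK : ∀ x y, |φ x - φ y| ≤ K * |x - y|) {F : α → ℝ} (hF : CReal F) :
    CReal fun p => φ (F p) := by
  obtain ⟨a, ha, h⟩ := hF
  refine limit (G := fun x : α × ℕ => φ (ratOf (a x.1 x.2))) (hφ.comp ha)
    (Computable.const K) fun p k => ?_
  calc _ ≤ (K : ℝ) * |(ratOf (a p k) : ℝ) - F p| := hK _ _
    _ ≤ K * (1 / ((k : ℝ) + 1)) := by gcongr; exact h p k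
    _ = _ := by ring

/-- Mean value inequality for arctan t - t/(1 + a²), whose derivative at t is bounded by |t - a|.
This is the local error of a Riemann sum. -/
theorem arctan_sub_le (a b : ℝ) :
    |Real.arctan b - Real.arctan a - (b - a) / (1 + a ^ 2)| ≤ (b - a) ^ 2 := by
  have h := Convex.norm_image_sub_le_of_norm_hasDerivWithin_le
    (f := fun t => Real.arctan t - t / (1 + a ^ 2)) (f' := fun t => 1 / (1 + t ^ 2) - 1 / (1 + a ^ 2))
    (C := |b - a|) (s := uIcc a b) (x := a) (y := b)
    (fun t _ => ((Real.hasDerivAt_arctan t).sub ((hasDerivAt_id t).div_const _)).hasDerivWithinAt)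
    (fun t ht => ?_) (convex_uIcc a b) left_mem_uIcc right_mem_uIcc
  · simp only [Real.norm_eq_abs] at h
    have h2 : |b - a| * |b - a| = (b - a) ^ 2 := by rw [← abs_mul, ← sq, abs_sq]
    rw [h2] at h
    convert! h using 2
    ring
  · rw [Real.norm_eq_abs, div_sub_div _ _ (by positivity) (by positivity), abs_div,
      div_le_iff₀ (by positivity)]
    have h1 : |(1 + t ^ 2) * (1 + a ^ 2)| = (1 + t ^ 2) * (1 + a ^ 2) := abs_of_pos (by positivity)
    have h2 : |1 * (1 + a ^ 2) - (1 + t ^ 2) * 1| = |t - a| * |a + t| := by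
      rw [← abs_mul, ← abs_neg]; congr 1; ring
    have h3 : |t - a| ≤ |b - a| := abs_sub_left_of_mem_uIcc ht
    have h4 : |a + t| ≤ (1 + t ^ 2) * (1 + a ^ 2) := by
      rw [abs_le]
      constructor <;> nlinarith [sq_nonneg (a * t), sq_nonneg (a + 1), sq_nonneg (t + 1),
        sq_nonneg (a - 1), sq_nonneg (t - 1)]
    rw [h1, h2]
    gcongr

theorem arctan_lipschitz (x y : ℝ) : |Real.arctan x - Real.arctan y| ≤ (1 : ℕ) * |x - y| := by
  have h := Convex.norm_image_sub_le_of_norm_hasDerivWithin_le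
    (f := Real.arctan) (f' := fun t => 1 / (1 + t ^ 2)) (C := 1) (s := univ) (x := y) (y := x)
    (fun t _ => (Real.hasDerivAt_arctan t).hasDerivWithinAt)
    (fun t _ => ?_) convex_univ (mem_univ _) (mem_univ _)
  · simpa using h
  · rw [Real.norm_eq_abs, abs_of_pos (by positivity), div_le_one (by positivity)]
    nlinarith [sq_nonneg t]

/-- Left Riemann sum of 1/(1 + t²) with k + 1 steps h = x/(k + 1). Each step costs at most h², in
total x²/(k + 1). -/
theorem arctan_rat : CReal fun n : ℕ => Real.arctan (ratOf n) := by
  have hx2 : CReal fun n : ℕ => (ratOf n : ℝ) * ratOf n :=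
    (rat Computable.id).mul (rat Computable.id)
  obtain ⟨B, hB, hxB⟩ := hx2.exists_bound
  have hterm : CReal fun p : (ℕ × ℕ) × ℕ => ((ratOf p.1.1 : ℝ) / ((p.1.2 + 1 : ℕ) : ℝ)) /
      (1 + ((p.2 : ℝ) * ((ratOf p.1.1 : ℝ) / ((p.1.2 + 1 : ℕ) : ℝ))) *
        ((p.2 : ℝ) * ((ratOf p.1.1 : ℝ) / ((p.1.2 + 1 : ℕ) : ℝ)))) := by
    have hh : CReal fun p : (ℕ × ℕ) × ℕ => (ratOf p.1.1 : ℝ) / ((p.1.2 + 1 : ℕ) : ℝ) :=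
      (rat (Computable.fst.comp Computable.fst)).div
        (nat (g := fun p : (ℕ × ℕ) × ℕ => p.1.2 + 1)
          (Computable.succ.comp (Computable.snd.comp Computable.fst)))
        (fun p => by push_cast; linarith [Nat.cast_nonneg (α := ℝ) p.1.2])
    have hj := (nat (g := fun p : (ℕ × ℕ) × ℕ => p.2) Computable.snd).mul hh
    have h1 : CReal fun _ : (ℕ × ℕ) × ℕ => (1 : ℝ) := by simpa using ratConst 1
    exact hh.div (h1.add (hj.mul hj)) fun p => by
      linarith [mul_self_nonneg ((p.2 : ℝ) * ((ratOf p.1.1 : ℝ) / ((p.1.2 + 1 : ℕ) : ℝ)))]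
  refine limit (sum hterm (N := fun p : ℕ × ℕ => p.2 + 1)
    (Computable.succ.comp Computable.snd)) hB fun n k => ?_
  simp only
  set x : ℝ := (ratOf n : ℝ)
  set h : ℝ := x / ((k + 1 : ℕ) : ℝ) with hh
  have hk : (0 : ℝ) < (k + 1 : ℕ) := by positivity
  have key : ∀ m : ℕ, |∑ j ∈ Finset.range m, h / (1 + (j * h) * (j * h)) - Real.arctan (m * h)| ≤
      m * h ^ 2 := by
    intro m
    induction m with
    | zero => simp
    | succ m ih =>
      rw [Finset.sum_range_succ]
      have h1 := arctan_sub_le (m * h) ((m + 1 : ℕ) * h)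
      have h2 : ((m + 1 : ℕ) : ℝ) * h - m * h = h := by push_cast; ring
      rw [h2, abs_sub_comm] at h1
      have h3 : ∑ j ∈ Finset.range m, h / (1 + (j * h) * (j * h)) + h / (1 + (m * h) * (m * h)) -
          Real.arctan ((m + 1 : ℕ) * h) =
          (∑ j ∈ Finset.range m, h / (1 + (j * h) * (j * h)) - Real.arctan (m * h)) +
          (h / (1 + (m * h) ^ 2) - (Real.arctan ((m + 1 : ℕ) * h) - Real.arctan (m * h))) := by
        rw [sq]; ring
      rw [h3]
      refine (abs_add_le _ _).trans ((add_le_add ih h1).trans (le_of_eq ?_))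
      push_cast; ring
  have h1 := key (k + 1)
  have h2 : ((k + 1 : ℕ) : ℝ) * h = x := by rw [hh]; field_simp
  rw [h2] at h1
  refine h1.trans ?_
  have h3 : ((k + 1 : ℕ) : ℝ) * h ^ 2 = x * x / ((k : ℝ) + 1) := by
    rw [hh]; push_cast; field_simp
  rw [h3]
  gcongr
  exact (le_abs_self _).trans (hxB n)

theorem arctan {F : α → ℝ} (hF : CReal F) : CReal fun p => Real.arctan (F p) :=
  comp_lipschitz arctan_rat 1 arctan_lipschitz hF

theorem pi : CReal fun _ : α => Real.pi := by
  have h := (ratConst (α := α) 4).mul (arctan (ratConst (α := α) 1))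
  have h2 : ((4 : ℚ) : ℝ) * Real.arctan ((1 : ℚ) : ℝ) = Real.pi := by
    push_cast; rw [Real.arctan_one]; ring
  rwa [h2] at h

theorem primrec_factorial : Primrec Nat.factorial := by
  have h : Primrec fun n : ℕ => (Nat.rec 1 (fun j c => (j + 1) * c) n : ℕ) :=
    Primrec.nat_rec₁ 1 (Primrec.nat_mul.comp (Primrec.succ.comp Primrec.fst) Primrec.snd)
  refine h.of_eq fun n => ?_
  induction n with
  | zero => rfl
  | succ n ih => rw [Nat.factorial_succ, ← ih]

/-- Real part of the remainder estimate for the exponential series at ix, cut off after 2N terms;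
the odd terms are imaginary. -/
theorem cos_sub_sum_le (x : ℝ) (N : ℕ) (h : |x| / ((2 * N : ℕ).succ : ℝ) ≤ 1 / 2) :
    |Real.cos x - ∑ j ∈ Finset.range N, (-(x * x)) ^ j / ((2 * j).factorial : ℝ)| ≤
      |x| ^ (2 * N) / ((2 * N).factorial : ℝ) * 2 := by
  have h1 := Complex.exp_bound' (x := x * Complex.I) (n := 2 * N) (by simpa using h)
  have hre : ∀ M : ℕ, (∑ m ∈ Finset.range (2 * M), (x * Complex.I) ^ m / (m.factorial : ℂ)).re =
      ∑ j ∈ Finset.range M, (-(x * x)) ^ j / ((2 * j).factorial : ℝ) := by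
    intro M
    induction M with
    | zero => simp
    | succ M ih =>
      rw [mul_add_one, Finset.sum_range_succ, Finset.sum_range_succ, Finset.sum_range_succ,
        Complex.add_re, Complex.add_re, ih]
      have e1 : ((x : ℂ) * Complex.I) ^ (2 * M) = ((-(x * x)) ^ M : ℝ) := by
        rw [pow_mul, mul_pow, Complex.I_sq]; push_cast; ring
      have e2 : ((x : ℂ) * Complex.I) ^ (2 * M + 1) = ((-(x * x)) ^ M * x : ℝ) * Complex.I := by
        rw [pow_succ, e1]; push_cast; ring
      have c1 : (((2 * M).factorial : ℕ) : ℂ) = (((2 * M).factorial : ℝ) : ℂ) := by push_cast; rfl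
      have c2 : (((2 * M + 1).factorial : ℕ) : ℂ) = (((2 * M + 1).factorial : ℝ) : ℂ) := by
        push_cast; rfl
      rw [e1, e2, c1, c2, ← Complex.ofReal_div, Complex.ofReal_re, mul_div_right_comm,
        ← Complex.ofReal_div, Complex.re_ofReal_mul, Complex.I_re, mul_zero, add_zero]
  have h2 := (Complex.abs_re_le_norm _).trans h1
  rw [Complex.sub_re, hre, Complex.exp_ofReal_mul_I_re] at h2
  simpa using h2

/-- With |x| ≤ R and N = k + R terms, (2|x|)^(2N)/(2N)! ≤ exp(2|x|) ≤ 9^R. Dividing by 2^(2N) ≥ k +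
1 leaves a remainder of at most 2 · 9^R/(k + 1). -/
theorem cos_rat : CReal fun n : ℕ => Real.cos (ratOf n) := by
  obtain ⟨R, hR, hxR⟩ := (rat (α := ℕ) Computable.id).exists_bound
  have hterm : CReal fun p : (ℕ × ℕ) × ℕ => (-((ratOf p.1.1 : ℝ) * ratOf p.1.1)) ^ p.2 /
      ((2 * p.2).factorial : ℝ) := by
    have hx : Computable fun p : (ℕ × ℕ) × ℕ => p.1.1 := Computable.fst.comp Computable.fst
    have h1 := ratPow (g := fun p : (ℕ × ℕ) × ℕ => ratNeg (ratMul p.1.1 p.1.1))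
      (primrec_ratNeg.to_comp.comp (primrec_ratMul.to_comp.comp hx hx))
      (h := fun p => p.2) Computable.snd
    simp only [ratOf_ratNeg, ratOf_ratMul] at h1
    push_cast at h1
    have hf : Computable fun p : (ℕ × ℕ) × ℕ => (2 * p.2).factorial :=
      (primrec_factorial.comp (Primrec.nat_double.comp Primrec.snd)).to_comp
    exact h1.div (nat hf) fun p => by exact_mod_cast Nat.one_le_iff_ne_zero.2 (Nat.factorial_ne_zero _)
  have hN : Computable fun p : ℕ × ℕ => p.2 + R p.1 :=
    Primrec.nat_add.to_comp.comp Computable.snd (hR.comp Computable.fst)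
  have hB : Computable fun n => 2 * 9 ^ R n := by
    have h9 : Primrec fun n : ℕ => 9 ^ n := by
      have h : Primrec fun n : ℕ => (Nat.rec 1 (fun _ c => 9 * c) n : ℕ) :=
        Primrec.nat_rec₁ 1 (Primrec.nat_mul.comp (Primrec.const 9) Primrec.snd)
      refine h.of_eq fun n => ?_
      induction n with
      | zero => rfl
      | succ n ih => rw [pow_succ', ← ih]
    exact Primrec.nat_double.to_comp.comp (h9.to_comp.comp hR)
  refine limit (sum hterm hN) hB fun n k => ?_
  simp only
  set x : ℝ := (ratOf n : ℝ)
  have hx : |x| ≤ R n := hxR n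
  have hk : (0 : ℝ) ≤ k := Nat.cast_nonneg _
  rw [abs_sub_comm]
  refine (cos_sub_sum_le x (k + R n) ?_).trans ?_
  · rw [div_le_iff₀ (by positivity)]
    push_cast
    linarith
  · have h1 := Real.pow_div_factorial_le_exp (2 * |x|) (by positivity) (2 * (k + R n))
    have h2 : Real.exp (2 * |x|) ≤ 9 ^ R n := by
      calc Real.exp (2 * |x|) ≤ Real.exp ((2 * R n : ℕ) * 1) := by
            apply Real.exp_le_exp.2; push_cast; linarith
        _ = Real.exp 1 ^ (2 * R n) := by rw [Real.exp_nat_mul]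
        _ ≤ 3 ^ (2 * R n) := by
            gcongr; linarith [Real.exp_one_lt_d9]
        _ = 9 ^ R n := by rw [pow_mul]; norm_num
    have h4 : (k : ℝ) + 1 ≤ 2 ^ (2 * (k + R n)) := by
      have : k + 1 ≤ 2 ^ (2 * (k + R n)) :=
        (Nat.lt_two_pow_self (n := k)).trans_le (Nat.pow_le_pow_right (by norm_num) (by omega))
      exact_mod_cast this
    rw [mul_pow] at h1
    have h5 := h1.trans h2
    push_cast
    rw [le_div_iff₀ (by positivity)]
    calc |x| ^ (2 * (k + R n)) / ((2 * (k + R n)).factorial : ℝ) * 2 * (k + 1)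
        ≤ |x| ^ (2 * (k + R n)) / ((2 * (k + R n)).factorial : ℝ) * 2 * 2 ^ (2 * (k + R n)) := by
          gcongr
      _ = 2 * (2 ^ (2 * (k + R n)) * |x| ^ (2 * (k + R n)) / ((2 * (k + R n)).factorial : ℝ)) := by
          ring
      _ ≤ _ := by gcongr

theorem cos_lipschitz (x y : ℝ) : |Real.cos x - Real.cos y| ≤ (1 : ℕ) * |x - y| := by
  have h := Convex.norm_image_sub_le_of_norm_hasDerivWithin_le
    (f := Real.cos) (f' := fun t => -Real.sin t) (C := 1) (s := univ) (x := y) (y := x)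
    (fun t _ => (Real.hasDerivAt_cos t).hasDerivWithinAt)
    (fun t _ => by rw [norm_neg]; exact Real.abs_sin_le_one t) convex_univ (mem_univ _) (mem_univ _)
  simpa using h

end CReal

/-! ## Computable, effectively locally Lipschitz functions on `ℝ ^ d` -/

/-- A real function on `ℝ ^ d` whose values at the rational points form a computable family and which
has computable Lipschitz constants on balls. -/
def CFun {d : ℕ} (h : (Fin d → ℝ) → ℝ) : Prop :=
  (CReal fun p : ℕ => h (vecOf d p)) ∧
    ∃ L : ℕ → ℕ, Computable L ∧ ∀ (R : ℕ) (x y : Fin d → ℝ), ‖x‖ ≤ R → ‖y‖ ≤ R →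
      |h x - h y| ≤ L R * ‖x - y‖

theorem primrec_vecOf_code {i : ℕ} :
    Primrec fun p : ℕ => (Denumerable.ofNat (List ℕ) p).getD i 0 :=
  (Primrec.list_getD 0).comp (Primrec.ofNat _) (Primrec.const i)

namespace CFun

variable {d : ℕ} {f g : (Fin d → ℝ) → ℝ}

theorem const {c : ℝ} (hc : CReal fun _ : ℕ => c) : CFun fun _ : Fin d → ℝ => c :=
  ⟨hc, fun _ => 0, Computable.const 0, fun R x y _ _ => by simp⟩

theorem ratConst (q : ℚ) : CFun fun _ : Fin d → ℝ => (q : ℝ) := const (CReal.ratConst q)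

theorem natConst (n : ℕ) : CFun fun _ : Fin d → ℝ => (n : ℝ) :=
  const (CReal.nat (Computable.const n))

theorem proj (i : Fin d) : CFun fun x : Fin d → ℝ => x i :=
  ⟨CReal.rat primrec_vecOf_code.to_comp, fun _ => 1, Computable.const 1, fun R x y _ _ => by
    simpa using norm_le_pi_norm (x - y) i⟩

theorem add (hf : CFun f) (hg : CFun g) : CFun fun x => f x + g x := by
  obtain ⟨cf, L, hL, hfL⟩ := hf
  obtain ⟨cg, K, hK, hgK⟩ := hg
  refine ⟨cf.add cg, fun R => L R + K R, Primrec.nat_add.to_comp.comp hL hK, fun R x y hx hy => ?_⟩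
  rw [add_sub_add_comm]
  push_cast
  rw [add_mul]
  exact (abs_add_le _ _).trans (add_le_add (hfL R x y hx hy) (hgK R x y hx hy))

theorem exists_bound (hf : CFun f) : ∃ B : ℕ → ℕ, Computable B ∧
    ∀ (R : ℕ) (x : Fin d → ℝ), ‖x‖ ≤ R → |f x| ≤ B R := by
  obtain ⟨cf, L, hL, hfL⟩ := hf
  obtain ⟨c, hc⟩ := exists_nat_ge |f 0|
  refine ⟨fun R => c + L R * R, Primrec.nat_add.to_comp.comp (Computable.const c)
    (Primrec.nat_mul.to_comp.comp hL Computable.id), fun R x hx => ?_⟩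
  have h := hfL R x 0 hx (by simp)
  rw [sub_zero] at h
  have h2 := abs_sub_abs_le_abs_sub (f x) (f 0)
  push_cast
  have h3 : (L R : ℝ) * ‖x‖ ≤ L R * R := by gcongr
  linarith

theorem mul (hf : CFun f) (hg : CFun g) : CFun fun x => f x * g x := by
  obtain ⟨A, hA, hfA⟩ := hf.exists_bound
  obtain ⟨B, hB, hgB⟩ := hg.exists_bound
  obtain ⟨cf, L, hL, hfL⟩ := hf
  obtain ⟨cg, K, hK, hgK⟩ := hg
  refine ⟨cf.mul cg, fun R => A R * K R + L R * B R, Primrec.nat_add.to_comp.comp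
    (Primrec.nat_mul.to_comp.comp hA hK) (Primrec.nat_mul.to_comp.comp hL hB), fun R x y hx hy => ?_⟩
  have h3 : f x * g x - f y * g y = f x * (g x - g y) + (f x - f y) * g y := by ring
  rw [h3]
  push_cast
  calc _ ≤ |f x| * |g x - g y| + |f x - f y| * |g y| := by
        rw [← abs_mul, ← abs_mul]; exact abs_add_le _ _
    _ ≤ A R * (K R * ‖x - y‖) + L R * ‖x - y‖ * B R := by
        gcongr
        · exact hfA R x hx
        · exact hgK R x y hx hy
        · exact hfL R x y hx hy
        · exact hgB R y hy
    _ = _ := by ring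

theorem neg (hf : CFun f) : CFun fun x => -f x := by
  simpa using (ratConst (-1)).mul hf

theorem sub (hf : CFun f) (hg : CFun g) : CFun fun x => f x - g x := by
  simpa only [sub_eq_add_neg] using hf.add hg.neg

theorem inv (hf : CFun f) (h1 : ∀ x, 1 ≤ f x) : CFun fun x => (f x)⁻¹ := by
  obtain ⟨cf, L, hL, hfL⟩ := hf
  refine ⟨cf.inv fun p => h1 _, L, hL, fun R x y hx hy => ?_⟩
  have hx1 := h1 x
  have hy1 := h1 y
  rw [inv_sub_inv (by linarith) (by linarith), abs_div, abs_sub_comm,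
    abs_of_pos (show 0 < f x * f y by positivity)]
  exact (div_le_self (abs_nonneg _) (by nlinarith)).trans (hfL R x y hx hy)

theorem div (hf : CFun f) (hg : CFun g) (h1 : ∀ x, 1 ≤ g x) : CFun fun x => f x / g x := by
  simpa only [div_eq_mul_inv] using hf.mul (hg.inv h1)

theorem comp_lipschitz {φ : ℝ → ℝ} (hφ : CReal fun n : ℕ => φ (ratOf n)) (K : ℕ)
    (hK : ∀ x y, |φ x - φ y| ≤ K * |x - y|) (hf : CFun f) : CFun fun x => φ (f x) := by
  obtain ⟨cf, L, hL, hfL⟩ := hf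
  refine ⟨CReal.comp_lipschitz hφ K hK cf, fun R => K * L R,
    Primrec.nat_mul.to_comp.comp (Computable.const K) hL, fun R x y hx hy => ?_⟩
  push_cast
  rw [mul_assoc]
  exact (hK _ _).trans (by gcongr; exact hfL R x y hx hy)

theorem arctan (hf : CFun f) : CFun fun x => Real.arctan (f x) :=
  comp_lipschitz CReal.arctan_rat 1 CReal.arctan_lipschitz hf

theorem cos (hf : CFun f) : CFun fun x => Real.cos (f x) :=
  comp_lipschitz CReal.cos_rat 1 CReal.cos_lipschitz hf

theorem sum {ι : Type*} (s : Finset ι) {F : ι → (Fin d → ℝ) → ℝ} (h : ∀ i ∈ s, CFun (F i)) :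
    CFun fun x => ∑ i ∈ s, F i x := by
  classical
  induction s using Finset.induction_on with
  | empty => simpa using ratConst (d := d) 0
  | insert a s ha ih =>
    simp only [Finset.sum_insert ha]
    exact (h a (Finset.mem_insert_self _ _)).add
      (ih fun i hi => h i (Finset.mem_insert_of_mem hi))

end CFun


/-! ### From effective Lipschitz bounds to oracle machines -/

theorem OracleMachine.exists_outputs (M : OracleMachine) (φ : ℕ → ℕ) (n : ℕ)
    (h : ∃ L, (M.run ((List.range L).map φ) n).isSome) :
    ∃ v, M.Outputs φ n v ∧ ∃ L, M.run ((List.range L).map φ) n = some v := by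
  classical
  obtain ⟨v, hv⟩ := Option.isSome_iff_exists.1 (Nat.find_spec h)
  refine ⟨v, ⟨_, hv, fun L' hL' => ?_⟩, _, hv⟩
  simpa using Nat.find_min h hL'

theorem vecOf_encode_ofFn {e : ℕ} (g : Fin e → ℕ) :
    vecOf e (Encodable.encode (List.ofFn g)) = fun i => ((ratOf (g i) : ℚ) : ℝ) := by
  funext i
  rw [vecOf, Denumerable.ofNat_encode]
  congr 2
  rw [List.getD_eq_getElem _ _ (by simp)]
  simp

theorem exists_computable_sum {ι : Type*} [Fintype ι] {α : Type*} [Primcodable α] (f : ι → α → ℕ)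
    (hf : ∀ i, Computable (f i)) : Computable fun a => ∑ i, f i a := by
  classical
  have : ∀ s : Finset ι, Computable fun a => ∑ i ∈ s, f i a := by
    intro s
    induction s using Finset.induction_on with
    | empty => simpa using Computable.const 0
    | insert a s ha ih =>
      simp only [Finset.sum_insert ha]
      exact Primrec.nat_add.to_comp.comp (hf a) ih
  exact this _

theorem exists_norm_vecOf_le (d : ℕ) : ∃ B : ℕ → ℕ, Computable B ∧ ∀ p, ‖vecOf d p‖ ≤ B p := by
  have h : ∀ i : Fin d, ∃ B : ℕ → ℕ, Computable B ∧ ∀ p, |vecOf d p i| ≤ B p := fun i =>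
    (CReal.rat (α := ℕ) (primrec_vecOf_code (i := (i : ℕ))).to_comp).exists_bound
  choose B hB hvB using h
  refine ⟨fun p => ∑ i, B i p, exists_computable_sum B hB, fun p => ?_⟩
  rw [pi_norm_le_iff_of_nonneg (by positivity)]
  intro i
  refine (hvB i p).trans ?_
  exact_mod_cast Finset.single_le_sum (f := fun i => B i p) (fun _ _ => Nat.zero_le _)
    (Finset.mem_univ i)

theorem primrec_two_pow : Primrec fun n : ℕ => 2 ^ n := by
  have h : Primrec fun n : ℕ => (Nat.rec 1 (fun _ c => 2 * c) n : ℕ) :=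
    Primrec.nat_rec₁ 1 (Primrec.nat_mul.comp (Primrec.const 2) Primrec.snd)
  refine h.of_eq fun n => ?_
  induction n with
  | zero => rfl
  | succ n ih => rw [pow_succ', ← ih]

theorem natCast_le_two_pow (n : ℕ) : (n : ℝ) ≤ 2 ^ n := by
  exact_mod_cast (Nat.lt_two_pow_self (n := n)).le

/-- A map whose components are computable with effective Lipschitz constants is computable. -/
theorem isComputableMap_of_cfun {d e : ℕ} {h : (Fin d → ℝ) → (Fin e → ℝ)}
    (hh : ∀ i, CFun fun x => h x i) : IsComputableMap h := by
  choose ha L hL hhL using hh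
  choose a hac ha using ha
  obtain ⟨B, hB, hvB⟩ := exists_norm_vecOf_le d
  let K : ℕ → ℕ := fun R => ∑ i, L i R
  have hK : Computable K := exists_computable_sum L hL
  -- The answer q to the query 0 bounds the norm of the point, hence yields a Lipschitz constant K ≤
  -- 2^K. At this precision the error of the argument contributes at most 2^(-(n + 2)).
  let idx : ℕ → ℕ → ℕ := fun q n => n + 2 + K (B q + 2)
  let out : ℕ → ℕ → ℕ := fun p n => Encodable.encode (List.ofFn fun i => a i p (2 ^ (n + 2)))
  have hidx : Computable₂ idx := Primrec.nat_add.to_comp.comp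
    (Computable.succ.comp (Computable.succ.comp Computable.snd))
    (hK.comp (Computable.succ.comp (Computable.succ.comp (hB.comp Computable.fst))))
  have hout : Computable₂ out := Computable.encode.comp (Computable.list_ofFn fun i =>
    (hac i).comp Computable.fst
      (primrec_two_pow.to_comp.comp (Computable.succ.comp (Computable.succ.comp Computable.snd))))
  let M : OracleMachine :=
    { run := fun l n => (l[0]?).bind fun q => (l[idx q n]?).map fun p => out p n
      computable_run := by
        refine Computable.option_bind
          (Computable.list_getElem?.comp Computable.fst (Computable.const 0)) ?_
        refine Computable.option_map (f := fun x : (List ℕ × ℕ) × ℕ => x.1.1[idx x.2 x.1.2]?)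
          (g := fun x p => out p x.1.2) ?_ ?_
        · exact Computable.list_getElem?.comp (Computable.fst.comp Computable.fst)
            (hidx.comp Computable.snd (Computable.snd.comp Computable.fst))
        · exact hout.comp Computable.snd
            (Computable.snd.comp (Computable.fst.comp Computable.fst)) }
  refine ⟨M, fun x φ hφ n => ?_⟩
  set m := idx (φ 0) n with hm
  have hget : ∀ (N j : ℕ), ((List.range N).map φ)[j]? = if j < N then some (φ j) else none := by
    intro N j
    rw [List.getElem?_map]
    split_ifs with hj
    · rw [List.getElem?_range hj]; rfl
    · rw [List.getElem?_eq_none (by simpa using hj)]; rfl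
  have hrun : ∀ N, M.run ((List.range N).map φ) n =
      if 0 < N then (if m < N then some (out (φ m) n) else none) else none := by
    intro N
    simp only [M, hget]
    split_ifs with h1 h2 <;> simp_all
  obtain ⟨v, hv, N, hN⟩ := M.exists_outputs φ n ⟨m + 1, by rw [hrun]; simp⟩
  refine ⟨v, hv, ?_⟩
  rw [hrun] at hN
  have hvout : out (φ m) n = v := by
    split_ifs at hN
    exact Option.some_inj.1 hN
  rw [← hvout]
  simp only [out, vecOf_encode_ofFn]
  rw [pi_norm_lt_iff (by positivity)]
  intro i
  simp only [Pi.sub_apply, Real.norm_eq_abs]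
  set p := vecOf d (φ m) with hp
  have hx0 := hφ 0
  have hxm := hφ m
  have hx : ‖x‖ ≤ (B (φ 0) + 2 : ℕ) := by
    have := norm_sub_norm_le x (vecOf d (φ 0))
    rw [norm_sub_rev] at this
    have := hvB (φ 0)
    push_cast
    rw [pow_zero] at hx0
    linarith
  have hpR : ‖p‖ ≤ (B (φ 0) + 2 : ℕ) := by
    have h1 := norm_sub_norm_le p (vecOf d (φ 0))
    have h2 := hvB (φ 0)
    have h3 : ‖p - vecOf d (φ 0)‖ ≤ ‖p - x‖ + ‖x - vecOf d (φ 0)‖ := norm_sub_le_norm_sub_add_norm_sub _ _ _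
    rw [norm_sub_rev x] at h3
    have h4 : ((2 : ℝ)⁻¹) ^ m ≤ 1 := pow_le_one₀ (by norm_num) (by norm_num)
    push_cast
    rw [pow_zero] at hx0
    linarith
  have h1 := hhL i _ p x hpR hx
  have h2 := ha i (φ m) (2 ^ (n + 2))
  have hpow : (0 : ℝ) < (2 : ℝ)⁻¹ ^ (n + 2) := by positivity
  have h3 : (1 : ℝ) / (((2 ^ (n + 2) : ℕ) : ℝ) + 1) ≤ (2 : ℝ)⁻¹ ^ (n + 2) := by
    rw [inv_pow, ← one_div]
    apply one_div_le_one_div_of_le (by positivity)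
    push_cast; linarith
  have h4 : (L i (B (φ 0) + 2) : ℝ) * ‖p - x‖ ≤ (2 : ℝ)⁻¹ ^ (n + 2) := by
    have hle : L i (B (φ 0) + 2) ≤ K (B (φ 0) + 2) :=
      Finset.single_le_sum (f := fun i => L i (B (φ 0) + 2)) (fun _ _ => Nat.zero_le _)
        (Finset.mem_univ i)
    have h5 : (L i (B (φ 0) + 2) : ℝ) ≤ 2 ^ K (B (φ 0) + 2) :=
      (by exact_mod_cast hle : (L i (B (φ 0) + 2) : ℝ) ≤ (K (B (φ 0) + 2) : ℝ)).trans
        (natCast_le_two_pow _)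
    calc _ ≤ (2 : ℝ) ^ K (B (φ 0) + 2) * (2 : ℝ)⁻¹ ^ m := by gcongr
      _ = (2 : ℝ)⁻¹ ^ (n + 2) := by
        rw [hm]; simp only [idx]
        rw [pow_add, mul_comm, mul_assoc, ← mul_pow, inv_mul_cancel₀ (by norm_num), one_pow, mul_one]
  have h6 : (2 : ℝ)⁻¹ ^ n = 4 * (2 : ℝ)⁻¹ ^ (n + 2) := by
    rw [pow_add]; norm_num; ring
  rw [h6]
  calc _ ≤ _ := abs_sub_le _ (h p i) _
    _ ≤ (2 : ℝ)⁻¹ ^ (n + 2) + (2 : ℝ)⁻¹ ^ (n + 2) := add_le_add (h2.trans h3) (h1.trans h4)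
    _ < _ := by linarith


/-! ## An analytic rounding function -/

/-- An analytic function that fixes the integers and contracts towards them, the more strongly the
larger `w` is; it is the primitive of a Poisson kernel. -/
noncomputable def softRound (w t : ℝ) : ℝ :=
  t - Real.arctan (w / 2 * Real.cos (2 * Real.pi * (t - 1 / 4)) /
    (1 + w / 2 * (1 + Real.cos (2 * Real.pi * t)))) / Real.pi

theorem one_le_softRound_denom {w : ℝ} (hw : 0 ≤ w) (t : ℝ) :
    1 ≤ 1 + w / 2 * (1 + Real.cos (2 * Real.pi * t)) := by
  have := Real.neg_one_le_cos (2 * Real.pi * t)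
  have : 0 ≤ w / 2 * (1 + Real.cos (2 * Real.pi * t)) := by
    apply mul_nonneg <;> linarith
  linarith

theorem softRound_int (w : ℝ) (n : ℤ) : softRound w n = n := by
  have : Real.cos (2 * Real.pi * ((n : ℝ) - 1 / 4)) = 0 := by
    rw [show 2 * Real.pi * ((n : ℝ) - 1 / 4) = -(Real.pi / 2) + n * (2 * Real.pi) by ring,
      Real.cos_add_int_mul_two_pi, Real.cos_neg, Real.cos_pi_div_two]
  rw [softRound, this]
  simp

/-- In the variable tan(πs) the rounding is division by 1 + w. The addition formula of arctan turns
this into the defining expression, which has no poles at the half-integers, as its denominator is at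
least 1. -/
theorem softRound_eq {w : ℝ} (hw : 0 ≤ w) (n : ℤ) {s : ℝ} (hs : |s| < 1 / 2) :
    softRound w (n + s) = n + Real.arctan (Real.tan (Real.pi * s) / (1 + w)) / Real.pi := by
  have hpi := Real.pi_pos
  obtain ⟨h1, h2⟩ := abs_lt.1 hs
  have hlow : -(Real.pi / 2) < Real.pi * s := by nlinarith
  have hup : Real.pi * s < Real.pi / 2 := by nlinarith
  have hc : 0 < Real.cos (Real.pi * s) := Real.cos_pos_of_mem_Ioo ⟨hlow, hup⟩
  have e1 : Real.cos (2 * Real.pi * ((n : ℝ) + s - 1 / 4)) =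
      2 * Real.sin (Real.pi * s) * Real.cos (Real.pi * s) := by
    rw [show 2 * Real.pi * ((n : ℝ) + s - 1 / 4) =
      (2 * (Real.pi * s) - Real.pi / 2) + n * (2 * Real.pi) by ring,
      Real.cos_add_int_mul_two_pi, Real.cos_sub_pi_div_two, Real.sin_two_mul]
  have e2 : Real.cos (2 * Real.pi * ((n : ℝ) + s)) = 2 * Real.cos (Real.pi * s) ^ 2 - 1 := by
    rw [show 2 * Real.pi * ((n : ℝ) + s) = 2 * (Real.pi * s) + n * (2 * Real.pi) by ring,
      Real.cos_add_int_mul_two_pi, Real.cos_two_mul]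
  have hsc := Real.sin_sq_add_cos_sq (Real.pi * s)
  have htan : Real.arctan (Real.tan (Real.pi * s)) = Real.pi * s := Real.arctan_tan hlow hup
  rw [Real.tan_eq_sin_div_cos] at htan ⊢
  set c := Real.cos (Real.pi * s)
  set σ := Real.sin (Real.pi * s)
  have hd : 0 < 1 + w * c ^ 2 := by positivity
  have hw1 : 0 < 1 + w := by linarith
  have hσ : σ ^ 2 = 1 - c ^ 2 := by linarith
  -- Below 1 the addition formula needs no correction by π.
  have hxy : w * σ * c / (1 + w * c ^ 2) * (σ / c / (1 + w)) < 1 := by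
    have : w * σ * c / (1 + w * c ^ 2) * (σ / c / (1 + w)) =
        w * σ ^ 2 / ((1 + w * c ^ 2) * (1 + w)) := by field_simp
    rw [this, div_lt_one (by positivity), hσ]
    have h3 : 0 ≤ w * c ^ 2 := by positivity
    nlinarith
  have hadd := Real.arctan_add hxy
  have hquot : (w * σ * c / (1 + w * c ^ 2) + σ / c / (1 + w)) /
      (1 - w * σ * c / (1 + w * c ^ 2) * (σ / c / (1 + w))) = σ / c := by
    have hne : 1 - w * σ * c / (1 + w * c ^ 2) * (σ / c / (1 + w)) ≠ 0 := by linarith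
    rw [div_eq_iff hne]
    field_simp
    rw [hσ]; ring
  rw [hquot, htan] at hadd
  have harg : w / 2 * (2 * σ * c) / (1 + w / 2 * (1 + (2 * c ^ 2 - 1))) =
      w * σ * c / (1 + w * c ^ 2) := by
    congr 1 <;> ring
  rw [softRound, e1, e2, harg]
  generalize Real.arctan (w * σ * c / (1 + w * c ^ 2)) = u at hadd ⊢
  generalize Real.arctan (σ / c / (1 + w)) = v at hadd ⊢
  field_simp
  linarith

/-- Since arctan is 1-Lipschitz, the image is bounded by |tan(πs)|/(1 + w) before division by π. As
η < 1/2, the cosine stays away from 0, so the contraction factor is as small as desired for large w.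
-/
theorem abs_softRound_sub_le {w η : ℝ} (hw : 0 ≤ w) (hη : η < 1 / 2) (n : ℤ) {t : ℝ}
    (ht : |t - n| ≤ η) :
    |softRound w t - n| ≤ |t - n| / (Real.cos (Real.pi * η) * (1 + w)) := by
  have hpi := Real.pi_pos
  obtain ⟨s, rfl⟩ : ∃ s, t = n + s := ⟨t - n, by ring⟩
  rw [add_sub_cancel_left] at ht ⊢
  have hη0 : 0 ≤ η := (abs_nonneg _).trans ht
  rw [softRound_eq hw n (ht.trans_lt hη), add_sub_cancel_left, abs_div, abs_of_pos hpi]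
  have hcη : 0 < Real.cos (Real.pi * η) :=
    Real.cos_pos_of_mem_Ioo ⟨by nlinarith, by nlinarith⟩
  have hcs : Real.cos (Real.pi * η) ≤ Real.cos (Real.pi * s) := by
    rw [← Real.cos_abs (Real.pi * s), abs_mul, abs_of_pos hpi]
    apply Real.cos_le_cos_of_nonneg_of_le_pi
    · positivity
    · nlinarith
    · gcongr
  have hat : ∀ v : ℝ, |Real.arctan v| ≤ |v| := fun v => by
    simpa using CReal.arctan_lipschitz v 0
  have hw1 : 0 < 1 + w := by linarith
  rw [div_le_iff₀ hpi]
  refine (hat _).trans ?_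
  rw [abs_div, abs_of_pos hw1, Real.tan_eq_sin_div_cos, abs_div,
    abs_of_pos (hcη.trans_le hcs), div_div]
  calc |Real.sin (Real.pi * s)| / (Real.cos (Real.pi * s) * (1 + w))
      ≤ |Real.pi * s| / (Real.cos (Real.pi * η) * (1 + w)) := by
        gcongr ?_ / (?_ * _)
        exact Real.abs_sin_le_abs
    _ = _ := by rw [abs_mul, abs_of_pos hpi]; ring

/-! ## Analytic extension of the step function -/

/-- A trigonometric polynomial which on the integers is the indicator of a residue class. -/
noncomputable def residueInd (N a : ℕ) (t : ℝ) : ℝ :=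
  (∑ j ∈ Finset.range N, Real.cos (2 * Real.pi * ((j : ℝ) * ((t - a) / N)))) / N

/-- The sum is the real part of a geometric sum of powers of an N-th root of unity: it is N if the
root is 1, and 0 otherwise. -/
theorem residueInd_nat {N : ℕ} (hN : 0 < N) (a n : ℕ) :
    residueInd N a n = if n % N = a % N then 1 else 0 := by
  have hN0 : (N : ℝ) ≠ 0 := by positivity
  have hNC : (N : ℂ) ≠ 0 := by exact_mod_cast hN.ne'
  set z : ℂ := Complex.exp (2 * Real.pi * Complex.I * (((n : ℂ) - a) / N)) with hz
  have hre : ∀ j : ℕ, Real.cos (2 * Real.pi * ((j : ℝ) * (((n : ℝ) - a) / N))) = (z ^ j).re := by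
    intro j
    rw [hz, ← Complex.exp_nat_mul, ← Complex.exp_ofReal_mul_I_re]
    congr 2
    push_cast; ring
  have hsum : ∑ j ∈ Finset.range N, Real.cos (2 * Real.pi * ((j : ℝ) * (((n : ℝ) - a) / N))) =
      (∑ j ∈ Finset.range N, z ^ j).re := by
    rw [Complex.re_sum]
    exact Finset.sum_congr rfl fun j _ => hre j
  have h2pi : (2 * Real.pi * Complex.I : ℂ) ≠ 0 := Complex.two_pi_I_ne_zero
  have hz1 : z = 1 ↔ n % N = a % N := by
    rw [hz, Complex.exp_eq_one_iff]
    constructor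
    · rintro ⟨k, hk⟩
      rw [mul_comm (k : ℂ)] at hk
      have h1 := mul_left_cancel₀ h2pi hk
      rw [div_eq_iff hNC] at h1
      have h2 : (n : ℤ) - a = k * N := by exact_mod_cast h1
      have h3 : (N : ℤ) ∣ (n : ℤ) - a := ⟨k, by rw [h2]; ring⟩
      exact ((Nat.modEq_iff_dvd.2 h3) : a ≡ n [MOD N]).symm
    · intro h
      obtain ⟨k, hk⟩ := (Nat.modEq_iff_dvd (n := N) (a := a) (b := n)).1 h.symm
      refine ⟨k, ?_⟩
      have h2 : ((n : ℂ) - a) = N * k := by exact_mod_cast hk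
      rw [h2]; field_simp
  rw [residueInd, hsum]
  split_ifs with h
  · rw [hz1.2 h]; simp [hN0]
  · have hzN : z ^ N = 1 := by
      rw [hz, ← Complex.exp_nat_mul, Complex.exp_eq_one_iff]
      exact ⟨(n : ℤ) - a, by push_cast; field_simp⟩
    have hne : z - 1 ≠ 0 := sub_ne_zero.2 (mt hz1.1 h)
    have hg : (∑ j ∈ Finset.range N, z ^ j) * (z - 1) = 0 := by
      rw [geom_sum_mul, hzN, sub_self]
    rw [(mul_eq_zero.1 hg).resolve_right hne]; simp

theorem abs_residueInd_le (N a : ℕ) (t : ℝ) : |residueInd N a t| ≤ 1 := by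
  rw [residueInd, abs_div, Nat.abs_cast]
  refine div_le_one_of_le₀ ((Finset.abs_sum_le_sum_abs _ _).trans ?_) (Nat.cast_nonneg _)
  refine (Finset.sum_le_sum fun j _ => Real.abs_cos_le_one _).trans ?_
  simp

/-- All frequencies are at most 1, so each cosine has Lipschitz constant at most 2π < 7, and so has
their average. -/
theorem abs_residueInd_sub_le (N a : ℕ) (t u : ℝ) :
    |residueInd N a t - residueInd N a u| ≤ 7 * |t - u| := by
  rcases Nat.eq_zero_or_pos N with rfl | hN
  · simp [residueInd]
  have hN0 : (0 : ℝ) < N := by positivity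
  rw [residueInd, residueInd, ← sub_div, ← Finset.sum_sub_distrib, abs_div, Nat.abs_cast,
    div_le_iff₀ hN0]
  refine (Finset.abs_sum_le_sum_abs _ _).trans ?_
  have : ∀ j ∈ Finset.range N, |Real.cos (2 * Real.pi * ((j : ℝ) * ((t - a) / N))) -
      Real.cos (2 * Real.pi * ((j : ℝ) * ((u - a) / N)))| ≤ 7 * |t - u| := by
    intro j hj
    refine (CReal.cos_lipschitz _ _).trans ?_
    have hjN : (j : ℝ) / N ≤ 1 := by
      rw [div_le_one hN0]; exact_mod_cast (Finset.mem_range.1 hj).le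
    have e : 2 * Real.pi * ((j : ℝ) * ((t - a) / N)) - 2 * Real.pi * ((j : ℝ) * ((u - a) / N)) =
        2 * Real.pi * (j / N) * (t - u) := by ring
    rw [e, abs_mul, abs_of_nonneg (by positivity : 0 ≤ 2 * Real.pi * ((j : ℝ) / N))]
    have : 2 * Real.pi * ((j : ℝ) / N) ≤ 7 := by
      have := Real.pi_lt_d2
      have h0 : (0 : ℝ) ≤ j / N := by positivity
      nlinarith
    rw [Nat.cast_one, one_mul]
    gcongr
  refine (Finset.sum_le_sum this).trans (le_of_eq ?_)
  simp; ring

namespace TuringM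

variable (M : TuringM)

/-- The state of the machine and the two symbols on which a step depends. -/
abbrev Local : Type :=
  Fin (M.lastState + 1) × Fin (M.extraSymbols + 2) × Fin (M.extraSymbols + 2)

/-- The coefficients of the affine functions that describe a step with given local data: the state,
the symbol read and the symbol on its left. -/
def stepCoef (t : M.Local) : Fin 3 → ℚ × ℚ × ℚ :=
  match M.trans t.1 t.2.1 with
  | (q, b, HeadMove.left) => ![(1 / M.base, 0, -t.2.2 / M.base),
      (0, M.base, M.base * (b - t.2.1) + t.2.2), (0, 0, q + 1)]
  | (q, b, HeadMove.stay) => ![(1, 0, 0), (0, 1, b - t.2.1), (0, 0, q + 1)]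
  | (q, b, HeadMove.right) => ![(M.base, 0, b), (0, 1 / M.base, -t.2.1 / M.base), (0, 0, q + 1)]

/-- The affine function that describes a step with given local data. -/
noncomputable def stepAffine (t : M.Local) (i : Fin 3) (y : Fin 3 → ℝ) : ℝ :=
  (M.stepCoef t i).1 * y 0 + (M.stepCoef t i).2.1 * y 1 + (M.stepCoef t i).2.2

/-- The indicator of the points with given local data. -/
noncomputable def localInd (t : M.Local) (y : Fin 3 → ℝ) : ℝ :=
  residueInd (M.lastState + 1) (t.1 + 1) (y 2) * residueInd M.base t.2.1 (y 1) *
    residueInd M.base t.2.2 (y 0)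

/-- An analytic extension of the step function to `ℝ³`. -/
noncomputable def stepMap (y : Fin 3 → ℝ) : Fin 3 → ℝ :=
  fun i => ∑ t : M.Local, M.localInd t y * M.stepAffine t i y

theorem localInd_toPoint (t : M.Local) (c : M.Config) :
    M.localInd t (M.toPoint c) =
      if t = (c.state, Fin.ofNat _ c.right, Fin.ofNat _ c.left) then 1 else 0 := by
  have hb : 0 < M.base := Nat.succ_pos _
  obtain ⟨q, a, d⟩ := t
  have e2 : M.toPoint c 2 = ((c.state + 1 : ℕ) : ℝ) := by simp [toPoint]
  have e1 : M.toPoint c 1 = (c.right : ℝ) := by simp [toPoint]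
  have e0 : M.toPoint c 0 = (c.left : ℝ) := by simp [toPoint]
  rw [localInd, e0, e1, e2, residueInd_nat (Nat.succ_pos _), residueInd_nat hb, residueInd_nat hb]
  have h2 : ((c.state : ℕ) + 1) % (M.lastState + 1) = ((q : ℕ) + 1) % (M.lastState + 1) ↔
      q = c.state := by
    rw [Fin.ext_iff]
    constructor
    · intro h
      have := Nat.ModEq.add_right_cancel' 1 (show _ ≡ _ [MOD _] from h)
      have h' := Nat.ModEq.eq_of_lt_of_lt this c.state.isLt q.isLt
      exact h'.symm
    · intro h; rw [h]
  have h1 : ∀ (n : ℕ) (a : Fin (M.extraSymbols + 2)), n % M.base = (a : ℕ) % M.base ↔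
      a = Fin.ofNat _ n := by
    intro n a
    rw [Fin.ext_iff, Nat.mod_eq_of_lt (show (a : ℕ) < M.base from a.isLt)]
    exact eq_comm
  simp only [h2, h1, Prod.mk.injEq]
  split_ifs <;> simp_all

/-- At a configuration only the summand of its own local data survives. Once the last digits are
known, dropping a digit is the affine map n ↦ (n - n mod b)/b. -/
theorem stepMap_toPoint (c : M.Config) : M.stepMap (M.toPoint c) = M.toPoint (M.step c) := by
  have hb : (M.base : ℝ) ≠ 0 := by
    have : M.base ≠ 0 := Nat.succ_ne_zero _
    exact_mod_cast this
  funext i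
  rw [stepMap, Finset.sum_eq_single (c.state, Fin.ofNat _ c.right, Fin.ofNat _ c.left)
    (fun t _ ht => by rw [localInd_toPoint, if_neg ht, zero_mul]) (by simp),
    localInd_toPoint, if_pos rfl, one_mul]
  rcases htr : M.trans c.state (Fin.ofNat _ c.right) with ⟨q, s, mv⟩
  obtain ⟨l, r, p⟩ := c
  have hr : (r : ℝ) = M.base * (r / M.base : ℕ) + (r % M.base : ℕ) := by
    exact_mod_cast (Nat.div_add_mod r M.base).symm
  have hl : (l : ℝ) = M.base * (l / M.base : ℕ) + (l % M.base : ℕ) := by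
    exact_mod_cast (Nat.div_add_mod l M.base).symm
  have hmr : ((Fin.ofNat (M.extraSymbols + 2) r : Fin _) : ℕ) = r % M.base := rfl
  have hml : ((Fin.ofNat (M.extraSymbols + 2) l : Fin _) : ℕ) = l % M.base := rfl
  simp only at htr
  rw [M.step_eq htr, stepAffine, stepCoef]
  simp only [htr, hmr, hml]
  generalize hA : r % M.base = A at *
  generalize hA' : r / M.base = A' at *
  generalize hD : l % M.base = D at *
  generalize hD' : l / M.base = D' at *
  cases mv <;> fin_cases i <;>
    simp [toPoint, moveHead, hA', hD', hD, hr, hl] <;> field_simp <;> ring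

theorem exists_stepMap_bound : ∃ K : ℕ, ∀ (c y : Fin 3 → ℝ), ‖y - c‖ ≤ 1 →
    ‖M.stepMap y - M.stepMap c‖ ≤ K * (1 + |c 0| + |c 1|) * ‖y - c‖ := by
  obtain ⟨A, hA⟩ : ∃ A : ℕ, ∀ (t : M.Local) (i : Fin 3), |((M.stepCoef t i).1 : ℝ)| ≤ A ∧
      |((M.stepCoef t i).2.1 : ℝ)| ≤ A ∧ |((M.stepCoef t i).2.2 : ℝ)| ≤ A := by
    choose B hB using fun r : ℝ => exists_nat_ge |r|
    let g : M.Local × Fin 3 → ℕ := fun x => B (M.stepCoef x.1 x.2).1 + B (M.stepCoef x.1 x.2).2.1 +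
      B (M.stepCoef x.1 x.2).2.2
    refine ⟨∑ x, g x, fun t i => ?_⟩
    have hle : g (t, i) ≤ ∑ x, g x :=
      Finset.single_le_sum (fun _ _ => Nat.zero_le _) (Finset.mem_univ (t, i))
    refine ⟨(hB _).trans ?_, (hB _).trans ?_, (hB _).trans ?_⟩ <;>
      refine Nat.cast_le.2 (le_trans ?_ hle) <;> simp only [g] <;> omega
  -- Product rule for each summand: the indicator, three factors with constant 7 each, contributes
  -- 21; the affine part, with two coefficients of size at most A, contributes 2.
  refine ⟨Fintype.card M.Local * (23 * A), fun c y hcy => ?_⟩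
  have hcoord : ∀ i, |y i - c i| ≤ ‖y - c‖ := fun i => norm_le_pi_norm (y - c) i
  set r := ‖y - c‖ with hr
  have hr0 : 0 ≤ r := norm_nonneg _
  rw [pi_norm_le_iff_of_nonneg (by positivity)]
  intro i
  simp only [stepMap, Pi.sub_apply, Real.norm_eq_abs]
  rw [← Finset.sum_sub_distrib]
  refine (Finset.abs_sum_le_sum_abs _ _).trans ?_
  have hterm : ∀ t : M.Local, |M.localInd t y * M.stepAffine t i y -
      M.localInd t c * M.stepAffine t i c| ≤ 23 * A * (1 + |c 0| + |c 1|) * r := by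
    intro t
    obtain ⟨hα, hβ, hγ⟩ := hA t i
    have hind : ∀ z, |M.localInd t z| ≤ 1 := by
      intro z
      rw [localInd, abs_mul, abs_mul]
      exact mul_le_one₀ (mul_le_one₀ (abs_residueInd_le _ _ _) (abs_nonneg _)
        (abs_residueInd_le _ _ _)) (abs_nonneg _) (abs_residueInd_le _ _ _)
    have hinds : |M.localInd t y - M.localInd t c| ≤ 21 * r := by
      have g := fun N a j => (abs_residueInd_sub_le N a (y j) (c j)).trans
        (mul_le_mul_of_nonneg_left (hcoord j) (by norm_num))
      have g2 := g (M.lastState + 1) (t.1 + 1) 2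
      have g1 := g M.base t.2.1 1
      have g0 := g M.base t.2.2 0
      have b2 := abs_residueInd_le (M.lastState + 1) (t.1 + 1) (c 2)
      have b1 := abs_residueInd_le M.base t.2.1 (y 1)
      have b1' := abs_residueInd_le M.base t.2.1 (c 1)
      have b0 := abs_residueInd_le M.base t.2.2 (y 0)
      simp only [localInd]
      set p := residueInd (M.lastState + 1) (t.1 + 1) (y 2)
      set p' := residueInd (M.lastState + 1) (t.1 + 1) (c 2)
      set q := residueInd M.base t.2.1 (y 1)
      set q' := residueInd M.base t.2.1 (c 1)
      set s := residueInd M.base t.2.2 (y 0)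
      set s' := residueInd M.base t.2.2 (c 0)
      have e : p * q * s - p' * q' * s' =
          (p - p') * (q * s) + p' * s * (q - q') + p' * q' * (s - s') := by ring
      rw [e]
      refine (abs_add_three _ _ _).trans ?_
      simp only [abs_mul]
      have m1 : |q| * |s| ≤ 1 := mul_le_one₀ b1 (abs_nonneg _) b0
      have m2 : |p'| * |s| ≤ 1 := mul_le_one₀ b2 (abs_nonneg _) b0
      have m3 : |p'| * |q'| ≤ 1 := mul_le_one₀ b2 (abs_nonneg _) b1'
      have k1 : |p - p'| * (|q| * |s|) ≤ 7 * r * 1 := by gcongr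
      have k2 : |p'| * |s| * |q - q'| ≤ 1 * (7 * r) := by gcongr
      have k3 : |p'| * |q'| * |s - s'| ≤ 1 * (7 * r) := by gcongr
      linarith
    have haff : |M.stepAffine t i y - M.stepAffine t i c| ≤ 2 * A * r := by
      have e : M.stepAffine t i y - M.stepAffine t i c =
          (M.stepCoef t i).1 * (y 0 - c 0) + (M.stepCoef t i).2.1 * (y 1 - c 1) := by
        simp only [stepAffine]; ring
      rw [e]
      refine (abs_add_le _ _).trans ?_
      rw [abs_mul, abs_mul]
      have k1 : |((M.stepCoef t i).1 : ℝ)| * |y 0 - c 0| ≤ A * r := by gcongr; exact hcoord 0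
      have k2 : |((M.stepCoef t i).2.1 : ℝ)| * |y 1 - c 1| ≤ A * r := by gcongr; exact hcoord 1
      linarith
    have haffc : |M.stepAffine t i c| ≤ A * (1 + |c 0| + |c 1|) := by
      simp only [stepAffine]
      refine (abs_add_three _ _ _).trans ?_
      rw [abs_mul, abs_mul]
      have k1 : |((M.stepCoef t i).1 : ℝ)| * |c 0| ≤ A * |c 0| := by gcongr
      have k2 : |((M.stepCoef t i).2.1 : ℝ)| * |c 1| ≤ A * |c 1| := by gcongr
      linarith
    have e : M.localInd t y * M.stepAffine t i y - M.localInd t c * M.stepAffine t i c =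
        M.localInd t y * (M.stepAffine t i y - M.stepAffine t i c) +
        (M.localInd t y - M.localInd t c) * M.stepAffine t i c := by ring
    rw [e]
    refine (abs_add_le _ _).trans ?_
    rw [abs_mul, abs_mul]
    have k1 : |M.localInd t y| * |M.stepAffine t i y - M.stepAffine t i c| ≤ 1 * (2 * A * r) := by
      gcongr; exact hind y
    have k2 : |M.localInd t y - M.localInd t c| * |M.stepAffine t i c| ≤
        21 * r * (A * (1 + |c 0| + |c 1|)) := by gcongr
    have k3 : 0 ≤ A * r * (|c 0| + |c 1|) := by positivity
    nlinarith
  refine (Finset.sum_le_sum fun t _ => hterm t).trans (le_of_eq ?_)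
  rw [Finset.sum_const, Finset.card_univ, nsmul_eq_mul]
  push_cast; ring

end TuringM


/-! ### The robust analytic simulation -/

namespace CFun

variable {d : ℕ} {f g : (Fin d → ℝ) → ℝ}

theorem cos_two_pi_mul (hf : CFun f) : CFun fun x => Real.cos (2 * Real.pi * f x) :=
  (((natConst 2).mul (const CReal.pi)).mul hf).cos

theorem softRound (hw : CFun f) (hw0 : ∀ x, 0 ≤ f x) (ht : CFun g) :
    CFun fun x => softRound (f x) (g x) := by
  have h1 : CFun fun _ : Fin d → ℝ => (1 : ℝ) := by simpa using ratConst (d := d) 1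
  have h2 : CFun fun x => f x / 2 := by
    simpa [div_eq_mul_inv] using hw.mul (ratConst (1 / 2))
  have h4 : CFun fun x => g x - 1 / 4 := by
    simpa using ht.sub (ratConst (1 / 4))
  exact ht.sub (((h2.mul h4.cos_two_pi_mul).div
    (h1.add (h2.mul (h1.add ht.cos_two_pi_mul)))
    fun x => one_le_softRound_denom (hw0 x) _).arctan.div (const CReal.pi)
    fun _ => by linarith [Real.pi_gt_three])

theorem residueInd (N a : ℕ) (hN : 0 < N) (hf : CFun f) : CFun fun x => residueInd N a (f x) := by
  have hN1 : ∀ _ : Fin d → ℝ, (1 : ℝ) ≤ N := fun _ => by exact_mod_cast hN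
  exact (sum (Finset.range N) fun j _ => ((natConst j).mul
    ((hf.sub (natConst a)).div (natConst N) hN1)).cos_two_pi_mul).div (natConst N) hN1

end CFun

namespace TuringM

variable (M : TuringM)

theorem cfun_stepMap {d : ℕ} {u : (Fin d → ℝ) → (Fin 3 → ℝ)} (hu : ∀ i, CFun fun x => u x i)
    (i : Fin 3) : CFun fun x => M.stepMap (u x) i := by
  have hb : 0 < M.base := Nat.succ_pos _
  refine CFun.sum _ fun t _ => CFun.mul ?_ ?_
  · exact ((CFun.residueInd _ _ (Nat.succ_pos _) (hu 2)).mul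
      (CFun.residueInd _ _ hb (hu 1))).mul (CFun.residueInd _ _ hb (hu 0))
  · exact (((CFun.ratConst _).mul (hu 0)).add ((CFun.ratConst _).mul (hu 1))).add (CFun.ratConst _)

/-- The argument rounded towards the nearest integer point, with a precision that grows with the
first two coordinates. -/
noncomputable def roundMap (K : ℕ) (x : Fin 3 → ℝ) : Fin 3 → ℝ :=
  fun i => softRound (K * (1 + x 0 * x 0 + x 1 * x 1)) (x i)

theorem roundMap_weight_nonneg (K : ℕ) (x : Fin 3 → ℝ) :
    0 ≤ (K : ℝ) * (1 + x 0 * x 0 + x 1 * x 1) :=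
  mul_nonneg (Nat.cast_nonneg _) (by nlinarith [mul_self_nonneg (x 0), mul_self_nonneg (x 1)])

/-- The simulation of `M` with rounding precision `K`. -/
noncomputable def simMap (K : ℕ) (x : Fin 3 → ℝ) : Fin 3 → ℝ := M.stepMap (roundMap K x)

theorem cfun_simMap (K : ℕ) (i : Fin 3) : CFun fun x => M.simMap K x i := by
  refine M.cfun_stepMap (fun i => ?_) i
  have h1 : CFun fun _ : Fin 3 → ℝ => (1 : ℝ) := by simpa using CFun.ratConst (d := 3) 1
  refine CFun.softRound ?_ (roundMap_weight_nonneg K) (CFun.proj i)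
  exact (CFun.natConst K).mul ((h1.add ((CFun.proj 0).mul (CFun.proj 0))).add
    ((CFun.proj 1).mul (CFun.proj 1)))

/-- The exponent `⊤` of `WithTop ℕ∞` is ω, so this is analyticity. -/
theorem contDiff_simMap (K : ℕ) : ContDiff ℝ (⊤ : WithTop ℕ∞) (M.simMap K) := by
  have hround : ∀ i, ContDiff ℝ (⊤ : WithTop ℕ∞) fun x => roundMap K x i := by
    intro i
    unfold roundMap softRound
    refine ContDiff.sub (by fun_prop) (ContDiff.div_const (Real.contDiff_arctan.comp ?_) _)
    refine ContDiff.div (by fun_prop) (by fun_prop) fun x => ?_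
    have := one_le_softRound_denom (roundMap_weight_nonneg K x) (x i)
    linarith
  have hind : ∀ (N a : ℕ), ContDiff ℝ (⊤ : WithTop ℕ∞) (residueInd N a) := by
    intro N a
    unfold residueInd
    refine ContDiff.div_const (ContDiff.sum fun j _ => ?_) _
    fun_prop
  rw [contDiff_pi]
  intro i
  unfold simMap stepMap localInd stepAffine
  refine ContDiff.sum fun t _ => ContDiff.mul (ContDiff.mul (ContDiff.mul ?_ ?_) ?_) ?_
  · exact (hind _ _).comp (hround 2)
  · exact (hind _ _).comp (hround 1)
  · exact (hind _ _).comp (hround 0)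
  · exact ((contDiff_const.mul (hround 0)).add (contDiff_const.mul (hround 1))).add contDiff_const

theorem toPoint_eq_intCast (c : M.Config) (i : Fin 3) : ∃ n : ℤ, M.toPoint c i = n := by
  fin_cases i
  · exact ⟨c.left, by simp [toPoint]⟩
  · exact ⟨c.right, by simp [toPoint]⟩
  · exact ⟨(c.state : ℕ) + 1, by simp [toPoint]⟩

theorem simMap_toPoint (K : ℕ) (c : M.Config) :
    M.simMap K (M.toPoint c) = M.toPoint (M.step c) := by
  have : roundMap K (M.toPoint c) = M.toPoint c := by
    funext i
    obtain ⟨n, hn⟩ := M.toPoint_eq_intCast c i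
    rw [roundMap, hn, softRound_int]
  rw [simMap, this, stepMap_toPoint]

/-- The simulation contracts as strongly as desired on large neighbourhoods of configurations. -/
theorem exists_simMap_contraction {η l : ℝ} (hη0 : 0 ≤ η) (hη : η < 1 / 2) (hl : 0 < l) :
    ∃ K : ℕ, ∀ (c : M.Config) (x : Fin 3 → ℝ), ‖x - M.toPoint c‖ ≤ η →
      ‖M.simMap K x - M.toPoint (M.step c)‖ ≤ l * ‖x - M.toPoint c‖ := by
  have hpi := Real.pi_pos
  obtain ⟨A, hA⟩ := M.exists_stepMap_bound
  set C := Real.cos (Real.pi * η) with hC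
  have hC0 : 0 < C := Real.cos_pos_of_mem_Ioo ⟨by nlinarith, by nlinarith⟩
  -- The summand 1/C brings the rounded point within distance 1 of the configuration, where the
  -- bound for `stepMap` applies; the other one makes the rounding beat the constant 3A of that
  -- bound.
  obtain ⟨K, hK⟩ := exists_nat_ge (3 * A / (C * l) + 1 / C)
  refine ⟨K, fun c x hx => ?_⟩
  set z := M.toPoint c with hz
  set r := ‖x - z‖ with hr
  have hr0 : 0 ≤ r := norm_nonneg _
  set V := 1 + x 0 * x 0 + x 1 * x 1 with hV
  have hV1 : 1 ≤ V := by nlinarith [mul_self_nonneg (x 0), mul_self_nonneg (x 1)]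
  have hKV : 0 ≤ (K : ℝ) * V := roundMap_weight_nonneg K x
  have hcoord : ∀ i, |x i - z i| ≤ r := fun i => norm_le_pi_norm (x - z) i
  have hround : ‖roundMap K x - z‖ ≤ r / (C * (1 + K * V)) := by
    rw [pi_norm_le_iff_of_nonneg (by positivity)]
    intro i
    obtain ⟨n, hn⟩ := M.toPoint_eq_intCast c i
    have h1 : |x i - n| ≤ r := by rw [← hn]; exact hcoord i
    have := abs_softRound_sub_le hKV hη n (h1.trans hx)
    rw [Pi.sub_apply, Real.norm_eq_abs, hz, hn]
    exact this.trans (by gcongr)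
  have hCK : 1 ≤ C * K := by
    have h1 : 1 / C ≤ K := le_trans (by linarith [show 0 ≤ 3 * A / (C * l) by positivity]) hK
    rwa [div_le_iff₀ hC0, mul_comm] at h1
  have hCKl : 3 * A ≤ C * K * l := by
    have h1 : 3 * A / (C * l) ≤ K := le_trans (by linarith [show 0 ≤ 1 / C by positivity]) hK
    rw [div_le_iff₀ (by positivity)] at h1
    linarith
  have hden : 0 < C * (1 + K * V) := by positivity
  have hr1 : r / (C * (1 + K * V)) ≤ 1 := by
    rw [div_le_one hden]
    have : 1 ≤ C * K * V := one_le_mul_of_one_le_of_one_le hCK hV1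
    nlinarith
  have h := hA z (roundMap K x) (hround.trans hr1)
  have hstep : M.stepMap z = M.toPoint (M.step c) := M.stepMap_toPoint c
  rw [hstep] at h
  refine h.trans ?_
  -- The bound grows with the configuration z, while the rounding weight V is computed from x. They
  -- are comparable because x is within 1/2 of z.
  have hsize : 1 + |z 0| + |z 1| ≤ 3 * V := by
    have h0 : |z 0| ≤ |x 0| + r := by
      have := abs_sub_abs_le_abs_sub (z 0) (x 0)
      rw [abs_sub_comm] at this; linarith [hcoord 0]
    have h1 : |z 1| ≤ |x 1| + r := by
      have := abs_sub_abs_le_abs_sub (z 1) (x 1)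
      rw [abs_sub_comm] at this; linarith [hcoord 1]
    have e0 : |x 0| * |x 0| = x 0 * x 0 := abs_mul_abs_self _
    have e1 : |x 1| * |x 1| = x 1 * x 1 := abs_mul_abs_self _
    nlinarith [sq_nonneg (|x 0| - 1), sq_nonneg (|x 1| - 1)]
  calc (A : ℝ) * (1 + |z 0| + |z 1|) * ‖roundMap K x - z‖
      ≤ A * (3 * V) * (r / (C * (1 + K * V))) := by gcongr
    _ = 3 * A * V / (C * (1 + K * V)) * r := by ring
    _ ≤ l * r := by
      gcongr
      rw [div_le_iff₀ hden]
      have : 3 * A * V ≤ C * K * l * V := by gcongr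
      nlinarith [mul_pos hl hC0]

end TuringM


/-! ### Sinks from derivatives of norm less than one -/

section
attribute [local instance] Matrix.linftyOpNormedRing Matrix.linftyOpNormedAlgebra

/-- An eigenvalue is bounded by any algebra norm. The row-sum norm of a matrix is its operator norm
for the max-norm, and it does not change when real entries are read as complex ones. -/
theorem norm_lt_one_of_mem_spectrum {L : (Fin 3 → ℝ) →L[ℝ] (Fin 3 → ℝ)} (hL : ‖L‖ < 1) {μ : ℂ}
    (hμ : μ ∈ spectrum ℂ ((LinearMap.toMatrix' (L : (Fin 3 → ℝ) →ₗ[ℝ] (Fin 3 → ℝ))).map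
      Complex.ofReal)) : ‖μ‖ < 1 := by
  set A := LinearMap.toMatrix' (L : (Fin 3 → ℝ) →ₗ[ℝ] (Fin 3 → ℝ)) with hA
  have : CompleteSpace (Matrix (Fin 3) (Fin 3) ℂ) := FiniteDimensional.complete ℂ _
  have h1 : ‖μ‖ ≤ ‖A.map Complex.ofReal‖ := by
    have h := spectrum.norm_le_norm_mul_of_mem hμ
    simpa using h
  have h2 : ‖A.map Complex.ofReal‖ = ‖A‖ := by
    rw [Matrix.linfty_opNorm_def, Matrix.linfty_opNorm_def]
    simp
  have h3 : ‖A‖ = ‖L‖ := by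
    rw [Matrix.linfty_opNorm_eq_opNorm]
    congr 1
    ext x i
    simp [hA, LinearMap.toMatrix'_mulVec]
  linarith

end

theorem isSink_of_norm_fderiv_lt_one {g : (Fin 3 → ℝ) → (Fin 3 → ℝ)} {p : Fin 3 → ℝ}
    (hp : g p = p) (hd : DifferentiableAt ℝ g p) (h : ‖fderiv ℝ g p‖ < 1) : IsSink g p :=
  ⟨hp, hd, fun _ hμ => norm_lt_one_of_mem_spectrum h hμ⟩

namespace TuringM

theorem norm_fderiv_le_of_contraction {M : TuringM} {f : (Fin 3 → ℝ) → (Fin 3 → ℝ)} {l : ℝ}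
    (hl : 0 ≤ l) (hd : Differentiable ℝ f) {c : M.Config}
    (h : ∀ x, ‖x - M.toPoint c‖ ≤ 1 / 4 →
      ‖f x - f (M.toPoint c)‖ ≤ l * ‖x - M.toPoint c‖) :
    ‖fderiv ℝ f (M.toPoint c)‖ ≤ l := by
  refine (hd _).hasFDerivAt.le_of_lip' hl ?_
  filter_upwards [Metric.closedBall_mem_nhds (M.toPoint c) (by norm_num : (0 : ℝ) < 1 / 4)] with x hx
  exact h x (by simpa [dist_eq_norm] using hx)

/-- Every machine has robust analytic and computable simulations. -/
theorem exists_robustSimulation (M : TuringM) {δ ε : ℝ} (hδ : 0 < δ) (hδε : δ < ε)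
    (hε : ε < 1 / 2) :
    ∃ (lam : ℚ) (f : (Fin 3 → ℝ) → (Fin 3 → ℝ)), M.RobustSimulation f lam δ ε := by
  have hε0 : 0 < ε := hδ.trans hδε
  -- From λ ≤ (ε - δ)/ε one gets δ + λε ≤ ε: balls of radius ε are carried into the next ones
  -- despite an error δ.
  obtain ⟨lam, hlam0, hlam⟩ := exists_rat_btwn
    (show (0 : ℝ) < min (1 / 2) ((ε - δ) / ε) from
      lt_min (by norm_num) (div_pos (by linarith) hε0))
  have hlam1 : (lam : ℝ) < 1 := hlam.trans_le ((min_le_left _ _).trans (by norm_num))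
  have hlam2 : (lam : ℝ) * ε ≤ ε - δ := by
    have := hlam.le.trans (min_le_right _ _)
    rwa [le_div_iff₀ hε0] at this
  -- The contraction is needed on balls of radius ε for robustness and of radius 1/4 for
  -- `contraction`.
  obtain ⟨K, hK⟩ := M.exists_simMap_contraction (η := max ε (1 / 4)) (l := lam)
    (hε0.le.trans (le_max_left _ _)) (max_lt hε (by norm_num)) hlam0
  have hcontr : ∀ (c : M.Config) (x : Fin 3 → ℝ), ‖x - M.toPoint c‖ ≤ 1 / 4 →
      ‖M.simMap K x - M.simMap K (M.toPoint c)‖ ≤ (lam : ℝ) * ‖x - M.toPoint c‖ := by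
    intro c x hx
    rw [M.simMap_toPoint]
    exact hK c x (hx.trans (le_max_right _ _))
  have hdiff : Differentiable ℝ (M.simMap K) := (M.contDiff_simMap K).differentiable (by simp)
  refine ⟨lam, M.simMap K, ⟨?_, isComputableMap_of_cfun (M.cfun_simMap K), M.simMap_toPoint K, ?_,
    by exact_mod_cast hlam0, by exact_mod_cast hlam1, hcontr, ?_⟩⟩
  · exact contDiff_omega_iff_analyticOnNhd.1 (M.contDiff_simMap K)
  · refine isSink_of_norm_fderiv_lt_one (by rw [M.simMap_toPoint, M.step_haltConfig]) (hdiff _) ?_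
    exact (norm_fderiv_le_of_contraction hlam0.le hdiff (hcontr _)).trans_lt hlam1
  · intro g hg w _ x hx j
    induction j with
    | zero => exact hx
    | succ j ih =>
      rw [Function.iterate_succ_apply', Function.iterate_succ_apply']
      set y := g^[j] x
      set c := M.step^[j] (M.init w)
      have h1 := hK c y (ih.trans (le_max_left _ _))
      have h2 := hg y
      rw [norm_sub_rev] at h2
      calc ‖g y - M.toPoint (M.step c)‖
          ≤ ‖g y - M.simMap K y‖ + ‖M.simMap K y - M.toPoint (M.step c)‖ :=
            norm_sub_le_norm_sub_add_norm_sub _ _ _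
        _ ≤ δ + lam * ε := by
            refine add_le_add h2 (h1.trans ?_)
            gcongr
        _ ≤ ε := by linarith

theorem toPoint_injective (M : TuringM) {c c' : M.Config}
    (h : ‖M.toPoint c - M.toPoint c'‖ < 1) : c = c' := by
  rw [pi_norm_lt_iff one_pos] at h
  have key : ∀ m n : ℕ, |(m : ℝ) - n| < 1 → m = n := by
    intro m n hmn
    have : |(m : ℤ) - n| < 1 := by exact_mod_cast hmn
    have := Int.abs_lt_one_iff.1 this
    omega
  obtain ⟨l, r, q⟩ := c
  obtain ⟨l', r', q'⟩ := c'
  have h0 := key l l' (by simpa [toPoint] using h 0)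
  have h1 := key r r' (by simpa [toPoint] using h 1)
  have h2 := key q q' (by simpa [toPoint] using h 2)
  rw [h0, h1, Fin.ext h2]

/-! ## Perturbations of a contracting simulation -/

/-- A map that follows the machine up to an error `θ` near the configurations, and whose derivative
is small near the halting configuration. -/
structure NearSim (M : TuringM) (g : (Fin 3 → ℝ) → (Fin 3 → ℝ)) (lam κ r θ : ℝ) : Prop where
  diff : Differentiable ℝ g
  step : ∀ (c : M.Config) (x : Fin 3 → ℝ), ‖x - M.toPoint c‖ ≤ 1 / 4 →
    ‖g x - M.toPoint (M.step c)‖ ≤ lam * ‖x - M.toPoint c‖ + θ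
  deriv : ∀ x, ‖x - M.toPoint M.haltConfig‖ ≤ r → ‖fderiv ℝ g x‖ ≤ κ
  lam_nonneg : 0 ≤ lam
  lam_lt : lam < 1
  κ_lt : κ < 1
  r_pos : 0 < r
  r_le : r ≤ 1 / 4
  -- This makes the balls of radius r around the halting point and of radius 1/4 around all
  -- configurations behave as trapping regions, and it forces every fixed point in the quarter ball
  -- into the ball of radius r.
  θ_lt : θ < (1 - lam) * r

namespace NearSim

variable {M : TuringM} {g : (Fin 3 → ℝ) → (Fin 3 → ℝ)} {lam κ r θ : ℝ}

theorem κ_nonneg (h : M.NearSim g lam κ r θ) : 0 ≤ κ :=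
  (norm_nonneg _).trans (h.deriv (M.toPoint M.haltConfig) (by simpa using h.r_pos.le))

theorem contraction (h : M.NearSim g lam κ r θ) {x y : Fin 3 → ℝ}
    (hx : ‖x - M.toPoint M.haltConfig‖ ≤ r) (hy : ‖y - M.toPoint M.haltConfig‖ ≤ r) :
    ‖g x - g y‖ ≤ κ * ‖x - y‖ :=
  Convex.norm_image_sub_le_of_norm_fderiv_le (s := Metric.closedBall (M.toPoint M.haltConfig) r)
    (fun z _ => h.diff z) (fun z hz => h.deriv z (by simpa [dist_eq_norm] using hz))
    (convex_closedBall _ _) (by simpa [dist_eq_norm] using hy) (by simpa [dist_eq_norm] using hx)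

theorem step_halt (h : M.NearSim g lam κ r θ) {x : Fin 3 → ℝ}
    (hx : ‖x - M.toPoint M.haltConfig‖ ≤ 1 / 4) :
    ‖g x - M.toPoint M.haltConfig‖ ≤ lam * ‖x - M.toPoint M.haltConfig‖ + θ := by
  have := h.step M.haltConfig x hx
  rwa [M.step_haltConfig] at this

theorem mapsTo (h : M.NearSim g lam κ r θ) {x : Fin 3 → ℝ}
    (hx : ‖x - M.toPoint M.haltConfig‖ ≤ r) : ‖g x - M.toPoint M.haltConfig‖ ≤ r := by
  have h1 := h.step_halt (hx.trans h.r_le)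
  have h2 : lam * ‖x - M.toPoint M.haltConfig‖ ≤ lam * r :=
    mul_le_mul_of_nonneg_left hx h.lam_nonneg
  linarith [h.θ_lt]

theorem exists_fixedPoint (h : M.NearSim g lam κ r θ) :
    ∃ p, ‖p - M.toPoint M.haltConfig‖ ≤ r ∧ g p = p := by
  set s := M.toPoint M.haltConfig with hs
  have hmaps : MapsTo g (Metric.closedBall s r) (Metric.closedBall s r) := fun x hx => by
    rw [mem_closedBall_iff_norm] at hx ⊢
    exact h.mapsTo hx
  have hcontr : ContractingWith ⟨κ, h.κ_nonneg⟩ (hmaps.restrict g _ _) := by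
    refine ⟨by exact_mod_cast h.κ_lt, LipschitzWith.of_dist_le_mul fun x y => ?_⟩
    have := h.contraction (mem_closedBall_iff_norm.1 x.2) (mem_closedBall_iff_norm.1 y.2)
    rw [← dist_eq_norm, ← dist_eq_norm] at this
    exact this
  obtain ⟨p, hp, hfix, -⟩ := hcontr.exists_fixedPoint' (Metric.isClosed_closedBall.isComplete) hmaps
    (x := s) (Metric.mem_closedBall_self h.r_pos.le) (edist_ne_top _ _)
  exact ⟨p, mem_closedBall_iff_norm.1 hp, hfix⟩

theorem fixedPoint_near (h : M.NearSim g lam κ r θ) {x : Fin 3 → ℝ}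
    (hx : ‖x - M.toPoint M.haltConfig‖ ≤ 1 / 4) (hfix : g x = x) :
    (1 - lam) * ‖x - M.toPoint M.haltConfig‖ ≤ θ := by
  have h1 := h.step_halt hx
  rw [hfix] at h1
  linarith

theorem fixedPoint_lt (h : M.NearSim g lam κ r θ) {x : Fin 3 → ℝ}
    (hx : ‖x - M.toPoint M.haltConfig‖ ≤ 1 / 4) (hfix : g x = x) :
    ‖x - M.toPoint M.haltConfig‖ < r := by
  have h1 := (h.fixedPoint_near hx hfix).trans_lt h.θ_lt
  exact lt_of_mul_lt_mul_left h1 (by linarith [h.lam_lt])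

theorem fixedPoint_unique (h : M.NearSim g lam κ r θ) {x p : Fin 3 → ℝ}
    (hx : ‖x - M.toPoint M.haltConfig‖ ≤ 1 / 4) (hfix : g x = x)
    (hp : ‖p - M.toPoint M.haltConfig‖ ≤ 1 / 4) (hpfix : g p = p) : x = p := by
  have h1 := h.contraction (h.fixedPoint_lt hx hfix).le (h.fixedPoint_lt hp hpfix).le
  rw [hfix, hpfix] at h1
  have h2 : ‖x - p‖ ≤ 0 := by
    by_contra hcon
    push Not at hcon
    nlinarith [h.κ_lt]
  exact sub_eq_zero.1 (norm_le_zero_iff.1 h2)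

/-- A distance of at most 1/4 becomes at most λ/4 + θ, which is less than 1/4 since θ < (1 - λ)r and
r ≤ 1/4. -/
theorem shadow (h : M.NearSim g lam κ r θ) {c : M.Config} {x : Fin 3 → ℝ}
    (hx : ‖x - M.toPoint c‖ ≤ 1 / 4) (j : ℕ) :
    ‖g^[j] x - M.toPoint (M.step^[j] c)‖ ≤ 1 / 4 := by
  induction j with
  | zero => exact hx
  | succ j ih =>
    rw [Function.iterate_succ_apply', Function.iterate_succ_apply']
    refine (h.step _ _ ih).trans ?_
    have h1 := mul_le_mul_of_nonneg_left ih h.lam_nonneg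
    have h2 : (1 - lam) * r ≤ (1 - lam) * (1 / 4) :=
      mul_le_mul_of_nonneg_left h.r_le (by linarith [h.lam_lt])
    linarith [h.θ_lt]

variable {p : Fin 3 → ℝ}

theorem mem_basin_of_iterate {j : ℕ} {x : Fin 3 → ℝ} (h : g^[j] x ∈ basin g p) :
    x ∈ basin g p := by
  have h' : Tendsto (fun n => g^[n] (g^[j] x)) atTop (𝓝 p) := h
  simp only [← Function.iterate_add_apply] at h'
  exact (tendsto_add_atTop_iff_nat (f := fun n => g^[n] x) j).1 h'

theorem mem_basin_of_near (h : M.NearSim g lam κ r θ)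
    (hp : ‖p - M.toPoint M.haltConfig‖ ≤ r) (hpfix : g p = p) {x : Fin 3 → ℝ}
    (hx : ‖x - M.toPoint M.haltConfig‖ ≤ r) : x ∈ basin g p := by
  have hin : ∀ n, ‖g^[n] x - M.toPoint M.haltConfig‖ ≤ r := by
    intro n
    induction n with
    | zero => exact hx
    | succ n ih => rw [Function.iterate_succ_apply']; exact h.mapsTo ih
  have hle : ∀ n, ‖g^[n] x - p‖ ≤ κ ^ n * ‖x - p‖ := by
    intro n
    induction n with
    | zero => simp
    | succ n ih =>
      rw [Function.iterate_succ_apply']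
      have h1 := h.contraction (hin n) hp
      rw [hpfix] at h1
      refine h1.trans ((mul_le_mul_of_nonneg_left ih h.κ_nonneg).trans (le_of_eq ?_))
      ring
  refine tendsto_iff_norm_sub_tendsto_zero.2 (squeeze_zero (fun _ => norm_nonneg _) hle ?_)
  simpa using (tendsto_pow_atTop_nhds_zero_of_lt_one h.κ_nonneg h.κ_lt).mul_const ‖x - p‖

/-- The derivative is controlled only on the ball of radius r. On the quarter ball the recursion d ↦
λd + θ bounds the distance to the halting point by a sequence tending to θ/(1 - λ) < r, so the orbit
enters the small ball. -/
theorem closedBall_subset_basin (h : M.NearSim g lam κ r θ)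
    (hp : ‖p - M.toPoint M.haltConfig‖ ≤ r) (hpfix : g p = p) {x : Fin 3 → ℝ}
    (hx : ‖x - M.toPoint M.haltConfig‖ ≤ 1 / 4) : x ∈ basin g p := by
  have h1l : 0 < 1 - lam := by linarith [h.lam_lt]
  have hfixed : ∀ j, M.step^[j] M.haltConfig = M.haltConfig :=
    fun j => Function.iterate_fixed M.step_haltConfig j
  have hin : ∀ j, ‖g^[j] x - M.toPoint M.haltConfig‖ ≤ 1 / 4 := fun j => by
    have := h.shadow hx j
    rwa [hfixed] at this
  have hle : ∀ n, ‖g^[n] x - M.toPoint M.haltConfig‖ ≤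
      lam ^ n * ‖x - M.toPoint M.haltConfig‖ + θ / (1 - lam) := by
    have hθ : 0 ≤ θ := by
      have h0 := h.step_halt (x := M.toPoint M.haltConfig) (by simp)
      simp only [sub_self, norm_zero, mul_zero, zero_add] at h0
      exact (norm_nonneg _).trans h0
    intro n
    induction n with
    | zero => simpa using div_nonneg hθ h1l.le
    | succ n ih =>
      rw [Function.iterate_succ_apply']
      refine (h.step_halt (hin n)).trans ?_
      have h2 := mul_le_mul_of_nonneg_left ih h.lam_nonneg
      have h3 : lam * (θ / (1 - lam)) + θ = θ / (1 - lam) := by field_simp; ring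
      have h4 : lam ^ (n + 1) * ‖x - M.toPoint M.haltConfig‖ =
        lam * (lam ^ n * ‖x - M.toPoint M.haltConfig‖) := by ring
      rw [h4]
      linarith
  have hlim : Tendsto (fun n : ℕ => lam ^ n * ‖x - M.toPoint M.haltConfig‖ + θ / (1 - lam)) atTop
      (𝓝 (θ / (1 - lam))) := by
    simpa using ((tendsto_pow_atTop_nhds_zero_of_lt_one h.lam_nonneg h.lam_lt).mul_const
      ‖x - M.toPoint M.haltConfig‖).add_const (θ / (1 - lam))
  have hlt : θ / (1 - lam) < r := by
    rw [div_lt_iff₀ h1l]; linarith [h.θ_lt]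
  obtain ⟨n, hn⟩ := (hlim.eventually (gt_mem_nhds hlt)).exists
  exact mem_basin_of_iterate (h.mem_basin_of_near hp hpfix ((hle n).trans hn.le))

/-- If the orbit comes within 1/4 of the sink, then the shadowed configuration, the orbit, the sink
and the halting point are successively at most 1/4 apart. The two integer points are thus less than
1 apart and coincide. -/
theorem mem_basin_iff (h : M.NearSim g lam κ r θ)
    (hp : ‖p - M.toPoint M.haltConfig‖ ≤ r) (hpfix : g p = p) {c : M.Config} {x : Fin 3 → ℝ}
    (hx : ‖x - M.toPoint c‖ ≤ 1 / 4) : x ∈ basin g p ↔ M.Reaches c := by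
  constructor
  · intro hb
    have hb' : Tendsto (fun n => g^[n] x) atTop (𝓝 p) := hb
    obtain ⟨n, hn⟩ := (hb'.eventually (Metric.ball_mem_nhds p (by norm_num : (0 : ℝ) < 1 / 4))).exists
    refine ⟨n, M.toPoint_injective ?_⟩
    have h1 := h.shadow hx n
    have h2 : ‖g^[n] x - p‖ < 1 / 4 := by simpa [dist_eq_norm] using hn
    have h3 := hp.trans h.r_le
    rw [norm_sub_rev] at h1
    calc _ ≤ ‖M.toPoint (M.step^[n] c) - g^[n] x‖ + ‖g^[n] x - M.toPoint M.haltConfig‖ :=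
          norm_sub_le_norm_sub_add_norm_sub _ _ _
      _ ≤ ‖M.toPoint (M.step^[n] c) - g^[n] x‖ +
          (‖g^[n] x - p‖ + ‖p - M.toPoint M.haltConfig‖) := by
          gcongr; exact norm_sub_le_norm_sub_add_norm_sub _ _ _
      _ < 1 := by linarith
  · rintro ⟨n, hn⟩
    have h1 := h.shadow hx n
    rw [hn] at h1
    exact mem_basin_of_iterate (h.closedBall_subset_basin hp hpfix h1)

/-- The sink is interior to the ball of radius r, which it attracts; hence the basin is the union of
the preimages of the open ball under the iterates. -/
theorem isOpen_basin (h : M.NearSim g lam κ r θ)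
    (hp : ‖p - M.toPoint M.haltConfig‖ < r) (hpfix : g p = p) : IsOpen (basin g p) := by
  have : basin g p = ⋃ n, (g^[n]) ⁻¹' Metric.ball (M.toPoint M.haltConfig) r := by
    ext x
    simp only [mem_iUnion, mem_preimage, mem_ball_iff_norm]
    constructor
    · intro hb
      have hb' : Tendsto (fun n => g^[n] x) atTop (𝓝 p) := hb
      have := hb'.eventually (Metric.isOpen_ball.mem_nhds (mem_ball_iff_norm.2 hp))
      obtain ⟨n, hn⟩ := this.exists
      exact ⟨n, mem_ball_iff_norm.1 hn⟩
    · rintro ⟨n, hn⟩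
      exact mem_basin_of_iterate (h.mem_basin_of_near hp.le hpfix hn.le)
  rw [this]
  exact isOpen_iUnion fun n => Metric.isOpen_ball.preimage (h.diff.continuous.iterate n)

end NearSim

end TuringM


/-! ## Decidable relations between codes -/

theorem primrecPred_ratOf_pos : PrimrecPred fun m : ℕ => 0 < ratOf m := by
  refine (Primrec.nat_lt.comp primrec_numNeg primrec_num).of_eq fun m => ?_
  have h1 : (0 : ℚ) < (m.unpair.2 : ℚ) + 1 := by positivity
  rw [ratOf, div_pos_iff_of_pos_right h1, sub_pos, Nat.cast_lt]

theorem primrecPred_ratOf_lt {α : Type*} [Primcodable α] {f g : α → ℕ} (hf : Primrec f)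
    (hg : Primrec g) : PrimrecPred fun a => ratOf (f a) < ratOf (g a) := by
  refine (primrecPred_ratOf_pos.comp
    (primrec_ratAdd.comp hg (primrec_ratNeg.comp hf))).of_eq fun a => ?_
  rw [ratOf_ratAdd, ratOf_ratNeg, ← sub_eq_add_neg, sub_pos]

theorem ratOf_zero : ratOf 0 = 0 := by simp [ratOf]

theorem ratOf_two_pow (m : ℕ) :
    ((ratOf (Nat.pair (Nat.pair 1 0) (2 ^ m - 1)) : ℚ) : ℝ) = (2 : ℝ)⁻¹ ^ m := by
  rw [ratOf_pair]
  push_cast [Nat.one_le_two_pow]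
  simp

theorem primrecPred_fin_forall {α : Type*} [Primcodable α] {d : ℕ} {R : Fin d → α → Prop}
    (h : ∀ i, PrimrecPred (R i)) : PrimrecPred fun a => ∀ i, R i a := by
  induction d with
  | zero =>
    exact (Primrec.eq.comp (Primrec.const 0) (Primrec.const 0)).of_eq fun a => by simp
  | succ d ih =>
    exact ((h 0).and (ih fun i => h i.succ)).of_eq fun a => (Fin.forall_fin_succ (P := fun i => R i a)).symm

theorem primrecPred_vecOf_near {α : Type*} [Primcodable α] (d : ℕ) {f g m : α → ℕ} (hf : Primrec f)
    (hg : Primrec g) (hm : Primrec m) :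
    PrimrecPred fun a => ‖vecOf d (f a) - vecOf d (g a)‖ < (2 : ℝ)⁻¹ ^ m a := by
  have hpow : Primrec fun a => Nat.pair (Nat.pair 1 0) (2 ^ m a - 1) :=
    primrec_pair3 (Primrec.const 1) (Primrec.const 0)
      (Primrec.nat_sub.comp (primrec_two_pow.comp hm) (Primrec.const 1))
  have h := primrecPred_fin_forall (d := d) (α := α) (R := fun i a => _) fun i =>
    (primrecPred_ratOf_lt (primrec_vecOf_code (i := i) |>.comp hf)
      (primrec_ratAdd.comp (primrec_vecOf_code (i := i) |>.comp hg) hpow)).and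
    (primrecPred_ratOf_lt (primrec_vecOf_code (i := i) |>.comp hg)
      (primrec_ratAdd.comp (primrec_vecOf_code (i := i) |>.comp hf) hpow))
  refine h.of_eq fun a => ?_
  rw [pi_norm_lt_iff (by positivity)]
  refine forall_congr' fun i => ?_
  rw [← ratOf_two_pow]
  simp only [ratOf_ratAdd, Pi.sub_apply, vecOf, Real.norm_eq_abs, abs_lt]
  norm_cast
  constructor
  · rintro ⟨h1, h2⟩
    constructor <;> linarith
  · rintro ⟨h1, h2⟩
    constructor <;> linarith

theorem ComputablePred.comp {α β : Type*} [Primcodable α] [Primcodable β] {R : β → Prop}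
    (hR : ComputablePred R) {f : α → β} (hf : Computable f) : ComputablePred fun a => R (f a) := by
  obtain ⟨hd, hc⟩ := hR
  exact ⟨fun a => hd (f a), hc.comp hf⟩

theorem ComputablePred.rePred_exists {α : Type*} [Primcodable α] {R : α × ℕ → Prop}
    (hR : ComputablePred R) : REPred fun a => ∃ n, R (a, n) := by
  obtain ⟨hd, hc⟩ := hR
  have h : Partrec fun a : α => Nat.rfind fun n => Part.some (decide (R (a, n))) :=
    Partrec.rfind hc.partrec.to₂
  refine h.dom_re.of_eq fun a => Nat.rfind_dom.trans ?_
  simp only [Part.mem_some_iff, Part.some_dom, implies_true, and_true]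
  exact exists_congr fun n => eq_comm.trans decide_eq_true_iff

/-! ## The basin of attraction answers the halting problem -/

namespace TuringM

variable {M : TuringM}

/-- A code of the initial configuration. -/
def initCode (w : ℕ) : ℕ := Encodable.encode [0, Nat.pair (Nat.pair w 0) 0, Nat.pair (Nat.pair 1 0) 0]

theorem vecOf_initCode (w : ℕ) : vecOf 3 (initCode w) = M.toPoint (M.init w) := by
  funext i
  rw [vecOf, initCode, Denumerable.ofNat_encode]
  fin_cases i <;> simp [toPoint, init, ratOf_pair, ratOf_zero]

theorem primrec_initCode : Primrec initCode :=
  Primrec.encode.comp (Primrec.list_cons.comp (Primrec.const 0)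
    (Primrec.list_cons.comp (primrec_pair3 Primrec.id (Primrec.const 0) (Primrec.const 0))
      (Primrec.const [Nat.pair (Nat.pair 1 0) 0])))

/-- The set `W` contains the points near an initial configuration exactly if the machine halts on it. -/
def DecidesHalting (M : TuringM) (W : Set (Fin 3 → ℝ)) : Prop :=
  ∀ w x, ‖x - M.toPoint (M.init w)‖ ≤ 1 / 4 → (x ∈ W ↔ M.Reaches (M.init w))

variable {W : Set (Fin 3 → ℝ)}

/-- Non-halting would be recursively enumerable: search the list for a ball of radius greater than
1/8 whose centre is within 1/8 of the initial configuration. Such a ball contains that point, and if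
the machine does not halt, the ball of radius 1/4 around it is listed. -/
theorem DecidesHalting.not_isComputableOpen (hW : M.DecidesHalting W) (hM : M.IsUniversal) :
    ¬ IsComputableOpen W := by
  rintro ⟨-, -, b, s, -, -, hb, hs, -, hlist⟩
  obtain ⟨enc, henc, hrun⟩ := hM.universal
  refine ComputablePred.halting_problem_not_re 0 ?_
  have hprim : PrimrecPred fun a : ℕ × ℕ × ℕ => ‖vecOf 3 a.1 - vecOf 3 a.2.1‖ < (2 : ℝ)⁻¹ ^ 3 ∧
      ratOf (Nat.pair (Nat.pair 1 0) 7) < ratOf a.2.2 :=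
    (primrecPred_vecOf_near 3 Primrec.fst (Primrec.fst.comp Primrec.snd) (Primrec.const 3)).and
      (primrecPred_ratOf_lt (Primrec.const _) (Primrec.snd.comp Primrec.snd))
  have hcode : Computable fun c : Nat.Partrec.Code => initCode (enc c 0) :=
    primrec_initCode.to_comp.comp (henc.comp Computable.id (Computable.const 0))
  have hcomp := hprim.computablePred.comp (f := fun a : Nat.Partrec.Code × ℕ =>
      (b a.2, initCode (enc a.1 0), s a.2))
    ((hb.comp Computable.snd).pair ((hcode.comp Computable.fst).pair (hs.comp Computable.snd)))
  refine hcomp.rePred_exists.of_eq fun c => ?_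
  rw [← (hrun c 0).2]
  simp only [vecOf_initCode (M := M)]
  have h18 : ratOf (Nat.pair (Nat.pair 1 0) 7) = 1 / 8 := by rw [ratOf_pair]; norm_num
  set z := M.toPoint (M.init (enc c 0)) with hz
  rw [h18]
  constructor
  · rintro ⟨n, h1, h2⟩ hr
    have h2' : ((1 / 8 : ℚ) : ℝ) < ratOf (s n) := by exact_mod_cast h2
    have hdis := (hlist (b n) (s n) (lt_trans (by norm_num) h2)).2 ⟨n, rfl, rfl⟩
    refine Set.disjoint_left.1 hdis ?_ ((hW _ z (by simp [hz])).2 hr)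
    rw [mem_closedBall_iff_norm, norm_sub_rev]
    push_cast at h2'
    norm_num at h1
    linarith
  · intro hr
    obtain ⟨q, hq⟩ := exists_ratOf (1 / 4)
    obtain ⟨n, hn1, hn2⟩ := (hlist (initCode (enc c 0)) q (by rw [hq]; norm_num)).1 (by
      rw [Set.disjoint_left]
      intro x hx hxW
      rw [mem_closedBall_iff_norm, hq, vecOf_initCode (M := M)] at hx
      exact hr ((hW _ x (by simpa using hx)).1 hxW))
    refine ⟨n, ?_, by rw [hn2, hq]; norm_num⟩
    rw [hn1, vecOf_initCode (M := M), sub_self, norm_zero]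
    positivity

/-- At an initial configuration the distance is 0 if the machine does not halt, and at least 1/4 if
it does. An approximation with error less than 1/8 separates the cases. As the point is rational, a
constant oracle names it and the run can be carried out without an oracle. -/
theorem DecidesHalting.not_isComputableMap_distMap (hW : M.DecidesHalting W) (hM : M.IsUniversal) :
    ¬ IsComputableMap (distMap Wᶜ) := by
  classical
  rintro ⟨A, hA⟩
  obtain ⟨enc, henc, hrun⟩ := hM.universal
  refine ComputablePred.halting_problem 0 (ComputablePred.of_eq (ComputablePred.not ?_)
    (p := fun c => ¬ ¬ (Nat.Partrec.Code.eval c 0).Dom) fun c => not_not)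
  let p : Nat.Partrec.Code → ℕ := fun c => initCode (enc c 0)
  have hp : Computable p :=
    primrec_initCode.to_comp.comp (henc.comp Computable.id (Computable.const 0))
  let out : Nat.Partrec.Code × ℕ → Option ℕ := fun a => A.run ((List.range a.2).map fun _ => p a.1) 3
  have hout : Computable out := by
    refine A.computable_run.comp ?_ (Computable.const 3)
    have h1 : Primrec fun a : ℕ × ℕ => (List.range a.2).map fun _ => a.1 :=
      Primrec.list_map (Primrec.list_range.comp Primrec.snd) (Primrec.fst.comp Primrec.fst)
    exact h1.to_comp.comp ((hp.comp Computable.fst).pair Computable.snd)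
  have hname : ∀ c, IsPointName (fun _ => p c) (M.toPoint (M.init (enc c 0))) := fun c m => by
    simp only [p, vecOf_initCode (M := M), sub_self, norm_zero]
    positivity
  choose v hv hvd using fun c => hA _ _ (hname c) 3
  have hex : ∀ c, ∃ L, (out (c, L)).isSome := fun c => by
    obtain ⟨L, hL, -⟩ := hv c
    exact ⟨L, by simp only [out, hL, Option.isSome_some]⟩
  have hfind : Computable fun c => Nat.find (hex c) :=
    Computable.find (P := fun c L => (out (c, L)).isSome = true)
      ⟨inferInstance, (Primrec.option_isSome.to_comp.comp hout).of_eq fun a => by simp⟩ hex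
  have hval : ∀ c, (out (c, Nat.find (hex c))).getD 0 = v c := fun c => by
    obtain ⟨L, hL, hmin⟩ := hv c
    have : Nat.find (hex c) = L := by
      refine (Nat.find_eq_iff _).2 ⟨by simp only [out, hL, Option.isSome_some], fun L' hL' => by
        simp only [out, hmin L' hL', Option.isSome_none, Bool.false_eq_true, not_false_eq_true]⟩
    rw [this]
    simp only [out, hL, Option.getD_some]
  have hvc : Computable v := by
    refine Computable.of_eq ?_ hval
    exact Primrec.option_getD.to_comp.comp (hout.comp (Computable.id.pair hfind))
      (Computable.const 0)
  have hprim : PrimrecPred fun a : ℕ => ‖vecOf 1 a - vecOf 1 0‖ < (2 : ℝ)⁻¹ ^ 3 :=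
    primrecPred_vecOf_near 1 Primrec.id (Primrec.const 0) (Primrec.const 3)
  have h0 : vecOf 1 0 = 0 := by
    funext i
    simp [vecOf, ratOf_zero]
  refine (hprim.computablePred.comp hvc).of_eq fun c => ?_
  rw [h0, sub_zero, ← (hrun c 0).2]
  have hd := hvd c
  set z := M.toPoint (M.init (enc c 0)) with hz
  have hzz : ‖z - M.toPoint (M.init (enc c 0))‖ ≤ 1 / 4 := by simp [hz]
  constructor
  · intro hsmall hr
    -- The distance to the empty set is 0 by convention, so this case must be excluded: otherwise
    -- every computation would halt, and the set of non-halting programs would be empty, hence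
    -- enumerable.
    have hne : (Wᶜ).Nonempty := by
      by_contra hcon
      refine ComputablePred.halting_problem_not_re 0 ?_
      have hall : ∀ c, (Nat.Partrec.Code.eval c 0).Dom := fun c' => by
        rw [← (hrun c' 0).2, ← hW _ (M.toPoint (M.init (enc c' 0))) (by simp)]
        by_contra hmem
        exact hcon ⟨_, hmem⟩
      have hf : ComputablePred fun _ : Nat.Partrec.Code => False :=
        ⟨inferInstance, by simpa using Computable.const false⟩
      exact hf.to_re.of_eq fun c' => by simp [hall c']
    have h1 : 1 / 4 ≤ Metric.infDist z Wᶜ := by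
      rw [Metric.le_infDist hne]
      intro y hy
      by_contra hlt
      push Not at hlt
      rw [dist_eq_norm, norm_sub_rev] at hlt
      exact hy ((hW _ y hlt.le).2 hr)
    have h2 : distMap Wᶜ z 0 ≤ ‖distMap Wᶜ z‖ := (le_abs_self _).trans (norm_le_pi_norm (distMap Wᶜ z) 0)
    have h3 := norm_sub_norm_le (distMap Wᶜ z) (vecOf 1 (v c))
    rw [norm_sub_rev] at h3
    have h4 : 1 / 4 ≤ distMap Wᶜ z 0 := h1
    norm_num at hsmall hd
    linarith
  · intro hr
    have hmem : z ∈ Wᶜ := fun h => hr ((hW _ z hzz).1 h)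
    have : distMap Wᶜ z = 0 := by
      funext i
      exact Metric.infDist_zero_of_mem hmem
    rwa [this, sub_zero] at hd

end TuringM


/-! ### Computing the fixed point from a name of the map -/

theorem exists_vecOf_near {d : ℕ} (x : Fin d → ℝ) {ε : ℝ} (hε : 0 < ε) :
    ∃ i, ‖vecOf d i - x‖ < ε := by
  have h : ∀ j, ∃ n, |(ratOf n : ℝ) - x j| < ε := fun j => by
    obtain ⟨q, hq1, hq2⟩ := exists_rat_btwn (show x j - ε < x j by linarith)
    obtain ⟨n, hn⟩ := exists_ratOf q
    exact ⟨n, by rw [hn, abs_lt]; constructor <;> linarith⟩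
  choose n hn using h
  refine ⟨Encodable.encode (List.ofFn n), ?_⟩
  rw [vecOf_encode_ofFn, pi_norm_lt_iff hε]
  exact hn

theorem getD_map_range {φ : ℕ → ℕ} {i L : ℕ} (h : i < L) :
    ((List.range L).map φ).getD i 0 = φ i := by
  rw [List.getD_eq_getElem _ _ (by simpa using h)]
  simp

/-- The fixed point of a map that contracts towards it near `vecOf d q` is computable, uniformly in the
map. -/
theorem exists_machine_fixedPoint {d : ℕ} (q m : ℕ) {κ : ℝ} (hκ : κ < 1) :
    ∃ B : OracleMachine, ∀ (g : (Fin d → ℝ) → (Fin d → ℝ)) (χ : ℕ → ℕ) (p : Fin d → ℝ),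
      IsMapName χ g → ‖p - vecOf d q‖ < (2 : ℝ)⁻¹ ^ m →
      (∀ x, ‖x - vecOf d q‖ < (2 : ℝ)⁻¹ ^ m → ‖g x - p‖ ≤ κ * ‖x - p‖) → B.ComputesPoint χ p := by
  obtain ⟨k, hk⟩ := exists_pow_lt_of_lt_one (show 0 < (1 - κ) / 2 by linarith)
    (show (2 : ℝ)⁻¹ < 1 by norm_num)
  let idx : ℕ → ℕ → ℕ := fun n i => Nat.pair 0 (Nat.pair i (n + k + 1))
  have hidx : Primrec₂ idx := Primrec₂.natPair.comp (Primrec.const 0)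
    (Primrec₂.natPair.comp Primrec.snd (Primrec.succ.comp
      (Primrec.nat_add.comp Primrec.fst (Primrec.const k))))
  -- A candidate is a rational point v of the ball whose approximate image is within 2^(-(n + k)) of
  -- v. Since (1 - κ)‖v - p‖ ≤ ‖v - g v‖, the choice 2^(-k) < (1 - κ)/2 makes every candidate
  -- 2^(-n)-close to p. The first condition says that the needed oracle answer is available.
  let R : (List ℕ × ℕ) × ℕ → Prop := fun a => idx a.1.2 a.2 < a.1.1.length ∧
    ‖vecOf d a.2 - vecOf d q‖ < (2 : ℝ)⁻¹ ^ m ∧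
    ‖vecOf d (a.1.1.getD (idx a.1.2 a.2) 0) - vecOf d a.2‖ < (2 : ℝ)⁻¹ ^ (a.1.2 + k)
  have hR : PrimrecPred R := by
    have hl : Primrec fun a : (List ℕ × ℕ) × ℕ => a.1.1 := Primrec.fst.comp Primrec.fst
    have hn : Primrec fun a : (List ℕ × ℕ) × ℕ => a.1.2 := Primrec.snd.comp Primrec.fst
    have hi : Primrec fun a : (List ℕ × ℕ) × ℕ => idx a.1.2 a.2 := hidx.comp hn Primrec.snd
    exact (Primrec.nat_lt.comp hi (Primrec.list_length.comp hl)).and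
      ((primrecPred_vecOf_near d Primrec.snd (Primrec.const q) (Primrec.const m)).and
        (primrecPred_vecOf_near d ((Primrec.list_getD 0).comp hl hi) Primrec.snd
          (Primrec.nat_add.comp hn (Primrec.const k))))
  obtain ⟨hdec, -⟩ := id hR
  let B : OracleMachine :=
    { run := fun l n => ((List.range l.length).filterMap
        fun i => if R ((l, n), i) then some i else none).head?
      computable_run := by
        refine Primrec₂.to_comp (Primrec.list_head?.comp (Primrec.listFilterMap
          (f := fun a : List ℕ × ℕ => List.range a.1.length)
          (g := fun a i => if R (a, i) then some i else none)
          (Primrec.list_range.comp (Primrec.list_length.comp Primrec.fst)) ?_))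
        exact Primrec.ite hR (Primrec.option_some.comp Primrec.snd) (Primrec.const none) }
  refine ⟨B, fun g χ p hχ hp hg n => ?_⟩
  have hsound : ∀ L i, B.run ((List.range L).map χ) n = some i →
      R (((List.range L).map χ, n), i) := by
    intro L i h
    have h1 := List.mem_of_mem_head? h
    rw [List.mem_filterMap] at h1
    obtain ⟨j, -, hj⟩ := h1
    split_ifs at hj with hRj
    rw [← Option.some_inj.1 hj]
    exact hRj
  have hex : ∃ L, (B.run ((List.range L).map χ) n).isSome := by
    -- The search succeeds at any rational point this close to p: the oracle error 1/2 and the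
    -- distances 1/4 from p to the point and to its image, in units of 2^(-(n + k)), add up to less
    -- than 1.
    obtain ⟨i, hi⟩ := exists_vecOf_near p (ε := min ((2 : ℝ)⁻¹ ^ (n + k + 2))
      ((2 : ℝ)⁻¹ ^ m - ‖p - vecOf d q‖)) (lt_min (by positivity) (by linarith))
    have hi1 := hi.trans_le (min_le_left _ _)
    have hi2 := hi.trans_le (min_le_right _ _)
    have hiq : ‖vecOf d i - vecOf d q‖ < (2 : ℝ)⁻¹ ^ m := by
      have := norm_sub_le_norm_sub_add_norm_sub (vecOf d i) p (vecOf d q)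
      linarith
    refine ⟨idx n i + 1, ?_⟩
    rw [Option.isSome_iff_ne_none]
    intro hnone
    rw [List.head?_eq_none_iff, List.filterMap_eq_nil_iff] at hnone
    have hle : i ≤ idx n i := (Nat.left_le_pair _ _).trans (Nat.right_le_pair _ _)
    have hcon := hnone i (by simpa using hle)
    rw [if_pos] at hcon
    · exact Option.some_ne_none _ hcon
    refine ⟨by simp, hiq, ?_⟩
    simp only
    rw [getD_map_range (Nat.lt_succ_self _)]
    have h1 := hχ.1 i (n + k + 1)
    have h2 := hg _ hiq
    have h3 : ‖g (vecOf d i) - p‖ ≤ ‖vecOf d i - p‖ :=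
      h2.trans (mul_le_of_le_one_left (norm_nonneg _) hκ.le)
    have h4 := norm_sub_le_norm_sub_add_norm_sub (χ (idx n i) |> vecOf d) (g (vecOf d i)) (vecOf d i)
    have h5 := norm_sub_le_norm_sub_add_norm_sub (g (vecOf d i)) p (vecOf d i)
    rw [norm_sub_rev p] at h5
    have e1 : (2 : ℝ)⁻¹ ^ (n + k + 1) = (2 : ℝ)⁻¹ ^ (n + k) / 2 := by rw [pow_succ]; ring
    have e2 : (2 : ℝ)⁻¹ ^ (n + k + 2) = (2 : ℝ)⁻¹ ^ (n + k) / 4 := by rw [pow_add]; ring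
    rw [e1] at h1
    rw [e2] at hi1
    simp only [idx] at h4 ⊢
    linarith
  obtain ⟨v, hv, L, hL⟩ := B.exists_outputs χ n hex
  refine ⟨v, hv, ?_⟩
  obtain ⟨h1, h2, h3⟩ := hsound L v hL
  simp only [List.length_map, List.length_range] at h1 h3
  rw [getD_map_range h1] at h3
  have h4 := hχ.1 v (n + k + 1)
  have h5 := hg _ h2
  have h6 := norm_sub_le_norm_sub_add_norm_sub (vecOf d v) (χ (idx n v) |> vecOf d) p
  have h7 := norm_sub_le_norm_sub_add_norm_sub (χ (idx n v) |> vecOf d) (g (vecOf d v)) p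
  rw [norm_sub_rev (vecOf d v) (vecOf d _)] at h6
  have e1 : (2 : ℝ)⁻¹ ^ (n + k + 1) = (2 : ℝ)⁻¹ ^ n * (2 : ℝ)⁻¹ ^ k / 2 := by
    rw [pow_succ, pow_add]; ring
  have e2 : (2 : ℝ)⁻¹ ^ n * (2 : ℝ)⁻¹ ^ k < (2 : ℝ)⁻¹ ^ n * ((1 - κ) / 2) := by gcongr
  have e3 : 0 < (2 : ℝ)⁻¹ ^ n := by positivity
  rw [e1] at h4
  rw [pow_add] at h3
  simp only [idx] at h6 h7 h3
  have h8 : (1 - κ) * ‖vecOf d v - p‖ < (1 - κ) * (2 : ℝ)⁻¹ ^ n := by nlinarith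
  exact lt_of_mul_lt_mul_left h8 (by linarith)

/-! ## The radius of the neighbourhood -/

/-- The sum of the moduli of continuity of the three partial derivatives on the ball of radius `Q + 2`, at
a precision that suits the contraction constant coded by `l`. -/
def modulusSum (ψ : ℕ → ℕ) (Q l : ℕ) : ℕ :=
  ψ (Nat.pair 1 (Nat.pair 1 (Nat.pair (Q + 2) (l.unpair.2 + 4)))) +
    ψ (Nat.pair 2 (Nat.pair 1 (Nat.pair (Q + 2) (l.unpair.2 + 4)))) +
    ψ (Nat.pair 3 (Nat.pair 1 (Nat.pair (Q + 2) (l.unpair.2 + 4))))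

/-- A code of the radius of the neighbourhood. -/
def radiusCode (m l k : ℕ) : ℕ :=
  Nat.pair (Nat.pair 1 0) ((l.unpair.2 + 1) * 2 ^ (m + 3) * (k.unpair.2 + 1))

/-- The value depends on three oracle entries only. The machine waits until the initial segment is
longer than the sum of their indices, which exceeds none of the lengths needed too early. -/
theorem exists_machine_radius : ∃ A : OracleMachine, ∀ (ψ : ℕ → ℕ) (Q l k : ℕ),
    A.Outputs ψ (Nat.pair Q (Nat.pair l k)) (radiusCode (modulusSum ψ Q l) l k) := by
  let idx : ℕ → ℕ → ℕ := fun j n =>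
    Nat.pair j (Nat.pair 1 (Nat.pair (n.unpair.1 + 2) (n.unpair.2.unpair.1.unpair.2 + 4)))
  have hQ : Primrec fun n : ℕ => n.unpair.1 := Primrec.fst.comp Primrec.unpair
  have hlk : Primrec fun n : ℕ => n.unpair.2 := Primrec.snd.comp Primrec.unpair
  have hl : Primrec fun n : ℕ => n.unpair.2.unpair.1.unpair.2 := hlk.comp (hQ.comp hlk)
  have hk : Primrec fun n : ℕ => n.unpair.2.unpair.2.unpair.2 := hlk.comp (hlk.comp hlk)
  have hidx : ∀ j, Primrec (idx j) := fun j => Primrec₂.natPair.comp (Primrec.const j)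
    (Primrec₂.natPair.comp (Primrec.const 1) (Primrec₂.natPair.comp
      (Primrec.nat_add.comp hQ (Primrec.const 2)) (Primrec.nat_add.comp hl (Primrec.const 4))))
  let msum : List ℕ → ℕ → ℕ := fun p n =>
    p.getD (idx 1 n) 0 + p.getD (idx 2 n) 0 + p.getD (idx 3 n) 0
  have hget : ∀ j, Primrec fun a : List ℕ × ℕ => a.1.getD (idx j a.2) 0 := fun j =>
    (Primrec.list_getD 0).comp Primrec.fst ((hidx j).comp Primrec.snd)
  have hmsum : Primrec fun a : List ℕ × ℕ => msum a.1 a.2 :=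
    Primrec.nat_add.comp (Primrec.nat_add.comp (hget 1) (hget 2)) (hget 3)
  let A : OracleMachine :=
    { run := fun p n => if idx 1 n + idx 2 n + idx 3 n < p.length then
        some (radiusCode (msum p n) n.unpair.2.unpair.1 n.unpair.2.unpair.2) else none
      computable_run := by
        refine Primrec₂.to_comp (Primrec.ite (Primrec.nat_lt.comp ?_
          (Primrec.list_length.comp Primrec.fst)) (Primrec.option_some.comp ?_) (Primrec.const none))
        · exact (Primrec.nat_add.comp (Primrec.nat_add.comp (hidx 1) (hidx 2)) (hidx 3)).comp
            Primrec.snd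
        · refine primrec_pair3 (Primrec.const 1) (Primrec.const 0) (Primrec.nat_mul.comp
            (Primrec.nat_mul.comp (Primrec.succ.comp (hl.comp Primrec.snd)) (primrec_two_pow.comp
              (Primrec.nat_add.comp hmsum (Primrec.const 3))))
            (Primrec.succ.comp (hk.comp Primrec.snd))) }
  refine ⟨A, fun ψ Q l k => ?_⟩
  set n := Nat.pair Q (Nat.pair l k) with hn
  refine ⟨idx 1 n + idx 2 n + idx 3 n + 1, ?_, fun L' hL' => ?_⟩
  · have h1 : msum ((List.range (idx 1 n + idx 2 n + idx 3 n + 1)).map ψ) n = modulusSum ψ Q l := by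
      simp only [msum]
      rw [getD_map_range (by omega), getD_map_range (by omega), getD_map_range (by omega)]
      simp [idx, hn, modulusSum]
    simp only [A]
    rw [if_pos (by simp), h1]
    simp [hn]
  · simp only [A]
    rw [if_neg (by simp; omega)]

theorem opNorm_le_sum_single {d : ℕ} {F : Type*} [NormedAddCommGroup F] [NormedSpace ℝ F]
    (L : (Fin d → ℝ) →L[ℝ] F) : ‖L‖ ≤ ∑ j, ‖L (Pi.single j 1)‖ := by
  refine L.opNorm_le_bound (by positivity) fun x => ?_
  have hx : x = ∑ j, x j • (Pi.single j 1 : Fin d → ℝ) := by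
    simpa using (pi_eq_sum_univ' x)
  calc ‖L x‖ = ‖∑ j, x j • L (Pi.single j 1)‖ := by
        conv_lhs => rw [hx]
        simp
    _ ≤ ∑ j, ‖x j • L (Pi.single j 1)‖ := norm_sum_le _ _
    _ ≤ ∑ j, ‖L (Pi.single j 1)‖ * ‖x‖ := by
        refine Finset.sum_le_sum fun j _ => ?_
        rw [norm_smul, mul_comm]
        gcongr
        exact norm_le_pi_norm x j
    _ = _ := by rw [Finset.sum_mul]

/-- The sum of the three moduli dominates each of them, so every column of the derivative varies by
less than 2^(-(l.unpair.2 + 4)); the operator norm is at most the sum over the columns. -/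
theorem norm_fderiv_sub_le_of_isC1Name {f : (Fin 3 → ℝ) → (Fin 3 → ℝ)} {ψ : ℕ → ℕ}
    (hψ : IsC1Name ψ f) {Q l : ℕ} {x y : Fin 3 → ℝ} (hx : ‖x‖ ≤ (Q + 2 : ℕ)) (hy : ‖y‖ ≤ (Q + 2 : ℕ))
    (hxy : ‖x - y‖ < (2 : ℝ)⁻¹ ^ modulusSum ψ Q l) :
    ‖fderiv ℝ f x - fderiv ℝ f y‖ ≤ 3 * (2 : ℝ)⁻¹ ^ (l.unpair.2 + 4) := by
  refine (opNorm_le_sum_single _).trans ?_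
  have hj : ∀ j : Fin 3, ‖(fderiv ℝ f x - fderiv ℝ f y) (Pi.single j 1)‖ ≤
      (2 : ℝ)⁻¹ ^ (l.unpair.2 + 4) := fun j => by
    refine ((hψ.2 j).2 (Q + 2) (l.unpair.2 + 4) x y hx hy (hxy.trans_le ?_)).le
    refine pow_le_pow_of_le_one (by norm_num) (by norm_num) ?_
    simp only [modulusSum]
    fin_cases j <;> simp <;> omega
  refine (Finset.sum_le_sum fun j _ => hj j).trans (le_of_eq ?_)
  simp

theorem sub_le_of_mem_c1Nhd {f g : (Fin 3 → ℝ) → (Fin 3 → ℝ)} {θ : ℝ} (hf : Differentiable ℝ f)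
    (hg : g ∈ c1Nhd f θ) (x : Fin 3 → ℝ) :
    ‖g x - f x‖ ≤ θ ∧ ‖fderiv ℝ g x‖ ≤ ‖fderiv ℝ f x‖ + θ := by
  obtain ⟨hc, hn⟩ := hg
  have hgd : Differentiable ℝ g := hc.differentiable (by simp)
  have hθ : 0 ≤ θ := by
    by_contra hcon
    rw [ENNReal.ofReal_of_nonpos (by linarith)] at hn
    exact not_lt_zero hn
  have key : ∀ {F : Type} [NormedAddCommGroup F] (z : F), ‖z‖ₑ ≤ c1Norm (fun x => g x - f x) →
      ‖z‖ ≤ θ := by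
    intro F _ z hz
    have := hz.trans hn.le
    rwa [← ofReal_norm, ENNReal.ofReal_le_ofReal_iff hθ] at this
  have h1 : ‖g x - f x‖ ≤ θ :=
    key _ ((le_iSup (fun x => ‖g x - f x‖ₑ) x).trans le_self_add)
  have h2 : ‖fderiv ℝ (fun x => g x - f x) x‖ ≤ θ :=
    key _ ((le_iSup (fun x => ‖fderiv ℝ (fun x => g x - f x) x‖ₑ) x).trans le_add_self)
  rw [fderiv_fun_sub (hgd x) (hf x)] at h2
  refine ⟨h1, ?_⟩
  have := norm_sub_norm_le (fderiv ℝ g x) (fderiv ℝ f x)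
  linarith


theorem ratOf_radiusCode (m l k : ℕ) : ((ratOf (radiusCode m l k) : ℚ) : ℝ) =
    1 / (((l.unpair.2 : ℝ) + 1) * 2 ^ (m + 3) * ((k.unpair.2 : ℝ) + 1) + 1) := by
  rw [radiusCode, ratOf_pair]
  push_cast
  simp

/-- A positive integer numerator is at least 1, so a positive fraction has a lower bound visible in
its denominator. This makes the radius computable without further search. -/
theorem one_div_den_le_of_pos {x : ℤ} {c : ℕ} (h : (0 : ℝ) < x / ((c : ℝ) + 1)) :
    1 / ((c : ℝ) + 1) ≤ x / ((c : ℝ) + 1) := by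
  have hc : (0 : ℝ) < (c : ℝ) + 1 := by positivity
  rw [div_pos_iff_of_pos_right hc] at h
  have h1 : (1 : ℤ) ≤ x := by exact_mod_cast h
  gcongr
  exact_mod_cast h1

theorem one_div_den_le_ratOf {k : ℕ} (h : 0 < ratOf k) :
    1 / ((k.unpair.2 : ℝ) + 1) ≤ (ratOf k : ℝ) := by
  have h' : (0 : ℝ) < ratOf k := by exact_mod_cast h
  have e : (ratOf k : ℝ) =
      (((k.unpair.1.unpair.1 : ℤ) - k.unpair.1.unpair.2 : ℤ) : ℝ) / ((k.unpair.2 : ℝ) + 1) := by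
    rw [ratOf]; push_cast; rfl
  rw [e] at h' ⊢
  exact one_div_den_le_of_pos h'

theorem one_div_den_le_one_sub_ratOf {l : ℕ} (h : ratOf l < 1) :
    1 / ((l.unpair.2 : ℝ) + 1) ≤ 1 - (ratOf l : ℝ) := by
  have h' : (0 : ℝ) < 1 - ratOf l := by
    have : (ratOf l : ℝ) < 1 := by exact_mod_cast h
    linarith
  have e : 1 - (ratOf l : ℝ) = (((l.unpair.2 : ℤ) + 1 - ((l.unpair.1.unpair.1 : ℤ) -
      l.unpair.1.unpair.2) : ℤ) : ℝ) / ((l.unpair.2 : ℝ) + 1) := by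
    rw [ratOf]; push_cast; field_simp
  rw [e] at h' ⊢
  exact one_div_den_le_of_pos h'

/-- The inverse of the radius exceeds the product of the denominators of λ and ρ with 2^(m + 3). The
bounds serve, in order, for the neighbourhood to be nonempty, for trapping in the ball of radius
2^(-(m + 2)), for the sink to be ρ-close to s, and for the perturbed derivative to stay contracting.
-/
theorem radius_bounds {m l k : ℕ} (hl : ratOf l < 1) (hk : 0 < ratOf k) :
    0 < (ratOf (radiusCode m l k) : ℝ) ∧
    (ratOf (radiusCode m l k) : ℝ) < (1 - ratOf l) * (2 : ℝ)⁻¹ ^ (m + 2) ∧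
    (ratOf (radiusCode m l k) : ℝ) < (1 - ratOf l) * ratOf k ∧
    (ratOf (radiusCode m l k) : ℝ) ≤ 1 / ((l.unpair.2 : ℝ) + 1) / 4 := by
  have h1 := one_div_den_le_one_sub_ratOf hl
  have h2 := one_div_den_le_ratOf hk
  rw [ratOf_radiusCode]
  set a : ℝ := (l.unpair.2 : ℝ) + 1
  set b : ℝ := (k.unpair.2 : ℝ) + 1
  have ha : 1 ≤ a := by simp [a]
  have hb : 1 ≤ b := by simp [b]
  have hm : (1 : ℝ) ≤ 2 ^ (m + 2) := one_le_pow₀ (by norm_num)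
  have e : (2 : ℝ) ^ (m + 3) = 2 * 2 ^ (m + 2) := by ring
  have hθ : 1 / (a * 2 ^ (m + 3) * b + 1) < 1 / (a * 2 ^ (m + 3) * b) :=
    one_div_lt_one_div_of_lt (by positivity) (by linarith)
  refine ⟨by positivity, hθ.trans_le ?_, hθ.trans_le ?_, hθ.le.trans ?_⟩
  · calc 1 / (a * 2 ^ (m + 3) * b) ≤ 1 / (a * 2 ^ (m + 2)) := by
          apply one_div_le_one_div_of_le (by positivity)
          rw [e]
          nlinarith [mul_pos (zero_lt_one.trans_le ha) (zero_lt_one.trans_le hm)]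
      _ = 1 / a * (2 : ℝ)⁻¹ ^ (m + 2) := by rw [inv_pow]; field_simp
      _ ≤ _ := by gcongr
  · calc 1 / (a * 2 ^ (m + 3) * b) ≤ 1 / (a * b) := by
          apply one_div_le_one_div_of_le (by positivity)
          rw [e]
          nlinarith [mul_pos (zero_lt_one.trans_le ha) (zero_lt_one.trans_le hb)]
      _ = 1 / a * (1 / b) := by field_simp
      _ ≤ _ := mul_le_mul h1 h2 (by positivity) ((by positivity : (0 : ℝ) ≤ 1 / a).trans h1)
  · rw [div_div]
    apply one_div_le_one_div_of_le (by positivity)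
    have : (4 : ℝ) ≤ 2 ^ (m + 3) := by
      have h0 : (1 : ℝ) ≤ 2 ^ m := one_le_pow₀ (by norm_num)
      rw [pow_add]; linarith
    have h3 : a * 4 ≤ a * 2 ^ (m + 3) := by gcongr
    have h4 : a * 2 ^ (m + 3) ≤ a * 2 ^ (m + 3) * b := le_mul_of_one_le_right (by positivity) hb
    linarith

/-! ### Maps in the neighbourhood follow the machine -/

namespace TuringM

variable {M : TuringM} {f : (Fin 3 → ℝ) → (Fin 3 → ℝ)} {lam : ℚ} {δ ε : ℝ}

theorem norm_toPoint_haltConfig_le (M : TuringM) : ‖M.toPoint M.haltConfig‖ ≤ (M.lastState : ℝ) + 1 := by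
  rw [pi_norm_le_iff_of_nonneg (by positivity)]
  intro i
  fin_cases i
  · simp [toPoint, haltConfig]; positivity
  · simp [toPoint, haltConfig]; positivity
  · simp only [toPoint, haltConfig, Fin.val_last]
    exact (abs_of_nonneg (by positivity : (0 : ℝ) ≤ (M.lastState : ℝ) + 1)).le

/-- Let γ be the inverse of the denominator in the code of λ, so γ ≤ 1 - λ. The derivative of `f`
has norm at most λ at the halting point, varies by at most γ/4 on the small ball, and changes by at
most θ ≤ γ/4 in passing to `g`; hence κ = λ + γ/2 < 1. -/
theorem RobustSimulation.nearSim (hf : M.RobustSimulation f lam δ ε) {ψ : ℕ → ℕ} {l k : ℕ}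
    (hψ : IsC1Name ψ f) (hl : ratOf l = lam) (hk : 0 < ratOf k) {g : (Fin 3 → ℝ) → (Fin 3 → ℝ)}
    (hg : g ∈ c1Nhd f (ratOf (radiusCode (modulusSum ψ M.lastState l) l k))) :
    M.NearSim g lam (lam + 1 / ((l.unpair.2 : ℝ) + 1) / 2)
      ((2 : ℝ)⁻¹ ^ (modulusSum ψ M.lastState l + 2))
      (ratOf (radiusCode (modulusSum ψ M.lastState l) l k)) := by
  set m := modulusSum ψ M.lastState l with hm
  have hl1 : ratOf l < 1 := hl ▸ hf.lam_lt_one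
  obtain ⟨hθ0, hθ1, -, hθ3⟩ := radius_bounds (m := m) hl1 hk
  have hγ := one_div_den_le_one_sub_ratOf hl1
  have hfd : Differentiable ℝ f := fun x => (hf.analytic x (mem_univ x)).differentiableAt
  have hlam0 : (0 : ℝ) ≤ lam := by exact_mod_cast hf.lam_pos.le
  rw [hl] at hθ1 hγ
  have hγ0 : 0 < 1 / ((l.unpair.2 : ℝ) + 1) := by positivity
  have hr2 : (2 : ℝ)⁻¹ ^ (m + 2) = (2 : ℝ)⁻¹ ^ m / 4 := by rw [pow_add]; ring
  have hm1 : (2 : ℝ)⁻¹ ^ m ≤ 1 := pow_le_one₀ (by norm_num) (by norm_num)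
  have hm0 : (0 : ℝ) < (2 : ℝ)⁻¹ ^ m := by positivity
  refine ⟨hg.1.differentiable (by simp), fun c x hx => ?_, fun x hx => ?_, hlam0,
    by exact_mod_cast hf.lam_lt_one, by linarith, by positivity, by linarith, hθ1⟩
  · have h1 := (sub_le_of_mem_c1Nhd hfd hg x).1
    have h2 := hf.contraction c x hx
    rw [hf.extends_step] at h2
    have h3 := norm_sub_le_norm_sub_add_norm_sub (g x) (f x) (M.toPoint (M.step c))
    linarith
  · have h1 := (sub_le_of_mem_c1Nhd hfd hg x).2
    have h2 := norm_fderiv_le_of_contraction hlam0 hfd (hf.contraction M.haltConfig)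
    have hs := M.norm_toPoint_haltConfig_le
    have hxn : ‖x‖ ≤ (M.lastState + 2 : ℕ) := by
      have := norm_sub_norm_le x (M.toPoint M.haltConfig)
      push_cast; linarith
    have h3 := norm_fderiv_sub_le_of_isC1Name hψ hxn (y := M.toPoint M.haltConfig)
      (by push_cast; linarith) (l := l) (by rw [← hm]; linarith)
    have h4 := norm_sub_norm_le (fderiv ℝ f x) (fderiv ℝ f (M.toPoint M.haltConfig))
    have h5 : 3 * (2 : ℝ)⁻¹ ^ (l.unpair.2 + 4) ≤ 1 / ((l.unpair.2 : ℝ) + 1) / 4 := by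
      have h6 : (l.unpair.2 : ℝ) + 1 ≤ 2 ^ l.unpair.2 := by
        exact_mod_cast (Nat.lt_two_pow_self (n := l.unpair.2))
      have h7 : (2 : ℝ)⁻¹ ^ l.unpair.2 ≤ 1 / ((l.unpair.2 : ℝ) + 1) := by
        rw [inv_pow, ← one_div]
        exact one_div_le_one_div_of_le (by positivity) h6
      have h8 : (2 : ℝ)⁻¹ ^ 4 = 1 / 16 := by norm_num
      rw [pow_add, h8]
      linarith
    linarith

open Classical in
/-- A fixed point of `g` within distance `r` of the halting configuration. -/
noncomputable def nearFixedPoint (M : TuringM) (r : ℝ) (g : (Fin 3 → ℝ) → (Fin 3 → ℝ)) : Fin 3 → ℝ :=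
  -- The default 0 never matters on the neighbourhood, where a fixed point exists.
  if h : ∃ p, ‖p - M.toPoint M.haltConfig‖ ≤ r ∧ g p = p then h.choose else 0

theorem NearSim.nearFixedPoint_spec {g : (Fin 3 → ℝ) → (Fin 3 → ℝ)} {lam κ r θ : ℝ}
    (h : M.NearSim g lam κ r θ) :
    ‖M.nearFixedPoint r g - M.toPoint M.haltConfig‖ ≤ r ∧
      g (M.nearFixedPoint r g) = M.nearFixedPoint r g := by
  rw [nearFixedPoint, dif_pos h.exists_fixedPoint]
  exact h.exists_fixedPoint.choose_spec

end TuringM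

/-! ### Proof of the theorem -/

theorem mem_c1Nhd_self {f : (Fin 3 → ℝ) → (Fin 3 → ℝ)} (hf : ContDiff ℝ 1 f) {θ : ℝ} (hθ : 0 < θ) :
    f ∈ c1Nhd f θ := by
  refine ⟨hf, ?_⟩
  have h0 : c1Norm (fun x => f x - f x) = 0 := by
    simp only [c1Norm, sub_self, fderiv_fun_const, Pi.zero_apply, enorm_zero, iSup_const, zero_add]
    exact enorm_zero (E := (Fin 3 → ℝ) →L[ℝ] (Fin 3 → ℝ))
  rw [h0]
  exact ENNReal.ofReal_pos.2 hθ

theorem theorem2 :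
    -- the robust analytic and computable simulation of a universal Turing machine exists
    (∃ M : TuringM, M.IsUniversal ∧
      ∀ δ ε : ℝ, 0 < δ → δ < ε → ε < 1 / 2 →
        ∃ (lam : ℚ) (f : (Fin 3 → ℝ) → (Fin 3 → ℝ)), M.RobustSimulation f lam δ ε) ∧
    -- one oracle machine computes a radius of the neighbourhood for every such map
    (∃ A : OracleMachine,
      ∀ (M : TuringM) (f : (Fin 3 → ℝ) → (Fin 3 → ℝ)) (lam : ℚ) (δ ε : ℝ),
        M.IsUniversal → 0 < δ → δ < ε → ε < 1 / 2 → M.RobustSimulation f lam δ ε →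
        ∀ (ψ : ℕ → ℕ) (l k : ℕ), IsC1Name ψ f → ratOf l = lam → 0 < ratOf k →
          ∃ v, A.Outputs ψ (Nat.pair M.lastState (Nat.pair l k)) v ∧ 0 < ratOf v ∧
            ∃ S : ((Fin 3 → ℝ) → (Fin 3 → ℝ)) → (Fin 3 → ℝ),
              S f = M.toPoint M.haltConfig ∧
              -- the sink is computable from `g`, uniformly on the neighbourhood
              (∃ B : OracleMachine, ∀ g ∈ c1Nhd f (ratOf v), ∀ χ : ℕ → ℕ, IsMapName χ g →
                B.ComputesPoint χ (S g)) ∧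
              ∀ g ∈ c1Nhd f (ratOf v),
                -- `S g` is a sink of `g` near the halting configuration
                IsSink g (S g) ∧
                ‖S g - M.toPoint M.haltConfig‖ < ratOf k ∧
                (∀ x, ‖x - M.toPoint M.haltConfig‖ ≤ 1 / 4 → g x = x → x = S g) ∧
                -- membership in its basin of attraction answers the halting problem
                (∀ c : M.Config, M.Reaches c ↔ M.toPoint c ∈ basin g (S g)) ∧
                -- the basin is an open set which is not computable
                IsOpen (basin g (S g)) ∧
                ¬ IsComputableOpen (basin g (S g)) ∧
                ¬ IsComputableMap (distMap (basin g (S g))ᶜ)) := by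
  refine ⟨?_, ?_⟩
  · obtain ⟨M, hM⟩ := exists_isUniversal
    exact ⟨M, hM, fun δ ε hδ hδε hε => M.exists_robustSimulation hδ hδε hε⟩
  obtain ⟨A, hA⟩ := exists_machine_radius
  refine ⟨A, fun M f lam δ ε hM _ _ _ hf ψ l k hψ hl hk => ⟨_, hA ψ M.lastState l k, ?_⟩⟩
  have hnear := fun g hg => hf.nearSim hψ hl hk (g := g) hg
  set m := modulusSum ψ M.lastState l
  have hl1 : ratOf l < 1 := hl ▸ hf.lam_lt_one
  obtain ⟨hθ0, -, hθ2, -⟩ := radius_bounds (m := m) hl1 hk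
  rw [hl] at hθ2
  have hlam1 : (0 : ℝ) < 1 - lam := by
    have : (lam : ℝ) < 1 := by exact_mod_cast hf.lam_lt_one
    linarith
  have hfC : ContDiff ℝ 1 f := contDiff_iff_contDiffAt.2 fun x =>
    (hf.analytic x (mem_univ x)).contDiffAt
  have hr : (2 : ℝ)⁻¹ ^ (m + 2) ≤ 1 / 4 := (hnear f (mem_c1Nhd_self hfC hθ0)).r_le
  refine ⟨by exact_mod_cast hθ0, M.nearFixedPoint ((2 : ℝ)⁻¹ ^ (m + 2)), ?_, ?_, fun g hg => ?_⟩
  · have h := hnear f (mem_c1Nhd_self hfC hθ0)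
    obtain ⟨h1, h2⟩ := h.nearFixedPoint_spec
    exact h.fixedPoint_unique (h1.trans hr) h2 (by simp) (by rw [hf.extends_step, M.step_haltConfig])
  -- The halting point is rational; its code and the radius are built into the machine, which
  -- therefore does not depend on `g`.
  · obtain ⟨q, hq⟩ : ∃ q, vecOf 3 q = M.toPoint M.haltConfig := by
      choose n hn using fun i : Fin 3 => exists_ratOf
        (![0, 0, (M.lastState : ℚ) + 1] i)
      refine ⟨_, (vecOf_encode_ofFn n).trans (funext fun i => ?_)⟩
      rw [hn]
      fin_cases i <;> simp [TuringM.toPoint, TuringM.haltConfig]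
    obtain ⟨B, hB⟩ := exists_machine_fixedPoint (d := 3) q (m + 2)
      (hnear f (mem_c1Nhd_self hfC hθ0)).κ_lt
    refine ⟨B, fun g hg χ hχ => hB g χ _ hχ ?_ fun x hx => ?_⟩
    · obtain ⟨h1, h2⟩ := (hnear g hg).nearFixedPoint_spec
      rw [hq]
      exact (hnear g hg).fixedPoint_lt (h1.trans hr) h2
    · obtain ⟨h1, h2⟩ := (hnear g hg).nearFixedPoint_spec
      rw [hq] at hx
      have := (hnear g hg).contraction hx.le h1
      rwa [h2] at this
  have h := hnear g hg
  obtain ⟨h1, h2⟩ := h.nearFixedPoint_spec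
  set p := M.nearFixedPoint ((2 : ℝ)⁻¹ ^ (m + 2)) g
  have hdec : M.DecidesHalting (basin g p) := fun w x hx => h.mem_basin_iff h1 h2 hx
  refine ⟨isSink_of_norm_fderiv_lt_one h2 (h.diff p) ((h.deriv p h1).trans_lt h.κ_lt), ?_,
    fun x hx hfix => h.fixedPoint_unique hx hfix (h1.trans hr) h2,
    fun c => (h.mem_basin_iff h1 h2 (by simp)).symm,
    h.isOpen_basin (h.fixedPoint_lt (h1.trans hr) h2) h2,
    hdec.not_isComputableOpen hM, hdec.not_isComputableMap_distMap hM⟩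
  -- A fixed point satisfies (1 - λ)‖p - s‖ ≤ θ < (1 - λ)ρ.
  have h3 := (h.fixedPoint_near (h1.trans hr) h2).trans_lt hθ2
  exact lt_of_mul_lt_mul_left h3 hlam1.le
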